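/- **Setting.** Fix integers $n\ge 1$ and $N\ge 1$. For $m\in\mathbb N$ let $h=h_m=h_0\,2^{-m}$, where $h_0$ is a formal variable, and let $L_m=(h_m\mathbb Z)^n/(4Nh_0\mathbb Z)^n$ be the periodic cubic lattice with step $h_m$ (and $4N2^m$ points in each direction). The cochain algebra at level $m$ consists of the sums $\sum_{I\subseteq[n]}f_I\,dI$ with $f_I$ a scalar function on $L_m$; here $f_I(p)$ is the value on the cube of type $I$ and edge length $2h_m$ centred at $p$. It has the pointwise wedge product $\wedge$ and is graded by $|I|$. Let $(T'_uf)(p)=f(p+h_me_u)$, $(T_uf)(p)=f(p-h_me_u)$, and $\delta(f\,dI)=\sum_u(T'_uf-T_uf)\,du\wedge dI$. The algebra $A_m=A(h_m)$ is obtained by extending scalars from $\mathbb Q$ to $\mathbb Q[[h_0]]$ and adjoining difference quotients $\Delta_u$ with $T'_ua-a=h\,\Delta_ua$ for all cochains $a$. This forces $h$ to be invertible, so $A_m$ is the algebra of cochains with coefficients in the Laurent series field $\mathbb Q((h_0))$. Put $\delta'=\frac1{2h}\delta$. **Cumulant bijection, brackets.** For a graded commutative associative algebra $V$ with differential $d$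 of degree $1$, let $S^*V=\bigoplus_{k\ge1}S^kV$, with $S^kV\subseteq V^{\otimes k}$ spanned by the signed symmetrisations $v_1\wedge\dots\wedge v_k$ and with the (reduced) deconcatenation coproduct; let $p_1:S^*V\to V$ be the projection. The cumulant bijection $\tau:S^*V\to S^*V$ is the coalgebra lift of the multiplication $v_1\wedge\dots\wedge v_k\mapsto v_1\cdots v_k$. Let $d^\wedge$ be the coderivation extending $d$ and $D=\tau^{-1}d^\wedge\tau$; the $k$-bracket is $p_1\circ D|_{S^kV}$. **Divisibility.** A $k$-linear operation from cochains at level $j$ to cochains at level $i$ is *allowed* if each component of its value is a $\mathbb Q[[h_0]]$-linear combination of products, with one factor for each argument $v_a$, of values $(\Delta_{u_1}\cdots\Delta_{u_s}v_a)_J(p)$ with $s\ge0$ and distinct directions $u_1,\dots,u_s$. An operation is *divisible by $h_j^{r}$* if it is $h_j^{r}$ times an allowed operation. (For an operation with rational coefficients: it is a sum of terms each containing at least $r$ differences.) A *binary QFT algebra* is a graded commutative associative algebra with a differential all of whose $(k+1)$-brackets are divisible by $h^{k}$, $k\ge0$. A *binary QFT morphism* is a coalgebra map $S^*V\to S^*W$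 of degree $0$ that preserves the filtration $\bigoplus_{k\le r}S^k$, intertwines the coderivations $D$, and whose $k$-th Taylor coefficient $S^kV\to W$ is divisible by $h^{k-1}$ for every $k\ge1$, $h$ being the scale of the source. **Integration.** For $n=1$, the integration map from the lattice of step $h=h_{m+1}$ to that of step $2h=h_m$ sends a $0$-cochain $f$ to $\bar f$ with $\bar f(x)=f(x)$ if $x\in4h\mathbb Z$ and $\bar f(x)=f(x-h)$ if $x\in2h+4h\mathbb Z$, and sends $f\,dx$ to $g\,dx$ with $g(x)=\frac12(f(x)+f(x-2h))$ if $x\in4h\mathbb Z$ and $g(x)=\frac12(f(x-h)+f(x+h))$ if $x\in2h+4h\mathbb Z$. For general $n$, integration $A_{m+1}\to A_m$ is the $n$-fold tensor power of this map. For $i\le j$ let $\beta_{ij}:A_j\to A_i$ be the composite of the integration maps. **Theorem.** (1) For every $m$, $(A_m,\wedge,\delta')$ is a binary QFT algebra at the scale $h_m$. (2) Integration $A_{m+1}\to A_m$ is a cochain map of degree $0$: it intertwines the operators $\delta'$ at the two levels. (3) For $i\le j$ let $\sigma_{ij}=\tau^{-1}\circ S(\beta_{ij})\circ\tau:S^*A_j\to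 S^*A_i$, where $S(\beta)(v_1\wedge\dots\wedge v_k)=\beta v_1\wedge\dots\wedge\beta v_k$. These maps form an inverse system: $\sigma_{ii}=\mathrm{id}$ and $\sigma_{ij}\circ\sigma_{jl}=\sigma_{il}$ for $i\le j\le l$. The $k$-th Taylor coefficient of $\sigma_{ij}$ is the $k$-th cumulant of $\beta_{ij}$, $$p_1\sigma_{ij}(v_1\wedge\dots\wedge v_k)=\sum_{r=1}^k(-1)^{r-1}(r-1)!\sum_{I_1\cup\dots\cup I_r=[k]}\pm\,\beta_{ij}(v_{I_1})\cdots\beta_{ij}(v_{I_r}),$$ where the inner sum is over the unordered partitions of $[k]$ into $r$ non-empty blocks, $v_I$ is the product of the $v_a$, $a\in I$, in increasing order, and $\pm$ is the Koszul sign of the reordering. It is divisible by $h_j^{k-1}$. Every $\sigma_{ij}$ is a binary QFT morphism from $(A_j,\wedge,\delta')$ to $(A_i,\wedge,\delta')$. -/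

import Mathlib

open scoped TensorProduct PowerSeries LaurentSeries

noncomputable section

namespace LatticeQFT

/-! ### The tensor coalgebra, the graded symmetric coalgebra and the cumulant bijection

`V` is an associative `K`-algebra with a grading `𝒱 : ℕ → Submodule K V`.  The coalgebra
`S^*V = ⨁_{k ≥ 1} S^k V` is realised inside the tensor coalgebra: `S^k V ⊆ V^{⊗ k}` is
spanned by the signed symmetrisations `v₁ ∧ … ∧ v_k`.  All structure maps are given on all
of `TensorAlgebra K V`, where they carry no signs, and are then restricted to `S^*V`. -/

section General

variable {K : Type*} [Field K] {V : Type*} [Ring V] [Algebra K V]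
  {W : Type*} [Ring W] [Algebra K W]

/-- The linear map on `TensorAlgebra K V` with prescribed multilinear values
`φ k (x₁, …, x_k)` on `x₁ ⊗ ⋯ ⊗ x_k`, for every `k`. -/
def liftWords {X : Type*} [AddCommGroup X] [Module K X]
    (φ : ∀ k : ℕ, MultilinearMap K (fun _ : Fin k => V) X) : TensorAlgebra K V →ₗ[K] X :=
  DirectSum.toModule K ℕ X (fun k => PiTensorProduct.lift (φ k)) ∘ₗ
    (TensorAlgebra.equivDirectSum (R := K) (M := V)).toLinearMap

theorem liftWords_tprod {X : Type*} [AddCommGroup X] [Module K X]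
    (φ : ∀ k : ℕ, MultilinearMap K (fun _ : Fin k => V) X) (k : ℕ) (x : Fin k → V) :
    liftWords φ (TensorAlgebra.tprod K V k x) = φ k x := by
  simp only [liftWords, LinearMap.comp_apply]
  have : (TensorAlgebra.equivDirectSum (R := K) (M := V)).toLinearMap
      (TensorAlgebra.tprod K V k x) =
      DirectSum.of (fun n => TensorPower K n V) k (PiTensorProduct.tprod K x) :=
    TensorAlgebra.toDirectSum_tensorPower_tprod x
  rw [this]
  erw [DirectSum.toModule_lof]
  simp

/-- The words of length at most `r`. -/
def lengthLE (K : Type*) [Field K] (V : Type*) [Ring V] [Algebra K V] (r : ℕ) :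
    Submodule K (TensorAlgebra K V) :=
  Submodule.span K {t | ∃ k ≤ r, ∃ x : Fin k → V, t = TensorAlgebra.tprod K V k x}

/-- The reduced deconcatenation coproduct
`x₁ ⊗ ⋯ ⊗ x_k ↦ ∑_{0 < i < k} (x₁ ⊗ ⋯ ⊗ x_i) ⊗ (x_{i+1} ⊗ ⋯ ⊗ x_k)`. -/
def coproduct (K : Type*) [Field K] (V : Type*) [Ring V] [Algebra K V] :
    TensorAlgebra K V →ₗ[K] TensorAlgebra K V ⊗[K] TensorAlgebra K V :=
  liftWords fun k => ∑ i : Fin (k - 1),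
    ((TensorAlgebra.tprod K V (i + 1)).domCoprod
      (TensorAlgebra.tprod K V (k - (i + 1)))).domDomCongr
        (finSumFinEquiv.trans (finCongr (by omega : (i : ℕ) + 1 + (k - (i + 1)) = k)))

/-- The sign `∏ (-1)^{|x_i| |x_j|}` over the pairs `j < i` that `π` puts in the opposite
order, for elements of degrees `d`. -/
def permSign {k : ℕ} (d : Fin k → ℕ) (π : Equiv.Perm (Fin k)) : ℤ :=
  ∏ i, ∏ j, if j < i ∧ π.symm i < π.symm j then (-1) ^ (d i * d j) else 1

/-- `x₁ ∧ … ∧ x_k` for homogeneous elements `x_i` of degrees `d i`. -/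
def wedge (K : Type*) [Field K] {V : Type*} [Ring V] [Algebra K V] {k : ℕ}
    (d : Fin k → ℕ) (x : Fin k → V) : TensorAlgebra K V :=
  ∑ π : Equiv.Perm (Fin k), permSign d π • TensorAlgebra.tprod K V k (x ∘ π)

/-- `S^*V = ⨁_{k ≥ 1} S^k V`. -/
def Sym (𝒱 : ℕ → Submodule K V) : Submodule K (TensorAlgebra K V) :=
  Submodule.span K {t | ∃ (k : ℕ) (d : Fin (k + 1) → ℕ) (x : Fin (k + 1) → V),
    (∀ i, x i ∈ 𝒱 (d i)) ∧ t = wedge K d x}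

/-- `x₁ ∧ … ∧ x_{k+1}` as an element of `S^*V`. -/
def symWedge (𝒱 : ℕ → Submodule K V) {k : ℕ} (d : Fin (k + 1) → ℕ) (x : Fin (k + 1) → V)
    (hx : ∀ i, x i ∈ 𝒱 (d i)) : Sym 𝒱 :=
  ⟨wedge K d x, Submodule.subset_span ⟨k, d, x, hx, rfl⟩⟩

/-- The cumulant map `τ`: the coalgebra lift of the multiplication
`τ₁ (v₁ ∧ … ∧ v_k) = v₁ ⋯ v_k`, that is `τ = ∑_r τ₁^{⊗ r} ∘ Δ^{r-1}`.
On a word of length `k` the map `τ₁` is `1/k!` times the product of the letters, because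
`v₁ ∧ … ∧ v_k` is the sum of `k!` words with the same signed product. -/
def cumulantMap (K : Type*) [Field K] (V : Type*) [Ring V] [Algebra K V] :
    TensorAlgebra K V →ₗ[K] TensorAlgebra K V :=
  liftWords fun k => ∑ c : Composition k,
    (∏ j, ((c.blocksFun j).factorial : K)⁻¹) •
      ((TensorAlgebra.tprod K V c.length).compMultilinearMap
        (fun j => MultilinearMap.mkPiAlgebraFin K (c.blocksFun j) V)).domDomCongr
          c.blocksFinEquiv

theorem cumulantMap_tprod (k : ℕ) (x : Fin k → V) :
    cumulantMap K V (TensorAlgebra.tprod K V k x) = ∑ c : Composition k,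
      (∏ j, ((c.blocksFun j).factorial : K)⁻¹) • TensorAlgebra.tprod K V c.length
        (fun j => (List.ofFn (fun a => x (c.embedding j a))).prod) := by
  simp only [cumulantMap, liftWords_tprod, sum_apply, smul_apply,
    MultilinearMap.domDomCongr_apply, MultilinearMap.compMultilinearMap_apply,
    MultilinearMap.mkPiAlgebraFin_apply]
  rfl

theorem cumulantMap_sub_mem (k : ℕ) (x : Fin (k + 1) → V) :
    cumulantMap K V (TensorAlgebra.tprod K V (k + 1) x) - TensorAlgebra.tprod K V (k + 1) x
      ∈ lengthLE K V k := by
  classical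
  rw [cumulantMap_tprod, ← Finset.add_sum_erase _ _ (Finset.mem_univ (Composition.ones (k + 1)))]
  have h1 : ∀ j, (Composition.ones (k + 1)).blocksFun j = 1 := Composition.ones_blocksFun _
  have key : TensorAlgebra.tprod K V (Composition.ones (k + 1)).length
        (fun j => (List.ofFn
          (fun a => x ((Composition.ones (k + 1)).embedding j a))).prod)
      = TensorAlgebra.tprod K V (k + 1) x := by
    rw [TensorAlgebra.tprod_apply, TensorAlgebra.tprod_apply,
      List.ofFn_congr (Composition.ones_length (k + 1))]
    congr 2
    funext i
    congr 1
    rw [List.ofFn_congr (h1 _)]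
    simp only [List.ofFn_succ, List.ofFn_zero, List.prod_cons, List.prod_nil, mul_one]
    congr 1
    have := Composition.ones_embedding (Fin.cast (Composition.ones_length (k + 1)).symm i)
      (by rw [h1]; exact Nat.one_pos)
    rw [show (Fin.cast (h1 (Fin.cast (Composition.ones_length (k + 1)).symm i)).symm 0)
      = ⟨0, by rw [h1]; exact Nat.one_pos⟩ from Fin.ext rfl, this]
    rfl
  rw [key]
  simp only [h1, Nat.factorial_one, Nat.cast_one, inv_one, Finset.prod_const_one, one_smul,
    add_sub_cancel_left]
  refine Submodule.sum_mem _ fun c hc => Submodule.smul_mem _ _ (Submodule.subset_span ?_)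
  refine ⟨c.length, ?_, _, rfl⟩
  have hne := Finset.ne_of_mem_erase hc
  have h2 := c.length_le
  have h3 : c.length ≠ k + 1 := fun h => hne (Composition.eq_ones_iff_length.mpr h)
  omega

theorem cumulantMap_tprod_zero (x : Fin 0 → V) :
    cumulantMap K V (TensorAlgebra.tprod K V 0 x) = TensorAlgebra.tprod K V 0 x := by
  have h0 : ∀ c : Composition 0, c.length = 0 := fun c => Nat.le_zero.mp c.length_le
  rw [cumulantMap_tprod, Fintype.sum_eq_single (Composition.ones 0) (fun c hc =>
    absurd (Composition.eq_ones_iff_length.mpr (h0 c)) hc)]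
  simp only [TensorAlgebra.tprod_apply]
  rw [List.ofFn_congr (h0 _)]
  have : IsEmpty (Fin (Composition.ones 0).length) := by rw [h0]; infer_instance
  simp

theorem lengthLE_mono {r s : ℕ} (h : r ≤ s) : lengthLE K V r ≤ lengthLE K V s :=
  Submodule.span_mono fun _ ⟨k, hk, x, hx⟩ => ⟨k, hk.trans h, x, hx⟩

theorem cumulantMap_sub_mem_of_mem (r : ℕ) (t : TensorAlgebra K V)
    (ht : t ∈ lengthLE K V (r + 1)) : cumulantMap K V t - t ∈ lengthLE K V r := by
  have : lengthLE K V (r + 1) ≤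
      (lengthLE K V r).comap (cumulantMap K V - LinearMap.id) := by
    refine Submodule.span_le.mpr ?_
    rintro _ ⟨k, hk, x, rfl⟩
    change cumulantMap K V _ - _ ∈ lengthLE K V r
    rcases k with _ | k
    · have h0 : cumulantMap K V (TensorAlgebra.tprod K V 0 x) = TensorAlgebra.tprod K V 0 x :=
        cumulantMap_tprod_zero x
      change cumulantMap K V _ - TensorAlgebra.tprod K V 0 x ∈ lengthLE K V r
      rw [h0, sub_self]
      exact Submodule.zero_mem _
    · exact lengthLE_mono (by omega) (cumulantMap_sub_mem k x)
  exact this ht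

theorem cumulantMap_eq_of_mem_zero (t : TensorAlgebra K V) (ht : t ∈ lengthLE K V 0) :
    cumulantMap K V t = t := by
  have : lengthLE K V 0 ≤ LinearMap.eqLocus (cumulantMap K V) LinearMap.id := by
    refine Submodule.span_le.mpr ?_
    rintro _ ⟨k, hk, x, rfl⟩
    obtain rfl : k = 0 := by omega
    exact cumulantMap_tprod_zero x
  exact this ht

theorem exists_mem_lengthLE (t : TensorAlgebra K V) : ∃ r, t ∈ lengthLE K V r := by
  induction t using TensorAlgebra.induction with
  | algebraMap a =>
    refine ⟨0, ?_⟩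
    rw [Algebra.algebraMap_eq_smul_one]
    exact Submodule.smul_mem _ _ (Submodule.subset_span ⟨0, le_rfl, Fin.elim0, by
      simp [TensorAlgebra.tprod_apply]⟩)
  | ι v =>
    exact ⟨1, Submodule.subset_span ⟨1, le_rfl, fun _ => v, by
      simp [TensorAlgebra.tprod_apply]⟩⟩
  | mul a b ha hb =>
    obtain ⟨r, hr⟩ := ha
    obtain ⟨s, hs⟩ := hb
    refine ⟨r + s, ?_⟩
    have : lengthLE K V r * lengthLE K V s ≤ lengthLE K V (r + s) := by
      rw [lengthLE, lengthLE, Submodule.span_mul_span]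
      refine Submodule.span_le.mpr ?_
      rintro _ ⟨_, ⟨k, hk, x, rfl⟩, _, ⟨l, hl, y, rfl⟩, rfl⟩
      refine Submodule.subset_span ⟨k + l, by omega, Fin.append x y, ?_⟩
      simp only [TensorAlgebra.tprod_apply, ← List.prod_append, ← List.ofFn_fin_append]
      congr 2
      funext i
      refine Fin.addCases (fun i => ?_) (fun i => ?_) i <;> simp
    exact this (Submodule.mul_mem_mul hr hs)
  | add a b ha hb =>
    obtain ⟨r, hr⟩ := ha
    obtain ⟨s, hs⟩ := hb
    exact ⟨max r s, Submodule.add_mem _ (lengthLE_mono (le_max_left _ _) hr)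
      (lengthLE_mono (le_max_right _ _) hs)⟩

theorem cumulantMap_bijective : Function.Bijective (cumulantMap K V) := by
  have inj : ∀ r, ∀ t ∈ lengthLE K V r, cumulantMap K V t = 0 → t = 0 := by
    intro r
    induction r with
    | zero => intro t ht h; rw [← h, cumulantMap_eq_of_mem_zero t ht]
    | succ r ih =>
      intro t ht h
      have := cumulantMap_sub_mem_of_mem r t ht
      rw [h, zero_sub, Submodule.neg_mem_iff] at this
      exact ih t this h
  have surj : ∀ r, ∀ t ∈ lengthLE K V r, ∃ s, cumulantMap K V s = t := by
    intro r
    induction r with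
    | zero => intro t ht; exact ⟨t, cumulantMap_eq_of_mem_zero t ht⟩
    | succ r ih =>
      intro t ht
      obtain ⟨s, hs⟩ := ih _ (cumulantMap_sub_mem_of_mem r t ht)
      exact ⟨t - s, by rw [map_sub, hs]; abel⟩
  constructor
  · rw [injective_iff_map_eq_zero]
    intro t h
    obtain ⟨r, hr⟩ := exists_mem_lengthLE t
    exact inj r t hr h
  · intro t
    obtain ⟨r, hr⟩ := exists_mem_lengthLE t
    exact surj r t hr

/-- The cumulant bijection `τ`. -/
def cumulantEquiv (K : Type*) [Field K] (V : Type*) [Ring V] [Algebra K V] :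
    TensorAlgebra K V ≃ₗ[K] TensorAlgebra K V :=
  LinearEquiv.ofBijective (cumulantMap K V) cumulantMap_bijective

/-- The coderivation `∂^∧` extending `∂`,
`x₁ ⊗ ⋯ ⊗ x_k ↦ ∑_i (-1)^{|x₁| + ⋯ + |x_{i-1}|} x₁ ⊗ ⋯ ⊗ ∂ x_i ⊗ ⋯ ⊗ x_k`;
here `s` is the sign involution `s v = (-1)^{|v|} v`. -/
def coderivationExt (s del : V →ₗ[K] V) : TensorAlgebra K V →ₗ[K] TensorAlgebra K V :=
  liftWords fun k => ∑ i : Fin k, (TensorAlgebra.tprod K V k).compLinearMap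
    (fun j => if j < i then s else if j = i then del else LinearMap.id)

/-- The coderivation `D = τ⁻¹ ∘ ∂^∧ ∘ τ`. -/
def cumulantCoderivation (s del : V →ₗ[K] V) : TensorAlgebra K V →ₗ[K] TensorAlgebra K V :=
  (cumulantEquiv K V).symm.toLinearMap ∘ₗ coderivationExt s del ∘ₗ cumulantMap K V

/-- `x₁ ⊗ ⋯ ⊗ x_k ↦ f x₁ ⊗ ⋯ ⊗ f x_k`. -/
def tensorMap (f : V →ₗ[K] W) : TensorAlgebra K V →ₐ[K] TensorAlgebra K W :=
  TensorAlgebra.lift K (TensorAlgebra.ι K ∘ₗ f)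

/-- The map `σ = τ̄⁻¹ ∘ S(f) ∘ τ` induced by a linear map `f : V → W`. -/
def cumulantConj (f : V →ₗ[K] W) : TensorAlgebra K V →ₗ[K] TensorAlgebra K W :=
  (cumulantEquiv K W).symm.toLinearMap ∘ₗ (tensorMap f).toLinearMap ∘ₗ cumulantMap K V

/-- The projection `p₁` of the tensor coalgebra to the words of length one. -/
def proj₁ (K : Type*) [Field K] (V : Type*) [Ring V] [Algebra K V] :
    TensorAlgebra K V →ₗ[K] V :=
  TensorAlgebra.ιInv

/-- The sign acquired in passing from `v₁ ∧ … ∧ v_k` to `v_{I₁} ∧ … ∧ v_{I_r}`, where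
`I₁, …, I_r` are the blocks of the partition `c` and `v_i` has degree `d i`. -/
def partitionSign {k : ℕ} (d : Fin k → ℕ) (c : OrderedFinpartition k) : ℤ :=
  ∏ i, ∏ j, if j < i ∧ c.index i < c.index j then (-1) ^ (d i * d j) else 1

/-- The `k`-th (graded commutative) cumulant of the linear map `f`, evaluated at homogeneous
elements `v_i` of degrees `d i`:
`∑_r (-1)^{r-1} (r-1)! ∑_{I₁ ∪ ⋯ ∪ I_r = [k]} ± f(v_{I₁}) ⋯ f(v_{I_r})`,
where the inner sum is over the (unordered) partitions of `[k]` into `r` non-empty blocks and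
`f(v_I)` is the value of `f` on the product of the `v_i`, `i ∈ I`, in increasing order. -/
def cumulant (f : V →ₗ[K] W) {k : ℕ} (d : Fin k → ℕ) (v : Fin k → V) : W :=
  ∑ c : OrderedFinpartition k,
    ((-1) ^ (c.length - 1) * ((c.length - 1).factorial : ℤ) * partitionSign d c) •
      (List.ofFn fun j => f (List.ofFn fun a => v (c.emb j a)).prod).prod

end General

/-! ### Binary QFT algebras and their morphisms

The formal variable is `X`.  Every `ℚ⟦X⟧`-algebra below is also an algebra over the Laurent
series `ℚ⸨X⸩` (see `isUnit_of_difference_quotients` for the reason), so that tensor powers over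
`ℚ⟦X⟧` and over `ℚ⸨X⸩` are the same.  Divisibility by powers of the scale refers to a given
`ℚ⟦X⟧`-module `O k` of allowed operations with `k` arguments: an operation is divisible by
`h ^ j` if it is `h ^ j` times an allowed one. -/

section BinaryQFT

variable {V : Type*} [Ring V] [Algebra ℚ⸨X⸩ V] {W : Type*} [Ring W] [Algebra ℚ⸨X⸩ W]
  [Algebra ℚ⟦X⟧ V] [IsScalarTower ℚ⟦X⟧ ℚ⸨X⸩ V] [Algebra ℚ⟦X⟧ W] [IsScalarTower ℚ⟦X⟧ ℚ⸨X⸩ W]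

/-- `(V, del)` with the grading `𝒱` is a binary QFT algebra with respect to the scale `h` and
the allowed operations `O`; `s` is the sign involution `v ↦ (-1)^{|v|} v`. -/
structure IsBinaryQFTAlgebra (𝒱 : ℕ → Submodule ℚ⸨X⸩ V) (s del : V →ₗ[ℚ⸨X⸩] V)
    (O : ∀ k : ℕ, Submodule ℚ⟦X⟧ ((Fin k → V) → V)) (h : ℚ⸨X⸩) : Prop where
  /-- `V` is a graded algebra. -/
  isInternal : DirectSum.IsInternal 𝒱
  one_mem : (1 : V) ∈ 𝒱 0
  mul_mem : ∀ d e, ∀ v ∈ 𝒱 d, ∀ w ∈ 𝒱 e, v * w ∈ 𝒱 (d + e)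
  /-- The product is graded commutative. -/
  graded_comm : ∀ d e, ∀ v ∈ 𝒱 d, ∀ w ∈ 𝒱 e, w * v = (-1 : ℤ) ^ (d * e) • (v * w)
  sign_apply : ∀ d, ∀ v ∈ 𝒱 d, s v = (-1 : ℤ) ^ d • v
  /-- `del` is a differential of degree one. -/
  del_mem : ∀ d, ∀ v ∈ 𝒱 d, del v ∈ 𝒱 (d + 1)
  del_del : del ∘ₗ del = 0
  /-- The cumulant map restricts to a bijection of `S^*V`. -/
  map_cumulantMap : (Sym 𝒱).map (cumulantMap ℚ⸨X⸩ V) = Sym 𝒱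
  /-- `D` restricts to a coderivation of square zero of `S^*V`. -/
  coder_mem : ∀ x ∈ Sym 𝒱, cumulantCoderivation s del x ∈ Sym 𝒱
  coder_coproduct : ∀ x ∈ Sym 𝒱, coproduct ℚ⸨X⸩ V (cumulantCoderivation s del x) =
    TensorProduct.map (cumulantCoderivation s del) LinearMap.id (coproduct ℚ⸨X⸩ V x) +
      TensorProduct.map (tensorMap s).toLinearMap (cumulantCoderivation s del)
        (coproduct ℚ⸨X⸩ V x)
  coder_coder : ∀ x ∈ Sym 𝒱, cumulantCoderivation s del (cumulantCoderivation s del x) = 0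
  /-- The `(k+1)`-bracket `p₁ ∘ D : S^{k+1} V → V` is divisible by `h ^ k`. -/
  bracket_divisible : ∀ (k : ℕ) (d : Fin (k + 1) → ℕ), ∃ φ ∈ O (k + 1),
    ∀ v : Fin (k + 1) → V, (∀ i, v i ∈ 𝒱 (d i)) →
      proj₁ ℚ⸨X⸩ V (cumulantCoderivation s del (wedge ℚ⸨X⸩ d v)) = h ^ k • φ v

/-- `F : S^*V → S^*W` is a morphism of binary QFT algebras from `(V, del)` to `(W, del')`, with
respect to the scale `h` and the allowed operations `O` from `V` to `W`. -/
structure IsBinaryQFTMorphism (𝒱 : ℕ → Submodule ℚ⸨X⸩ V) (s del : V →ₗ[ℚ⸨X⸩] V)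
    (𝒲 : ℕ → Submodule ℚ⸨X⸩ W) (s' del' : W →ₗ[ℚ⸨X⸩] W)
    (O : ∀ k : ℕ, Submodule ℚ⟦X⟧ ((Fin k → V) → W)) (h : ℚ⸨X⸩)
    (F : Sym 𝒱 →ₗ[ℚ⸨X⸩] Sym 𝒲) : Prop where
  /-- `F` is a coalgebra map: `(F ⊗ F) ∘ Δ = Δ ∘ F`, where `Δ x` lies in `S^*V ⊗ S^*V`. -/
  coalgebra : ∀ x : Sym 𝒱, ∃ z : Sym 𝒱 ⊗[ℚ⸨X⸩] Sym 𝒱,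
    TensorProduct.map (Sym 𝒱).subtype (Sym 𝒱).subtype z = coproduct ℚ⸨X⸩ V x ∧
    TensorProduct.map ((Sym 𝒲).subtype ∘ₗ F) ((Sym 𝒲).subtype ∘ₗ F) z =
      coproduct ℚ⸨X⸩ W (F x)
  /-- `F` preserves the monomial filtration. -/
  filtration : ∀ (r : ℕ) (x : Sym 𝒱), (x : TensorAlgebra ℚ⸨X⸩ V) ∈ lengthLE ℚ⸨X⸩ V r →
    (F x : TensorAlgebra ℚ⸨X⸩ W) ∈ lengthLE ℚ⸨X⸩ W r
  /-- `F ∘ D = D' ∘ F`. -/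
  intertwines : ∀ x : Sym 𝒱, ∃ y : Sym 𝒱,
    (y : TensorAlgebra ℚ⸨X⸩ V) = cumulantCoderivation s del x ∧
    (F y : TensorAlgebra ℚ⸨X⸩ W) = cumulantCoderivation s' del' (F x)
  /-- The Taylor coefficients of `F` preserve degrees. -/
  degree : ∀ (k : ℕ) (d : Fin (k + 1) → ℕ) (v : Fin (k + 1) → V) (hv : ∀ i, v i ∈ 𝒱 (d i)),
    proj₁ ℚ⸨X⸩ W (F (symWedge 𝒱 d v hv)) ∈ 𝒲 (∑ i, d i)
  /-- The `(k+1)`-st Taylor coefficient `S^{k+1} V → W` of `F` is divisible by `h ^ k`. -/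
  divisible : ∀ (k : ℕ) (d : Fin (k + 1) → ℕ), ∃ φ ∈ O (k + 1),
    ∀ (v : Fin (k + 1) → V) (hv : ∀ i, v i ∈ 𝒱 (d i)),
      proj₁ ℚ⸨X⸩ W (F (symWedge 𝒱 d v hv)) = h ^ k • φ v

end BinaryQFT

/-! ### Cochains on periodic cubical lattices -/

section Lattice

/-- The exterior algebra `∧^* K^n` in the basis `dI`, `I ⊆ {1, …, n}`. -/
def Ext (K : Type*) (n : ℕ) : Type _ := Finset (Fin n) → K

/-- The sign with `dJ ∧ dL = ± d(J ∪ L)` for disjoint `J`, `L`. -/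
def wedgeSign {n : ℕ} (J L : Finset (Fin n)) : ℤ :=
  (-1) ^ ((J ×ˢ L).filter fun p => p.2 < p.1).card

instance (K : Type*) [Field K] (n : ℕ) : AddCommGroup (Ext K n) :=
  inferInstanceAs (AddCommGroup (Finset (Fin n) → K))

instance (K : Type*) [Field K] (n : ℕ) : One (Ext K n) := ⟨fun I => if I = ∅ then 1 else 0⟩

/-- The wedge product. -/
instance (K : Type*) [Field K] (n : ℕ) : Mul (Ext K n) :=
  ⟨fun f g I => ∑ J ∈ I.powerset, wedgeSign J (I \ J) • (f J * g (I \ J))⟩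

theorem Ext.mul_apply {K : Type*} [Field K] {n : ℕ} (f g : Ext K n) (I : Finset (Fin n)) :
    (f * g) I = ∑ J ∈ I.powerset, wedgeSign J (I \ J) • (f J * g (I \ J)) := rfl

theorem Ext.one_apply {K : Type*} [Field K] {n : ℕ} (I : Finset (Fin n)) :
    (1 : Ext K n) I = if I = ∅ then 1 else 0 := rfl

theorem Ext.add_apply {K : Type*} [Field K] {n : ℕ} (f g : Ext K n) (I : Finset (Fin n)) :
    (f + g) I = f I + g I := rfl

theorem wedgeSign_union_left {n : ℕ} {J L : Finset (Fin n)} (h : Disjoint J L)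
    (P : Finset (Fin n)) : wedgeSign (J ∪ L) P = wedgeSign J P * wedgeSign L P := by
  rw [wedgeSign, wedgeSign, wedgeSign, ← pow_add, Finset.union_product, Finset.filter_union,
    Finset.card_union_of_disjoint]
  exact Finset.disjoint_filter_filter (Finset.disjoint_product.mpr (Or.inl h))

theorem wedgeSign_union_right {n : ℕ} {J L : Finset (Fin n)} (h : Disjoint J L)
    (P : Finset (Fin n)) : wedgeSign P (J ∪ L) = wedgeSign P J * wedgeSign P L := by
  rw [wedgeSign, wedgeSign, wedgeSign, ← pow_add, Finset.product_union, Finset.filter_union,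
    Finset.card_union_of_disjoint]
  exact Finset.disjoint_filter_filter (Finset.disjoint_product.mpr (Or.inr h))

theorem Ext.mul_assoc {K : Type*} [Field K] {n : ℕ} (f g e : Ext K n) :
    f * g * e = f * (g * e) := by
  funext I
  simp only [Ext.mul_apply, Finset.sum_mul, Finset.mul_sum, Finset.smul_sum]
  rw [Finset.sum_sigma', Finset.sum_sigma']
  refine Finset.sum_bij' (fun p _ => ⟨p.2, p.1 \ p.2⟩) (fun p _ => ⟨p.1 ∪ p.2, p.1⟩)
    ?_ ?_ ?_ ?_ ?_
  · rintro ⟨J, L⟩ h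
    simp only [Finset.mem_sigma, Finset.mem_powerset] at h ⊢
    exact ⟨h.2.trans h.1, Finset.sdiff_subset_sdiff h.1 le_rfl⟩
  · rintro ⟨J, L⟩ h
    simp only [Finset.mem_sigma, Finset.mem_powerset] at h ⊢
    exact ⟨Finset.union_subset h.1 (h.2.trans Finset.sdiff_subset), Finset.subset_union_left⟩
  · rintro ⟨J, L⟩ h
    simp only [Finset.mem_sigma, Finset.mem_powerset] at h
    simp [Finset.union_sdiff_of_subset h.2]
  · rintro ⟨J, L⟩ h
    simp only [Finset.mem_sigma, Finset.mem_powerset] at h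
    have : Disjoint J L := (Finset.disjoint_sdiff).mono_right h.2
    simp [Finset.union_sdiff_cancel_left this]
  · rintro ⟨J, L⟩ h
    simp only [Finset.mem_sigma, Finset.mem_powerset] at h
    obtain ⟨hJ, hL⟩ := h
    have e1 : (I \ L) \ (J \ L) = I \ J := by
      ext a
      have := @hL a
      simp only [Finset.mem_sdiff]
      tauto
    have e2 : I \ L = (J \ L) ∪ (I \ J) := by
      ext a
      have := @hL a
      have := @hJ a
      simp only [Finset.mem_sdiff, Finset.mem_union]
      tauto
    have d1 : Disjoint (J \ L) (I \ J) := by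
      rw [Finset.disjoint_left]
      intro a
      simp only [Finset.mem_sdiff]
      tauto
    have s1 : wedgeSign J (I \ J) = wedgeSign L (I \ J) * wedgeSign (J \ L) (I \ J) := by
      rw [← wedgeSign_union_left Finset.disjoint_sdiff, Finset.union_sdiff_of_subset hL]
    have s2 : wedgeSign L (I \ L) = wedgeSign L (J \ L) * wedgeSign L (I \ J) := by
      rw [← wedgeSign_union_right d1, ← e2]
    simp only [e1, s1, s2, zsmul_eq_mul]
    push_cast
    ring

instance (K : Type*) [Field K] (n : ℕ) : Ring (Ext K n) :=
  { (inferInstance : AddCommGroup (Ext K n)), (inferInstance : One (Ext K n)),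
    (inferInstance : Mul (Ext K n)) with
    mul_assoc := Ext.mul_assoc
    one_mul := fun f => by
      funext I
      rw [Ext.mul_apply, Finset.sum_eq_single ∅]
      · simp [Ext.one_apply, wedgeSign]
      · intro J _ hJ
        simp [Ext.one_apply, hJ]
      · simp
    mul_one := fun f => by
      funext I
      rw [Ext.mul_apply, Finset.sum_eq_single I]
      · simp [Ext.one_apply, wedgeSign]
      · intro J hJ hne
        have : I \ J ≠ ∅ := fun h => hne
          (Finset.Subset.antisymm (Finset.mem_powerset.mp hJ) (Finset.sdiff_eq_empty_iff_subset.mp h))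
        simp [Ext.one_apply, this]
      · simp
    left_distrib := fun f g e => by
      funext I
      simp only [Ext.mul_apply, Ext.add_apply, mul_add, smul_add, Finset.sum_add_distrib]
    right_distrib := fun f g e => by
      funext I
      simp only [Ext.mul_apply, Ext.add_apply, add_mul, smul_add, Finset.sum_add_distrib]
    zero_mul := fun f => by
      funext I
      rw [Ext.mul_apply]
      exact Finset.sum_eq_zero fun J _ => by
        rw [show (0 : Ext K n) J = 0 from rfl, zero_mul, smul_zero]
    mul_zero := fun f => by
      funext I
      rw [Ext.mul_apply]
      exact Finset.sum_eq_zero fun J _ => by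
        rw [show (0 : Ext K n) (I \ J) = 0 from rfl, mul_zero, smul_zero] }

instance (R K : Type*) [CommSemiring R] [Field K] [Algebra R K] (n : ℕ) :
    Algebra R (Ext K n) :=
  letI : Module R (Ext K n) := inferInstanceAs (Module R (Finset (Fin n) → K))
  Algebra.ofModule
    (fun a f g => by
      funext I
      change ∑ J ∈ I.powerset, wedgeSign J (I \ J) • ((a • f J : K) * g (I \ J)) =
        a • ∑ J ∈ I.powerset, wedgeSign J (I \ J) • (f J * g (I \ J))
      rw [Finset.smul_sum]
      exact Finset.sum_congr rfl fun J _ => by rw [smul_mul_assoc, smul_comm])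
    (fun a f g => by
      funext I
      change ∑ J ∈ I.powerset, wedgeSign J (I \ J) • (f J * (a • g (I \ J) : K)) =
        a • ∑ J ∈ I.powerset, wedgeSign J (I \ J) • (f J * g (I \ J))
      rw [Finset.smul_sum]
      exact Finset.sum_congr rfl fun J _ => by rw [mul_smul_comm, smul_comm])

/-- The lattice `(h_m ℤ)^n / (4 N h_0 ℤ)^n` with step `h_m = h_0 / 2^m`; the class of the integer
vector `p` stands for the point `h_m p`. -/
abbrev Lat (n N m : ℕ) : Type := Fin n → ZMod (4 * N * 2 ^ m)

/-- Cochains on the lattice at level `m`, with the pointwise wedge product.  For `f` a cochain,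
`f p I` is the value of `f` on the cube of type `I` and edge length `2 h_m` centred at `p`,
so that `f = ∑_I f_I dI` with `f_I p = f p I`. -/
def Cochain (K : Type*) (n N m : ℕ) : Type _ := Lat n N m → Ext K n

instance (K : Type*) [Field K] (n N m : ℕ) : Ring (Cochain K n N m) :=
  inferInstanceAs (Ring (Lat n N m → Ext K n))

instance (R K : Type*) [CommSemiring R] [Field K] [Algebra R K] (n N m : ℕ) :
    Algebra R (Cochain K n N m) :=
  inferInstanceAs (Algebra R (Lat n N m → Ext K n))

section
variable {K : Type*} [Field K] {n N m : ℕ} (f g : Cochain K n N m) (p : Lat n N m)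
  (I : Finset (Fin n))

theorem Cochain.add_apply : (f + g) p I = f p I + g p I := rfl

theorem Cochain.smul_apply {R : Type*} [CommSemiring R] [Algebra R K] (a : R) :
    (a • f) p I = a • f p I := rfl

theorem Cochain.mul_apply :
    (f * g) p I = ∑ J ∈ I.powerset, wedgeSign J (I \ J) • (f p J * g p (I \ J)) := rfl

end

instance (n N m : ℕ) : IsScalarTower ℚ⟦X⟧ ℚ⸨X⸩ (Cochain ℚ⸨X⸩ n N m) where
  smul_assoc a b f := by
    funext p I
    exact smul_assoc a b (f p I)

/-- The translation `T'_u`: `(T'_u f)(p) = f (p + h e_u)`. -/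
def shift {K : Type*} [Field K] {n N m : ℕ} (u : Fin n) : Cochain K n N m →ₗ[K] Cochain K n N m :=
  { toFun := fun f p => f (p + Pi.single u 1), map_add' := fun _ _ => rfl,
    map_smul' := fun _ _ => rfl }

/-- The translation `T_u`: `(T_u f)(p) = f (p - h e_u)`. -/
def shiftBack {K : Type*} [Field K] {n N m : ℕ} (u : Fin n) :
    Cochain K n N m →ₗ[K] Cochain K n N m :=
  { toFun := fun f p => f (p - Pi.single u 1), map_add' := fun _ _ => rfl,
    map_smul' := fun _ _ => rfl }

/-- The coboundary, `(δ f)_I = ∑_{u ∈ I} ± (T'_u - T_u) f_{I \ u}` where the sign is the parity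
of the number of elements of `I` below `u`. -/
def coboundary {K : Type*} [Field K] {n N m : ℕ} : Cochain K n N m →ₗ[K] Cochain K n N m where
  toFun f p I := ∑ u ∈ I, (-1) ^ (I.filter (· < u)).card *
    (shift u f p (I.erase u) - shiftBack u f p (I.erase u))
  map_add' f g := by
    funext p I
    change _ = Finset.sum (M := K) I _ + Finset.sum (M := K) I _
    rw [← Finset.sum_add_distrib]
    refine Finset.sum_congr rfl fun u _ => ?_
    simp only [map_add, Cochain.add_apply]
    ring
  map_smul' a f := by
    funext p I
    change _ = a * Finset.sum (M := K) I _
    rw [Finset.mul_sum]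
    refine Finset.sum_congr rfl fun u _ => ?_
    simp only [map_smul, Cochain.smul_apply, smul_eq_mul]
    ring

/-- The cochains of degree `d`. -/
def cochainDeg (K : Type*) [Field K] (n N m : ℕ) (d : ℕ) : Submodule K (Cochain K n N m) where
  carrier := {f | ∀ p I, I.card ≠ d → f p I = 0}
  add_mem' {f g} hf hg p I h := by
    change f p I + g p I = 0
    rw [hf p I h, hg p I h, add_zero]
  zero_mem' _ _ _ := rfl
  smul_mem' a f hf p I h := by
    change a * f p I = 0
    rw [hf p I h, mul_zero]

/-- The sign involution `f dI ↦ (-1)^{|I|} f dI`. -/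
def signInv {K : Type*} [Field K] {n N m : ℕ} : Cochain K n N m →ₗ[K] Cochain K n N m where
  toFun f p I := (-1) ^ I.card * f p I
  map_add' f g := by
    funext p I
    exact mul_add _ _ _
  map_smul' a f := by
    funext p I
    exact mul_left_comm _ _ _

/-- The point `ρ y` of the fine one-dimensional lattice at which integration evaluates
`0`-cochains: the point `x = 2 h y` itself if `x ∈ 4hℤ`, and `x - h` if `x ∈ 2h + 4hℤ`. -/
def basePt {N m : ℕ} (y : ZMod (4 * N * 2 ^ m)) : ZMod (4 * N * 2 ^ (m + 1)) :=
  if Even y.val then ((2 * y.val : ℕ) : ZMod _) else ((2 * y.val : ℕ) : ZMod _) - 1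

/-- Integration averages `1`-cochains on the one-dimensional lattice over `ρ y` and this point:
`x - 2h` if `x = 2 h y ∈ 4hℤ`, and `x + h` if `x ∈ 2h + 4hℤ`. -/
def otherPt {N m : ℕ} (y : ZMod (4 * N * 2 ^ m)) : ZMod (4 * N * 2 ^ (m + 1)) :=
  if Even y.val then ((2 * y.val : ℕ) : ZMod _) - 2 else ((2 * y.val : ℕ) : ZMod _) + 1

/-- The integration map from level `m + 1` to level `m`: the `n`-fold tensor power of the
one-dimensional map with `f ↦ f (ρ y)` on `0`-cochains and
`f dx ↦ (f (ρ y) + f (ρ' y)) / 2 dx` on `1`-cochains, `ρ' = otherPt`.  The component of type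
`I` is thus evaluated at `ρ` in the directions outside `I` and averaged in those of `I`. -/
def integration (K : Type*) [Field K] (n N m : ℕ) :
    Cochain K n N (m + 1) →ₗ[K] Cochain K n N m where
  toFun f y I := (2⁻¹ : K) ^ I.card *
    ∑ E ∈ I.powerset, f (fun u => if u ∈ E then otherPt (y u) else basePt (y u)) I
  map_add' f g := by
    funext y I
    change _ = _ * Finset.sum (M := K) I.powerset _ + _ * Finset.sum (M := K) I.powerset _
    simp only [Cochain.add_apply, Finset.sum_add_distrib, mul_add]
  map_smul' a f := by
    funext y I
    change _ = a * (_ * Finset.sum (M := K) I.powerset _)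
    simp only [Cochain.smul_apply, smul_eq_mul, ← Finset.mul_sum]
    ring

/-- The composite `A_j → A_{j-1} → ⋯ → A_i` of integration maps, for `i ≤ j`. -/
def integrationTo (K : Type*) [Field K] (n N : ℕ) {i j : ℕ} (hij : i ≤ j) :
    Cochain K n N j →ₗ[K] Cochain K n N i :=
  Nat.leRec (motive := fun j _ => Cochain K n N j →ₗ[K] Cochain K n N i)
    LinearMap.id (fun k _ g => g ∘ₗ integration K n N k) hij

/-- Extending the scalars of the rational cochains to `ℚ⟦X⟧` and adjoining difference quotients,
`T'_u a - a = h Δ_u a` for all cochains `a`, makes `h` invertible, already on `0`-cochains, since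
the lattice has even size: hence the resulting algebra consists of the cochains with
coefficients in `ℚ⸨X⸩`. -/
theorem isUnit_of_difference_quotients {n M : ℕ} (hM : Even M) (u : Fin n) {R : Type*}
    [CommRing R] [Algebra ℚ R] (φ : ((Fin n → ZMod M) → ℚ) →ₐ[ℚ] R) (h : R)
    (hφ : ∀ f, h ∣ φ (fun p => f (p + Pi.single u 1)) - φ f) : IsUnit h := by
  obtain ⟨c, rfl⟩ := hM.two_dvd
  let χ : ZMod (2 * c) → ℚ := fun a =>
    if ZMod.castHom (Dvd.intro c rfl : 2 ∣ 2 * c) (ZMod 2) a = 0 then 1 else -1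
  have hz : ∀ b : ZMod 2, (if b + 1 = 0 then (1 : ℚ) else -1) = -(if b = 0 then 1 else -1) := by
    intro b
    obtain rfl | rfl : b = 0 ∨ b = 1 := by
      revert b
      decide
    · simp
    · simp [show (1 : ZMod 2) + 1 = 0 from rfl]
  have hχ : ∀ a, χ (a + 1) = -χ a := fun a => by
    simp only [χ, map_add, map_one]
    exact hz _
  have hsq : ∀ a, χ a * χ a = 1 := fun a => by
    simp only [χ]
    split_ifs <;> norm_num
  let f : (Fin n → ZMod (2 * c)) → ℚ := fun p => χ (p u)
  have e1 : (fun p => f (p + Pi.single u 1)) = -f := by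
    funext p
    simp [f, hχ]
  have e2 : f * f = 1 := by
    funext p
    exact hsq _
  have e3 : IsUnit (φ f) := ⟨⟨φ f, φ f, by rw [← map_mul, e2, map_one],
    by rw [← map_mul, e2, map_one]⟩, rfl⟩
  have e4 : IsUnit (algebraMap ℚ R (-2)) := (IsUnit.mk0 (-2 : ℚ) (by norm_num)).map _
  have := hφ f
  rw [e1, map_neg, show -φ f - φ f = algebraMap ℚ R (-2) * φ f by
    rw [map_neg, map_ofNat]; ring] at this
  exact isUnit_of_dvd_unit this (e4.mul e3)

/-- The scale `h_m = h_0 2^{-m}`, where `h_0 = X` is the formal variable. -/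
def scale (m : ℕ) : ℚ⸨X⸩ := HahnSeries.single 1 ((1 / 2 : ℚ) ^ m)

/-- The cochain algebra `A(h)` at the scale `h = h_m`. -/
abbrev ACochain (n N m : ℕ) : Type := Cochain ℚ⸨X⸩ n N m

/-- The difference quotient `Δ_u = h⁻¹ (T'_u - 1)`. -/
def diffQuot {n N m : ℕ} (u : Fin n) : ACochain n N m →ₗ[ℚ⸨X⸩] ACochain n N m :=
  (scale m)⁻¹ • (shift u - LinearMap.id)

/-- The differential `δ' = (2h)⁻¹ δ`. -/
def deltaPrime (n N m : ℕ) : ACochain n N m →ₗ[ℚ⸨X⸩] ACochain n N m :=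
  (2 * scale m)⁻¹ • coboundary

/-- The allowed operations with `k` arguments from level `j` to level `i`: every component of the
result is a linear combination, with coefficients in `ℚ⟦X⟧`, of products of values of
the arguments and of their difference quotients,
`(Δ_{u₁} ⋯ Δ_{u_s} v_a)(p_a)_{J_a}`, one factor for each argument `v_a`, with pairwise distinct
directions `u₁, …, u_s`.  So an operation with rational coefficients is `h ^ r` times an allowed
one if and only if it is a sum of terms containing at least `r` differences.  (Repeated
directions have to be excluded: on a periodic lattice every difference is a rational
combination of arbitrarily high iterated differences in the same direction.) -/
def allowedOps (n N i j k : ℕ) :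
    Submodule ℚ⟦X⟧ ((Fin k → ACochain n N j) → ACochain n N i) where
  carrier := {φ | ∀ (q : Lat n N i) (I : Finset (Fin n)),
    (fun v => φ v q I) ∈ Submodule.span ℚ⟦X⟧
      {ψ : (Fin k → ACochain n N j) → ℚ⸨X⸩ |
        ∃ (l : Fin k → List (Fin n)) (p : Fin k → Lat n N j) (J : Fin k → Finset (Fin n)),
          (∀ a, (l a).Nodup) ∧
          ψ = fun v => ∏ a, ((l a).map diffQuot).prod (v a) (p a) (J a)}}
  add_mem' hf hg q I := Submodule.add_mem _ (hf q I) (hg q I)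
  zero_mem' _ _ := Submodule.zero_mem _
  smul_mem' c _ hf q I := Submodule.smul_mem _ c (hf q I)

end Lattice

end LatticeQFT

end

noncomputable section

namespace LatticeQFT

/-! ### Koszul signs of lists -/

section KoszulSign

variable {ι : Type*} [LinearOrder ι] (d : ι → ℕ)

/-! The argument has an algebraic half, valid for every graded commutative algebra over a field of
characteristic zero, and a half that counts powers of the scale.

Algebra. By `cumulantMap_wedge`, `τ` sends `x₁ ∧ … ∧ x_k` to the sum over set partitions of the
wedges of the block products; the weights `1 / b!` in `cumulantMap` compensate for the orders inside
each block. On `S^*V` the map `p₁ ∘ τ⁻¹` is a logarithm (`IsGradedComm.proj₁_cumulantEquiv_symm`),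
so brackets and Taylor coefficients are explicit sums over partitions with the Möbius numbers
`(-1)^{r-1} (r-1)!`. The rest of the formal structure is conjugation by `τ`: it follows once `τ` is
known to be a coalgebra map (`fullCoproduct_cumulantMap`) and a bijection of `S^*V`
(`IsGradedComm.map_cumulantMap`).

Divisibility. Both estimates rest on one cancellation, `sum_moebius_coarser`: the Möbius numbers of
all partitions coarser than a fixed one with at least two blocks have sum zero.

For the brackets, the coboundary is `∑ du (T'_u - T_u)` with automorphisms `T'_u` and `T_u`. A
translated block product is a product of translated factors, and each of these is the original
factor plus a difference. The term with differences exactly in the arguments of a set `S` is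
weighted by the partitions that have `S` inside one block. The cancellation leaves only `S` full,
and `S` empty, where the contributions of `T'_u` and `T_u` agree and drop out. So `k + 1`
differences remain, and the prefactor `1 / (2h)` takes away one power of `h` (`bracket_component`).

For the cumulants, every composite of integration maps is a mean over choices that are independent
in the different directions (`IsAverage`). Let the arguments have the single types `J a`. If two
types meet, all products vanish. If not, distinct blocks involve disjoint sets of directions, so a
product of means is a mean of products (`prod_mean_eq`). For a fixed choice, the argument `a` is
evaluated at a base point displaced in the directions of its block. Such a value is a sum of
iterated differences in distinct directions (`exists_sum_differences`). A term that differences each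
`a` in the directions `S a` is weighted by the partitions for which `S a` lies in the directions of
the block of `a`. Each direction in `S a` thus ties `a` to the argument owning that direction. Fewer
than `k` ties cannot connect `k + 1` arguments, so by the cancellation every surviving term has at
least `k` differences (`sum_moebius_subset_eq_zero`, `cumulant_divisible`).

Integration commutes with the differentials because the differences at the two averaging points
telescope (`sum_difference_eq`). The weight `1 / 2` of the average matches the doubling of the
scale. -/

/-- The sign of moving an element past a list: `∏ (-1)^{d a d b}` over the `b` in the list with
`b < a`. -/
def crossSign (a : ι) (l : List ι) : ℤ :=
  (l.map fun b => if b < a then (-1 : ℤ) ^ (d a * d b) else 1).prod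

/-- The Koszul sign of sorting a list of indices. -/
def listSign : List ι → ℤ
  | [] => 1
  | a :: l => crossSign d a l * listSign l

/-- The product of the elements with indices in the list. -/
def listProd {V : Type*} [Ring V] (x : ι → V) (l : List ι) : V := (l.map x).prod

/-- The sign of interchanging the elements of two lists that are in the wrong order. -/
def crossSigns (l l' : List ι) : ℤ := (l.map fun a => crossSign d a l').prod

theorem crossSign_perm {l l' : List ι} (h : l.Perm l') (a : ι) :
    crossSign d a l = crossSign d a l' := (h.map _).prod_eq

theorem crossSign_append (a : ι) (l l' : List ι) :
    crossSign d a (l ++ l') = crossSign d a l * crossSign d a l' := by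
  simp [crossSign]

theorem crossSign_cons (a b : ι) (l : List ι) : crossSign d a (b :: l) =
    (if b < a then (-1 : ℤ) ^ (d a * d b) else 1) * crossSign d a l := by
  simp [crossSign]

theorem crossSigns_perm {l₁ l₂ l₁' l₂' : List ι} (h : l₁.Perm l₂) (h' : l₁'.Perm l₂') :
    crossSigns d l₁ l₁' = crossSigns d l₂ l₂' := by
  have : (fun a => crossSign d a l₁') = fun a => crossSign d a l₂' :=
    funext fun a => crossSign_perm d h' a
  rw [crossSigns, crossSigns, this]
  exact (h.map _).prod_eq

theorem crossSigns_append_right (l l₁ l₂ : List ι) :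
    crossSigns d l (l₁ ++ l₂) = crossSigns d l l₁ * crossSigns d l l₂ := by
  simp [crossSigns, crossSign_append]

theorem listSign_append (l l' : List ι) :
    listSign d (l ++ l') = listSign d l * listSign d l' * crossSigns d l l' := by
  induction l with
  | nil => simp [listSign, crossSigns]
  | cons a l ih =>
    rw [List.cons_append, listSign, ih, listSign, crossSign_append, crossSigns, crossSigns,
      List.map_cons, List.prod_cons]
    ring

theorem crossSign_mul_self (a : ι) (l : List ι) : crossSign d a l * crossSign d a l = 1 := by
  induction l with
  | nil => simp [crossSign]
  | cons b l ih =>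
    rw [crossSign_cons, mul_mul_mul_comm, ih, mul_one]
    split_ifs
    · rw [← mul_pow]; simp
    · simp

theorem listSign_mul_self (l : List ι) : listSign d l * listSign d l = 1 := by
  induction l with
  | nil => simp [listSign]
  | cons a l ih => rw [listSign, mul_mul_mul_comm, ih, crossSign_mul_self, mul_one]

/-- Each pair of an entry of `l` and an entry of `l'` is out of order in exactly one of the two
concatenations, so it contributes its sign once. -/
theorem crossSigns_mul_comm {l l' : List ι} (h : ∀ a ∈ l, ∀ b ∈ l', a ≠ b) :
    crossSigns d l l' * crossSigns d l' l = (-1) ^ ((l.map d).sum * (l'.map d).sum) := by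
  have key : ∀ a : ι, ∀ l' : List ι, (∀ b ∈ l', a ≠ b) →
      crossSign d a l' * crossSigns d l' [a] = (-1) ^ (d a * (l'.map d).sum) := by
    intro a l'
    induction l' with
    | nil => simp [crossSign, crossSigns]
    | cons b l' ih =>
      intro hb
      have h1 := ih fun c hc => hb c (List.mem_cons_of_mem _ hc)
      have h2 : a ≠ b := hb b List.mem_cons_self
      rw [List.map_cons, List.sum_cons, mul_add, pow_add, ← h1, crossSign_cons, crossSigns,
        List.map_cons, List.prod_cons, ← crossSigns]
      have : (if b < a then (-1 : ℤ) ^ (d a * d b) else 1) * crossSign d b [a] =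
          (-1) ^ (d a * d b) := by
        simp only [crossSign, List.map_cons, List.map_nil, List.prod_cons, List.prod_nil, mul_one]
        rcases lt_or_gt_of_ne h2 with h3 | h3
        · simp [h3, h3.not_gt, mul_comm]
        · simp [h3, h3.not_gt]
      linear_combination crossSign d a l' * crossSigns d l' [a] * this
  induction l with
  | nil =>
    have : ∀ a, crossSign d a [] = 1 := fun a => rfl
    simp [crossSigns, this]
  | cons a l ih =>
    have h1 := ih fun c hc => h c (List.mem_cons_of_mem _ hc)
    have h2 := key a l' (h a List.mem_cons_self)
    have h3 : crossSigns d l' (a :: l) = crossSigns d l' [a] * crossSigns d l' l := by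
      rw [← List.singleton_append, crossSigns_append_right]
    rw [List.map_cons, List.sum_cons, add_mul, pow_add, ← h1, ← h2, h3, crossSigns, List.map_cons,
      List.prod_cons, ← crossSigns]
    ring

/-- The Koszul sign is made so that signed products do not depend on the order of the factors. An
adjacent swap produces `(-1) ^ (d a * d b)` twice: from graded commutativity, and from the one
inversion that changes. -/
theorem listSign_perm_smul {V : Type*} [Ring V] {x : ι → V}
    (hx : ∀ a b, x b * x a = (-1 : ℤ) ^ (d a * d b) • (x a * x b)) {l l' : List ι}
    (h : l.Perm l') (hl : l.Nodup) :
    listSign d l • listProd x l = listSign d l' • listProd x l' := by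
  induction h with
  | nil => rfl
  | cons a h ih =>
    have := ih (List.nodup_cons.mp hl).2
    simp only [listSign, listProd, List.map_cons, List.prod_cons] at this ⊢
    rw [crossSign_perm d h, mul_smul, mul_smul, ← mul_smul_comm, this, mul_smul_comm]
  | swap a b l =>
    have hab : b ≠ a := by
      have := (List.nodup_cons.mp hl).1
      intro h
      exact this (h ▸ List.mem_cons_self)
    simp only [listSign, listProd, List.map_cons, List.prod_cons, crossSign_cons]
    rw [← mul_assoc (x b), ← mul_assoc (x a), hx a b, smul_mul_assoc, smul_smul]
    congr 1
    rcases lt_or_gt_of_ne hab with h3 | h3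
    · simp only [h3, h3.not_gt, if_false, if_true, mul_comm (d b)]
      ring
    · simp only [h3, h3.not_gt, if_false, if_true, mul_comm (d b)]
      have : (-1 : ℤ) ^ (d a * d b) * (-1) ^ (d a * d b) = 1 := by rw [← mul_pow]; simp
      linear_combination (crossSign d b l * crossSign d a l * listSign d l) * this
  | trans h₁ h₂ ih₁ ih₂ => rw [ih₁ hl, ih₂ (h₁.nodup_iff.mp hl)]

theorem listSign_sorted {l : List ι} (h : l.Pairwise (· < ·)) : listSign d l = 1 := by
  induction l with
  | nil => rfl
  | cons a l ih =>
    rw [List.pairwise_cons] at h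
    rw [listSign, ih h.2, mul_one, crossSign]
    refine List.prod_eq_one fun z hz => ?_
    obtain ⟨b, hb, rfl⟩ := List.mem_map.mp hz
    rw [if_neg (h.1 b hb).not_gt]

/-- Permuting blocks of indices: the sign of the concatenation times the sign of the
permutation of the blocks is invariant. -/
theorem listSign_flatten_perm {κ : Type*} [LinearOrder κ] (B : κ → List ι) (D : κ → ℕ)
    (hD : ∀ j, ((B j).map d).sum = D j) (hB : ∀ i j, i ≠ j → ∀ a ∈ B i, ∀ b ∈ B j, a ≠ b)
    {M M' : List κ} (h : M.Perm M') (hM : M.Nodup) :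
    listSign d (M.map B).flatten * listSign D M = listSign d (M'.map B).flatten * listSign D M' := by
  induction h with
  | nil => rfl
  | @cons a M M' h ih =>
    have := ih (List.nodup_cons.mp hM).2
    simp only [listSign, List.map_cons, List.flatten_cons, listSign_append]
    rw [crossSign_perm D h, crossSigns_perm d (List.Perm.refl (B a)) (h.map B).flatten]
    linear_combination listSign d (B a) * crossSigns d (B a) (M'.map B).flatten *
      crossSign D a M' * this
  | swap a b M =>
    have hab : b ≠ a := by
      have := (List.nodup_cons.mp hM).1
      intro h
      exact this (h ▸ List.mem_cons_self)
    simp only [listSign, List.map_cons, List.flatten_cons, listSign_append,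
      crossSigns_append_right, crossSign_cons]
    -- Interchanging two adjacent blocks replaces one cross sign by the other, and their product is
    -- the sign of swapping two elements of the total degrees of the blocks.
    have h1 := crossSigns_mul_comm d (hB b a hab)
    rw [hD, hD] at h1
    have hz : ∀ l l' : List ι, crossSigns d l l' * crossSigns d l l' = 1 := by
      intro l l'
      induction l with
      | nil => simp [crossSigns]
      | cons c l ih =>
        rw [crossSigns, List.map_cons, List.prod_cons, ← crossSigns, mul_mul_mul_comm, ih,
          crossSign_mul_self, mul_one]
    have h2 := hz (B b) (B a)
    have h3 := hz (B a) (B b)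
    have h4 : (-1 : ℤ) ^ (D a * D b) * (-1) ^ (D a * D b) = 1 := by rw [← mul_pow]; simp
    rcases lt_or_gt_of_ne hab with h5 | h5
    · simp only [h5, h5.not_gt, if_false, if_true, mul_comm (D b)] at h1 ⊢
      have h6 : crossSigns d (B b) (B a) = (-1) ^ (D a * D b) * crossSigns d (B a) (B b) := by
        linear_combination crossSigns d (B a) (B b) * h1 - crossSigns d (B b) (B a) * h3
      rw [h6]
      ring
    · simp only [h5, h5.not_gt, if_false, if_true, mul_comm (D b)] at h1 ⊢
      have h6 : crossSigns d (B a) (B b) = (-1) ^ (D a * D b) * crossSigns d (B b) (B a) := by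
        linear_combination crossSigns d (B b) (B a) * h1 - crossSigns d (B a) (B b) * h2
      rw [h6]
      ring
  | trans h₁ h₂ ih₁ ih₂ => rw [ih₁ hM, ih₂ (h₁.nodup_iff.mp hM)]

/-- The Koszul sign of a list as a product over inversions, for a list ordered by `R`. -/
theorem listSign_eq_prod (R : ι → ι → Prop) [DecidableRel R] (hR : ∀ a b, R a b → ¬ R b a)
    {l : List ι} (h : l.Pairwise R) : listSign d l =
      (l.map fun i => (l.map fun j => if j < i ∧ R i j then (-1 : ℤ) ^ (d i * d j) else 1).prod).prod := by
  induction l with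
  | nil => rfl
  | cons a l ih =>
    rw [List.pairwise_cons] at h
    have h1 : ∀ b ∈ l, R a b := h.1
    simp only [List.map_cons, List.prod_cons, lt_irrefl, false_and, if_false, one_mul]
    rw [listSign, ih h.2, crossSign]
    congr 1
    · congr 1
      refine List.map_congr_left fun b hb => ?_
      simp [h1 b hb]
    · congr 1
      refine List.map_congr_left fun b hb => ?_
      simp [hR a b (h1 b hb)]

/-- For a list running through the whole index type this converts the recursive sign into a double
product over indices, the shape of `permSign` and `partitionSign`. -/
theorem listSign_eq_prod_univ [Fintype ι] (R : ι → ι → Prop) [DecidableRel R]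
    (hR : ∀ a b, R a b → ¬ R b a) {l : List ι} (h : l.Pairwise R) (hl : ∀ i, i ∈ l) :
    listSign d l = ∏ i, ∏ j, if j < i ∧ R i j then (-1 : ℤ) ^ (d i * d j) else 1 := by
  classical
  have hnd : l.Nodup := h.imp fun {a b} hab => by
    rintro rfl
    exact hR a a hab hab
  have key : ∀ g : ι → ℤ, (l.map g).prod = ∏ i, g i := by
    intro g
    rw [← List.prod_toFinset g hnd]
    congr 1
    ext i
    simp [hl i]
  rw [listSign_eq_prod d R hR h]
  simp only [key]

end KoszulSign

/-! ### Ordered set partitions -/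

section OrderedPartitions

theorem ofp_index_emb {k : ℕ} (o : OrderedFinpartition k) (j : Fin o.length)
    (a : Fin (o.partSize j)) : o.index (o.emb j a) = j :=
  congrArg Sigma.fst (o.equivSigma.symm_apply_apply ⟨j, a⟩)

theorem ofp_mem_range_emb {k : ℕ} (o : OrderedFinpartition k) (j : Fin o.length) (i : Fin k) :
    i ∈ Set.range (o.emb j) ↔ o.index i = j := by
  constructor
  · rintro ⟨a, rfl⟩
    exact ofp_index_emb o j a
  · rintro rfl
    exact ⟨_, o.emb_invEmbedding i⟩

/-- The surjections from `Fin k` to some `Fin r`, that is, the partitions of `Fin k` into a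
sequence of non-empty blocks. -/
abbrev OrderedPartition (k : ℕ) : Type :=
  Σ r : Fin (k + 1), {f : Fin k → Fin r // Function.Surjective f}

theorem OrderedPartition.ext {k : ℕ} {y z : OrderedPartition k} (h : (y.1 : ℕ) = z.1)
    (h' : ∀ a, (y.2.1 a : ℕ) = z.2.1 a) : y = z := by
  obtain ⟨r, f, hf⟩ := y
  obtain ⟨s, g, hg⟩ := z
  obtain rfl : r = s := Fin.ext h
  congr 1
  exact Subtype.ext (funext fun a => Fin.ext (h' a))

/-- An unordered partition together with an ordering of its blocks. -/
def OrderedPartition.ofPerm {k : ℕ}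
    (p : Σ o : OrderedFinpartition k, Equiv.Perm (Fin o.length)) : OrderedPartition k :=
  ⟨⟨p.1.length, Nat.lt_succ_of_le p.1.length_le⟩, fun a => p.2.symm (p.1.index a),
    fun j => ⟨p.1.emb (p.2 j) ⟨0, p.1.partSize_pos _⟩, by
      simp only [ofp_index_emb, Equiv.symm_apply_apply]⟩⟩

/-- Blocks are enumerated increasingly, so the last entry is the maximum of the block. It is the
datum by which `OrderedFinpartition` orders its blocks, here expressed through `index` alone. -/
theorem ofp_last_eq {k : ℕ} (o : OrderedFinpartition k) (j : Fin o.length) (i : Fin k) :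
    o.emb j ⟨o.partSize j - 1, Nat.sub_one_lt_of_lt (o.partSize_pos j)⟩ = i ↔
      o.index i = j ∧ ∀ i', o.index i' = j → i' ≤ i := by
  have h : ∀ i', o.index i' = j →
      i' ≤ o.emb j ⟨o.partSize j - 1, Nat.sub_one_lt_of_lt (o.partSize_pos j)⟩ := by
    rintro i' rfl
    conv_lhs => rw [← o.emb_invEmbedding i']
    exact (o.emb_strictMono _).monotone (Fin.le_def.mpr (Nat.le_sub_one_of_lt (Fin.is_lt _)))
  constructor
  · rintro rfl
    exact ⟨ofp_index_emb o j _, h⟩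
  · rintro ⟨h1, h2⟩
    exact le_antisymm (h2 _ (ofp_index_emb o j _)) (h i h1)

theorem ofp_ext_range {k : ℕ} {o o' : OrderedFinpartition k} (hl : o.length = o'.length)
    (h : ∀ j, Set.range (o.emb j) = Set.range (o'.emb (Fin.cast hl j))) : o = o' := by
  obtain ⟨r, s, s_pos, emb, emb_mono, parts, disj, cover⟩ := o
  obtain ⟨r', s', s_pos', emb', emb_mono', parts', disj', cover'⟩ := o'
  dsimp only at hl h
  subst hl
  have h1 : s = s' := by
    funext j
    have h2 := Nat.card_range_of_injective (emb_mono j).injective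
    have h3 := Nat.card_range_of_injective (emb_mono' j).injective
    rw [h] at h2
    simpa using h2.symm.trans h3
  subst h1
  have h2 : emb = emb' := by
    funext j
    exact ((emb_mono j).range_inj (emb_mono' j)).mp (h j)
  subst h2
  rfl

/-- Blocks are listed by increasing maximum. A relabelling compatible with the index functions
preserves the maxima, so it is increasing and therefore the identity. -/
theorem ofp_eq_of_index {k : ℕ} {o o' : OrderedFinpartition k}
    (hl : o.length = o'.length) (e : Equiv.Perm (Fin o.length))
    (h : ∀ a, (o'.index a : ℕ) = e (o.index a)) : o = o' ∧ e = 1 := by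
  have h' : ∀ a, o'.index a = Fin.cast hl (e (o.index a)) := fun a => Fin.ext (h a)
  have hlast : ∀ j : Fin o.length,
      o'.emb (Fin.cast hl (e j)) ⟨o'.partSize _ - 1, Nat.sub_one_lt_of_lt (o'.partSize_pos _)⟩ =
      o.emb j ⟨o.partSize j - 1, Nat.sub_one_lt_of_lt (o.partSize_pos j)⟩ := by
    intro j
    have := (ofp_last_eq o j _).mp rfl
    rw [ofp_last_eq]
    have h2 : ∀ a, o'.index a = Fin.cast hl (e j) ↔ o.index a = j := fun a => by
      rw [h', Fin.cast_inj, e.apply_eq_iff_eq]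
    simpa only [h2] using this
  have he : StrictMono e := by
    intro i j hij
    have h1 := o.parts_strictMono hij
    dsimp only at h1
    rw [← hlast, ← hlast] at h1
    exact (o'.parts_strictMono.lt_iff_lt (a := Fin.cast hl (e i)) (b := Fin.cast hl (e j))).mp h1
  have he1 : e = 1 := by
    ext j
    have : (e : Fin o.length → Fin o.length) = id :=
      (he.range_inj strictMono_id).mp (by simp)
    simp [this]
  refine ⟨ofp_ext_range hl fun j => ?_, he1⟩
  ext a
  rw [ofp_mem_range_emb, ofp_mem_range_emb, h', he1]
  simp [Fin.cast_inj]

theorem OrderedPartition.ofPerm_injective {k : ℕ} :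
    Function.Injective (OrderedPartition.ofPerm (k := k)) := by
  rintro ⟨o, ρ⟩ ⟨o', ρ'⟩ h
  have hl : o.length = o'.length := congrArg (fun y : OrderedPartition k => (y.1 : ℕ)) h
  have hi : ∀ a, (ρ.symm (o.index a) : ℕ) = ρ'.symm (o'.index a) := by
    have : ∀ y z : OrderedPartition k, y = z → ∀ a, (y.2.1 a : ℕ) = z.2.1 a := by
      rintro y _ rfl a
      rfl
    exact this _ _ h
  let e : Equiv.Perm (Fin o.length) :=
    ρ.symm.trans ((finCongr hl).trans (ρ'.trans (finCongr hl.symm)))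
  obtain ⟨rfl, he⟩ := ofp_eq_of_index hl e (fun a => by
    have : Fin.cast hl (ρ.symm (o.index a)) = ρ'.symm (o'.index a) := Fin.ext (hi a)
    simp [e, this])
  have : ρ = ρ' := by
    ext j
    have := DFunLike.congr_fun he (ρ j)
    simpa [e] using congrArg Fin.val this.symm
  rw [this]

theorem OrderedPartition.ofPerm_surjective {k : ℕ} :
    Function.Surjective (OrderedPartition.ofPerm (k := k)) := by
  rintro ⟨⟨r, hr⟩, f, hf⟩
  dsimp only at f hf
  let A : Fin r → Finset (Fin k) := fun j => Finset.univ.filter (f · = j)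
  have hA : ∀ j, (A j).Nonempty := fun j => by
    obtain ⟨a, ha⟩ := hf j
    exact ⟨a, by simp [A, ha]⟩
  have hmem : ∀ j a, a ∈ A j ↔ f a = j := fun j a => by simp [A]
  let M : Fin r → Fin k := fun j => (A j).max' (hA j)
  have hM : ∀ j, f (M j) = j := fun j => (hmem j _).mp ((A j).max'_mem (hA j))
  have hinj : Function.Injective M := fun i j h => by rw [← hM i, h, hM j]
  -- Sorting the blocks by their maxima gives the normal form; the original order survives in the
  -- permutation.
  let ρ := Tuple.sort M
  have hmono : StrictMono (M ∘ ρ) :=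
    (Tuple.monotone_sort M).strictMono_of_injective (hinj.comp ρ.injective)
  let o : OrderedFinpartition k :=
    { length := r
      partSize := fun j => (A (ρ j)).card
      partSize_pos := fun j => (hA _).card_pos
      emb := fun j => (A (ρ j)).orderEmbOfFin rfl
      emb_strictMono := fun j => OrderEmbedding.strictMono _
      parts_strictMono := by
        have : (fun j => (A (ρ j)).orderEmbOfFin rfl ⟨(A (ρ j)).card - 1,
            Nat.sub_one_lt_of_lt (hA _).card_pos⟩) = M ∘ ρ := by
          funext j
          exact Finset.orderEmbOfFin_last rfl (hA _).card_pos
        rw [this]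
        exact hmono
      disjoint := by
        intro i _ j _ hij
        rw [Function.onFun, Set.disjoint_left]
        intro a hi hj
        rw [Finset.range_orderEmbOfFin, Finset.mem_coe, hmem] at hi hj
        exact hij (ρ.injective (hi.symm.trans hj))
      cover := fun a => ⟨ρ.symm (f a), by
        rw [Finset.range_orderEmbOfFin, Finset.mem_coe, hmem]; simp⟩ }
  have hidx : ∀ a, o.index a = ρ.symm (f a) := fun a => by
    rw [← ofp_mem_range_emb]
    change a ∈ Set.range ((A (ρ (ρ.symm (f a)))).orderEmbOfFin rfl)
    rw [Finset.range_orderEmbOfFin, Finset.mem_coe, hmem]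
    simp
  refine ⟨⟨o, ρ.symm⟩, OrderedPartition.ext rfl fun a => ?_⟩
  change ((ρ.symm.symm (o.index a) : Fin r) : ℕ) = f a
  rw [hidx]
  simp

/-- The sum over all sequences of blocks as a sum over unordered partitions and orderings. -/
theorem sum_orderedPartition {k : ℕ} {M : Type*} [AddCommMonoid M] (G : OrderedPartition k → M) :
    ∑ y, G y = ∑ o : OrderedFinpartition k, ∑ ρ : Equiv.Perm (Fin o.length),
      G (OrderedPartition.ofPerm ⟨o, ρ⟩) := by
  rw [← Fintype.sum_sigma' (fun (o : OrderedFinpartition k) (ρ : Equiv.Perm (Fin o.length)) =>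
    G (OrderedPartition.ofPerm ⟨o, ρ⟩))]
  exact (Function.Bijective.sum_comp ⟨OrderedPartition.ofPerm_injective,
    OrderedPartition.ofPerm_surjective⟩ G).symm

/-- A composition of `k` and a permutation of `Fin k` give a sequence of blocks. -/
def OrderedPartition.ofComposition {k : ℕ} (p : Composition k × Equiv.Perm (Fin k)) :
    OrderedPartition k :=
  ⟨⟨p.1.length, Nat.lt_succ_of_le p.1.length_le⟩, fun a => p.1.index (p.2.symm a),
    fun j => ⟨p.2 (p.1.embedding j ⟨0, p.1.one_le_blocksFun j⟩), by
      simp only [Equiv.symm_apply_apply]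
      exact p.1.index_embedding j _⟩⟩

theorem card_composition_index {k : ℕ} (c : Composition k) (j : Fin c.length) :
    Fintype.card {a // c.index a = j} = c.blocksFun j := by
  rw [← Fintype.card_fin (c.blocksFun j)]
  refine (Fintype.card_congr (Equiv.ofBijective
    (fun b => (⟨c.embedding j b, c.index_embedding j b⟩ : {a // c.index a = j})) ⟨?_, ?_⟩)).symm
  · intro b b' h
    exact (c.embedding j).injective (congrArg Subtype.val h)
  · rintro ⟨a, rfl⟩
    exact ⟨c.invEmbedding a, Subtype.ext (c.embedding_comp_inv a)⟩

/-- The fibre sizes of the block function, in order, are the blocks of the composition, and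
permuting the arguments does not alter them. -/
theorem OrderedPartition.ofComposition_fst {k : ℕ} {c c' : Composition k}
    {π π' : Equiv.Perm (Fin k)} (h : ofComposition (c, π) = ofComposition (c', π')) : c = c' := by
  let Φ : OrderedPartition k → List ℕ := fun y =>
    List.ofFn fun j : Fin y.1 => Nat.card {a // y.2.1 a = j}
  have key : ∀ c π, Φ (ofComposition (c, π)) = c.blocks := by
    intro c π
    rw [← c.ofFn_blocksFun]
    refine congrArg List.ofFn (funext fun (j : Fin c.length) => ?_)
    have hj := card_composition_index c j
    rw [← hj, ← Nat.card_eq_fintype_card]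
    exact Nat.card_congr (π.symm.subtypeEquiv fun a => Iff.rfl)
  exact Composition.ext (by rw [← key c π, h, key])

theorem OrderedPartition.ofComposition_surjective {k : ℕ} :
    Function.Surjective (ofComposition (k := k)) := by
  rintro ⟨⟨r, hr⟩, f, hf⟩
  dsimp only at f hf
  let c : Composition k :=
    { blocks := List.ofFn fun j => Fintype.card {a // f a = j}
      blocks_pos := by
        intro i hi
        obtain ⟨j, rfl⟩ := (List.mem_ofFn' _ _).mp hi
        obtain ⟨a, ha⟩ := hf j
        exact Fintype.card_pos_iff.mpr ⟨a, ha⟩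
      blocks_sum := by
        rw [List.sum_ofFn, ← Fintype.card_sigma,
          Fintype.card_congr (Equiv.sigmaFiberEquiv f), Fintype.card_fin] }
  have hlen : c.length = r := by simp [c, Composition.length]
  have hblock : ∀ j, c.blocksFun j = Fintype.card {a // f a = finCongr hlen j} := fun j => by
    simp [c, Composition.blocksFun]
    rfl
  -- Any enumeration of the fibres of `f` yields a suitable permutation.
  let e : (Σ j : Fin c.length, Fin (c.blocksFun j)) ≃ Σ j : Fin r, {a // f a = j} :=
    Equiv.sigmaCongr (finCongr hlen) fun j =>
      (finCongr (hblock j)).trans (Fintype.equivFin _).symm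
  refine ⟨(c, c.blocksFinEquiv.symm.trans (e.trans (Equiv.sigmaFiberEquiv f))),
    OrderedPartition.ext hlen fun a => ?_⟩
  obtain ⟨⟨j, b⟩, rfl⟩ := (e.trans (Equiv.sigmaFiberEquiv f)).surjective a
  change (c.index ((c.blocksFinEquiv.symm.trans (e.trans (Equiv.sigmaFiberEquiv f))).symm
    ((e.trans (Equiv.sigmaFiberEquiv f)) ⟨j, b⟩)) : ℕ) =
      f ((e.trans (Equiv.sigmaFiberEquiv f)) ⟨j, b⟩)
  rw [Equiv.symm_trans_apply, Equiv.symm_apply_apply, Equiv.symm_symm]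
  change (c.index (c.embedding j b) : ℕ) = f (e ⟨j, b⟩).2
  rw [c.index_embedding, (e ⟨j, b⟩).2.2]
  rfl

/-- The fibre over a sequence of blocks consists of one composition and a coset of the stabiliser of
its index function. This stabiliser is a product of symmetric groups, one for each block, and its
order cancels the weights. -/
theorem sum_ofComposition_weight {K : Type*} [Field K] [CharZero K] {k : ℕ}
    (y : OrderedPartition k) :
    ∑ p : Composition k × Equiv.Perm (Fin k) with OrderedPartition.ofComposition p = y,
      (∏ j, ((p.1.blocksFun j).factorial : K)⁻¹) = 1 := by
  classical
  obtain ⟨⟨c, π⟩, rfl⟩ := OrderedPartition.ofComposition_surjective y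
  have h1 : ∀ p ∈ Finset.univ.filter (fun p : Composition k × Equiv.Perm (Fin k) =>
      OrderedPartition.ofComposition p = OrderedPartition.ofComposition (c, π)),
      (∏ j, ((p.1.blocksFun j).factorial : K)⁻¹) = ∏ j, ((c.blocksFun j).factorial : K)⁻¹ := by
    rintro ⟨c', π'⟩ h
    rw [OrderedPartition.ofComposition_fst (Finset.mem_filter.mp h).2]
  rw [Finset.sum_congr rfl h1, Finset.sum_const]
  have h2 : (Finset.univ.filter (fun p : Composition k × Equiv.Perm (Fin k) =>
      OrderedPartition.ofComposition p = OrderedPartition.ofComposition (c, π))).card =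
      ∏ j, (c.blocksFun j).factorial := by
    have h3 := DomMulAct.stabilizer_card c.index
    simp only [card_composition_index] at h3
    rw [← h3, Fintype.card_subtype]
    refine Finset.card_bij' (fun p _ => p.2⁻¹ * π) (fun g _ => (c, π * g⁻¹)) ?_ ?_ ?_ ?_
    · rintro ⟨c', π'⟩ h
      have h4 := (Finset.mem_filter.mp h).2
      obtain rfl := OrderedPartition.ofComposition_fst h4
      refine Finset.mem_filter.mpr ⟨Finset.mem_univ _, funext fun a => ?_⟩
      have h5 : ∀ a, c'.index (π'.symm a) = c'.index (π.symm a) := by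
        have h6 := eq_of_heq (Sigma.mk.inj h4).2
        exact fun a => congrFun (Subtype.mk.inj h6) a
      have := h5 (π a)
      simpa using this
    · intro g hg
      have hg' := (Finset.mem_filter.mp hg).2
      refine Finset.mem_filter.mpr ⟨Finset.mem_univ _, OrderedPartition.ext rfl fun a => ?_⟩
      change (c.index ((π * g⁻¹)⁻¹ a) : ℕ) = c.index (π.symm a)
      have := congrFun hg' (π.symm a)
      rw [mul_inv_rev, inv_inv]
      exact congrArg Fin.val this
    · rintro ⟨c', π'⟩ h
      obtain rfl := OrderedPartition.ofComposition_fst (Finset.mem_filter.mp h).2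
      simp
    · intro g _
      simp
  rw [h2, nsmul_eq_mul, Finset.prod_inv_distrib, Nat.cast_prod]
  exact mul_inv_cancel₀ (Finset.prod_ne_zero_iff.mpr fun j _ =>
    Nat.cast_ne_zero.mpr (Nat.factorial_ne_zero _))

/-- The factorial weights of `cumulantMap` remove the overcounting of orders within a block that
arises when a symmetrised word is cut into pieces. -/
theorem sum_composition_perm {K : Type*} [Field K] [CharZero K] {k : ℕ} {M : Type*}
    [AddCommGroup M] [Module K M] (G : OrderedPartition k → M) :
    ∑ c : Composition k, ∑ π : Equiv.Perm (Fin k), (∏ j, ((c.blocksFun j).factorial : K)⁻¹) •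
      G (OrderedPartition.ofComposition (c, π)) = ∑ y, G y := by
  classical
  rw [← Fintype.sum_prod_type' (f := fun (c : Composition k) (π : Equiv.Perm (Fin k)) =>
    (∏ j, ((c.blocksFun j).factorial : K)⁻¹) • G (OrderedPartition.ofComposition (c, π)))]
  rw [← Finset.sum_fiberwise Finset.univ OrderedPartition.ofComposition]
  refine Finset.sum_congr rfl fun y _ => ?_
  conv_rhs => rw [← one_smul K (G y), ← sum_ofComposition_weight (K := K) y, Finset.sum_smul]
  refine Finset.sum_congr rfl fun p hp => ?_
  rw [← (Finset.mem_filter.mp hp).2]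

end OrderedPartitions

/-! ### The cumulant map on signed symmetrisations -/

section SignedWords

variable {K : Type*} [Field K] {V : Type*} [Ring V] [Algebra K V] {k : ℕ}
  (d : Fin k → ℕ) (x : Fin k → V)

/-- The word whose letters are the products over the given blocks of indices, with the Koszul
sign of the concatenation of the blocks. -/
def signedWord (K : Type*) [Field K] {V : Type*} [Ring V] [Algebra K V] {k : ℕ}
    (d : Fin k → ℕ) (x : Fin k → V) (L : List (List (Fin k))) : TensorAlgebra K V :=
  listSign d L.flatten • (L.map fun l => TensorAlgebra.ι K (listProd x l)).prod

variable {x}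

/-- Reordering inside a block changes the sign and the block product compatibly, while the cross
signs between blocks see the blocks only up to permutation. -/
theorem signedWord_congr (hx : ∀ a b, x b * x a = (-1 : ℤ) ^ (d a * d b) • (x a * x b))
    {L L' : List (List (Fin k))} (h : List.Forall₂ List.Perm L L') (hL : L.flatten.Nodup) :
    signedWord K d x L = signedWord K d x L' := by
  induction h with
  | nil => rfl
  | @cons l l' L L' hl h ih =>
    rw [List.flatten_cons, List.nodup_append] at hL
    have h1 := ih hL.2.1
    have h2 := listSign_perm_smul d hx hl hL.1
    have h3 : L.flatten.Perm L'.flatten := by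
      clear ih h1 hL
      induction h with
      | nil => exact List.Perm.refl _
      | cons h _ ih => exact h.append ih
    simp only [signedWord, List.flatten_cons, listSign_append, List.map_cons, List.prod_cons] at h1 ⊢
    rw [crossSigns_perm d hl h3, mul_right_comm, mul_comm (listSign d l), mul_assoc, mul_smul,
      mul_right_comm, mul_comm (listSign d l'), mul_assoc, mul_smul, mul_smul, mul_smul]
    congr 1
    rw [← mul_smul_comm, h1, mul_smul_comm, smul_comm, ← smul_mul_assoc, ← map_zsmul, h2,
      map_zsmul, smul_mul_assoc, smul_comm]

theorem listSign_ofFn_perm (π : Equiv.Perm (Fin k)) : listSign d (List.ofFn π) = permSign d π := by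
  rw [listSign_eq_prod_univ d (fun i j => π.symm i < π.symm j) (fun a b h => h.not_gt)]
  · rfl
  · rw [List.pairwise_ofFn]
    intro i j hij
    simpa using hij
  · intro i
    rw [List.mem_ofFn]
    exact π.surjective i

/-- The blocks of a sequence of blocks as a list of increasing lists. -/
def OrderedPartition.blocks (y : OrderedPartition k) : List (List (Fin k)) :=
  List.ofFn fun j : Fin y.1 => (List.finRange k).filter (y.2.1 · = j)

/-- A signed word depends on the block function only. Words coming from compositions with
permutations and words coming from ordered set partitions can therefore be compared in a common
normal form with increasing blocks. -/
theorem signedWord_eq_blocks (hx : ∀ a b, x b * x a = (-1 : ℤ) ^ (d a * d b) • (x a * x b))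
    (y : OrderedPartition k) (B : Fin y.1 → List (Fin k)) (hB : ∀ j, (B j).Nodup)
    (hm : ∀ j a, a ∈ B j ↔ y.2.1 a = j) :
    signedWord K d x (List.ofFn B) = signedWord K d x y.blocks := by
  refine signedWord_congr d hx ?_ ?_
  · rw [OrderedPartition.blocks, List.forall₂_iff_get]
    refine ⟨by simp, fun i h₁ h₂ => ?_⟩
    rw [List.get_ofFn, List.get_ofFn]
    refine (List.perm_ext_iff_of_nodup (hB _) ((List.nodup_finRange k).filter _)).mpr fun a => ?_
    rw [hm, List.mem_filter]
    simp
  · rw [List.nodup_flatten]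
    refine ⟨fun l hl => ?_, ?_⟩
    · obtain ⟨j, rfl⟩ := (List.mem_ofFn' _ _).mp hl
      exact hB j
    · rw [List.pairwise_ofFn]
      intro i j hij a hi hj
      exact hij.ne (((hm i a).mp hi).symm.trans ((hm j a).mp hj))

theorem prod_ofFn_smul_tprod_composition (c : Composition k) (π : Equiv.Perm (Fin k))
    (hx : ∀ a b, x b * x a = (-1 : ℤ) ^ (d a * d b) • (x a * x b)) :
    permSign d π • TensorAlgebra.tprod K V c.length
        (fun j => (List.ofFn (fun a => x (π (c.embedding j a)))).prod) =
      signedWord K d x (OrderedPartition.ofComposition (c, π)).blocks := by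
  have hmem : ∀ j a, a ∈ List.ofFn (fun b => π (c.embedding j b)) ↔ c.index (π.symm a) = j := by
    intro j a
    rw [List.mem_ofFn]
    constructor
    · rintro ⟨b, rfl⟩
      rw [Equiv.symm_apply_apply]
      exact c.index_embedding j b
    · rintro rfl
      exact ⟨c.invEmbedding (π.symm a), by rw [c.embedding_comp_inv]; simp⟩
  rw [← signedWord_eq_blocks d hx (OrderedPartition.ofComposition (c, π))
    (fun j => List.ofFn fun a => π (c.embedding j a))
    (fun j => List.nodup_ofFn.mpr (π.injective.comp (c.embedding j).injective)) hmem]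
  have hs : listSign d (List.ofFn fun j => List.ofFn fun a => π (c.embedding j a)).flatten =
      permSign d π := by
    rw [listSign_eq_prod_univ d (fun i j => π.symm i < π.symm j) (fun a b h => h.not_gt)]
    · rfl
    · rw [List.pairwise_flatten]
      constructor
      · intro l hl
        obtain ⟨j, rfl⟩ := (List.mem_ofFn' _ _).mp hl
        rw [List.pairwise_ofFn]
        intro a b hab
        simpa using hab
      · rw [List.pairwise_ofFn]
        intro i j hij a ha b hb
        rw [hmem] at ha hb
        by_contra hcon
        rw [not_lt] at hcon
        -- The entries of an earlier block of a composition precede those of a later one, so the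
        -- flattened list is ordered by `π.symm`.
        have h3 : c.sizeUpTo (i : ℕ).succ ≤ c.sizeUpTo j := c.monotone_sizeUpTo hij
        have h4 := c.lt_sizeUpTo_index_succ (π.symm a)
        have h5 := c.sizeUpTo_index_le (π.symm b)
        rw [ha] at h4
        rw [hb] at h5
        have h6 : (π.symm b : ℕ) ≤ π.symm a := hcon
        exact absurd ((h4.trans_le h3).trans_le (h5.trans h6)) (lt_irrefl _)
    · intro a
      rw [List.mem_flatten]
      exact ⟨_, (List.mem_ofFn' _ _).mpr ⟨c.index (π.symm a), rfl⟩, (hmem _ _).mpr rfl⟩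
  change _ = listSign d (List.ofFn fun j => List.ofFn fun a => π (c.embedding j a)).flatten • _
  rw [hs, List.map_ofFn, TensorAlgebra.tprod_apply]
  congr 3
  funext j
  change _ = TensorAlgebra.ι K (listProd x (List.ofFn fun a => π (c.embedding j a)))
  rw [listProd, List.map_ofFn]
  rfl

/-- The degrees of the blocks of a partition. -/
def blockDeg (o : OrderedFinpartition k) (j : Fin o.length) : ℕ := ∑ a, d (o.emb j a)

/-- The products of the elements in the blocks of a partition. -/
def blockProd (x : Fin k → V) (o : OrderedFinpartition k) (j : Fin o.length) : V :=
  (List.ofFn fun a => x (o.emb j a)).prod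

/-- The concatenated blocks are ordered lexicographically, by block and then by the element itself.
Two elements of one block are never inverted, so only pairs from distinct blocks count. -/
theorem listSign_ofp (o : OrderedFinpartition k) :
    listSign d (List.ofFn fun j => List.ofFn (o.emb j)).flatten = partitionSign d o := by
  have hmem : ∀ j a, a ∈ List.ofFn (o.emb j) ↔ o.index a = j := by
    intro j a
    rw [List.mem_ofFn, ← ofp_mem_range_emb]
    rfl
  rw [listSign_eq_prod_univ d (fun i j => o.index i < o.index j ∨ (o.index i = o.index j ∧ i < j))]
  · refine Finset.prod_congr rfl fun i _ => Finset.prod_congr rfl fun j _ => ?_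
    have : (j < i ∧ (o.index i < o.index j ∨ (o.index i = o.index j ∧ i < j))) ↔
        (j < i ∧ o.index i < o.index j) := by
      constructor
      · rintro ⟨h1, h2 | h2⟩
        · exact ⟨h1, h2⟩
        · exact absurd h2.2 h1.not_gt
      · rintro ⟨h1, h2⟩
        exact ⟨h1, Or.inl h2⟩
    simp only [this]
  · rintro a b (h | h) (h' | h')
    · exact h.not_gt h'
    · exact h.ne h'.1.symm
    · exact h'.ne h.1.symm
    · exact h.2.not_gt h'.2
  · rw [List.pairwise_flatten]
    constructor
    · intro l hl
      obtain ⟨j, rfl⟩ := (List.mem_ofFn' _ _).mp hl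
      rw [List.pairwise_ofFn]
      intro a b hab
      exact Or.inr ⟨by rw [ofp_index_emb, ofp_index_emb], o.emb_strictMono j hab⟩
    · rw [List.pairwise_ofFn]
      intro i j hij a ha b hb
      rw [hmem] at ha hb
      exact Or.inl (by rwa [ha, hb])
  · intro a
    rw [List.mem_flatten]
    exact ⟨_, (List.mem_ofFn' _ _).mpr ⟨o.index a, rfl⟩, (hmem _ _).mpr rfl⟩

theorem listSign_ofp_perm (o : OrderedFinpartition k) (ρ : Equiv.Perm (Fin o.length)) :
    listSign d (List.ofFn fun j => List.ofFn (o.emb (ρ j))).flatten =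
      partitionSign d o * permSign (blockDeg d o) ρ := by
  have hperm : (List.ofFn ρ).Perm (List.finRange o.length) :=
    (List.perm_ext_iff_of_nodup (List.nodup_ofFn.mpr ρ.injective)
      (List.nodup_finRange _)).mpr fun a => by
        simp only [List.mem_ofFn, List.mem_finRange, iff_true]
        exact ρ.surjective a
  have h := listSign_flatten_perm d (fun j => List.ofFn (o.emb j)) (blockDeg d o)
    (fun j => by simp [blockDeg, List.map_ofFn, List.sum_ofFn])
    (fun i j hij a ha b hb => by
      obtain ⟨a, rfl⟩ := (List.mem_ofFn' _ _).mp ha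
      obtain ⟨b, rfl⟩ := (List.mem_ofFn' _ _).mp hb
      exact o.emb_ne_emb_of_ne hij) hperm (List.nodup_ofFn.mpr ρ.injective)
  rw [List.map_ofFn, listSign_ofFn_perm, ← List.ofFn_id, List.map_ofFn] at h
  have h2 := listSign_ofFn_perm (blockDeg d o) 1
  have h3 : listSign (blockDeg d o) (List.ofFn id) = 1 := by
    rw [List.ofFn_id]
    exact listSign_sorted _ (List.pairwise_lt_finRange _)
  have h4 := listSign_mul_self (blockDeg d o) (List.ofFn ρ)
  rw [listSign_ofFn_perm] at h4
  rw [h3, mul_one] at h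
  change _ = listSign d (List.ofFn fun j => List.ofFn (o.emb j)).flatten at h
  rw [listSign_ofp] at h
  rw [← h, mul_assoc, h4, mul_one]
  rfl

theorem tprod_blockProd_perm (o : OrderedFinpartition k) (ρ : Equiv.Perm (Fin o.length))
    (hx : ∀ a b, x b * x a = (-1 : ℤ) ^ (d a * d b) • (x a * x b)) :
    partitionSign d o • permSign (blockDeg d o) ρ •
        TensorAlgebra.tprod K V o.length (blockProd x o ∘ ρ) =
      signedWord K d x (OrderedPartition.ofPerm ⟨o, ρ⟩).blocks := by
  rw [← signedWord_eq_blocks d hx (OrderedPartition.ofPerm ⟨o, ρ⟩)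
    (fun j => List.ofFn (o.emb (ρ j)))
    (fun j => List.nodup_ofFn.mpr (o.emb_strictMono _).injective) (fun j a => by
      rw [List.mem_ofFn]
      change a ∈ Set.range (o.emb (ρ j)) ↔ ρ.symm (o.index a) = j
      rw [ofp_mem_range_emb]
      exact (Equiv.symm_apply_eq ρ).symm)]
  change _ = listSign d (List.ofFn fun j => List.ofFn (o.emb (ρ j))).flatten • _
  rw [listSign_ofp_perm, List.map_ofFn, TensorAlgebra.tprod_apply, mul_smul]
  congr 4
  funext j
  change _ = TensorAlgebra.ι K (listProd x (List.ofFn (o.emb (ρ j))))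
  rw [listProd, List.map_ofFn]
  rfl

/-- The cumulant map sends `x₁ ∧ … ∧ x_k` to the sum over all partitions of the wedge products of
the products over the blocks. -/
theorem cumulantMap_wedge [CharZero K]
    (hx : ∀ a b, x b * x a = (-1 : ℤ) ^ (d a * d b) • (x a * x b)) :
    cumulantMap K V (wedge K d x) = ∑ o : OrderedFinpartition k,
      partitionSign d o • wedge K (blockDeg d o) (blockProd x o) := by
  have h1 : cumulantMap K V (wedge K d x) = ∑ c : Composition k, ∑ π : Equiv.Perm (Fin k),
      (∏ j, ((c.blocksFun j).factorial : K)⁻¹) •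
        signedWord K d x (OrderedPartition.ofComposition (c, π)).blocks := by
    rw [wedge, map_sum, Finset.sum_comm]
    refine Finset.sum_congr rfl fun π _ => ?_
    rw [map_zsmul, cumulantMap_tprod, Finset.smul_sum]
    refine Finset.sum_congr rfl fun c _ => ?_
    rw [← prod_ofFn_smul_tprod_composition d c π hx, smul_comm]
    rfl
  -- Both sides are the sum of one signed word for each sequence of blocks: the left side reaches it
  -- through compositions and permutations, the right side through unordered partitions and
  -- orderings of their blocks.
  rw [h1, sum_composition_perm fun y => signedWord K d x y.blocks, sum_orderedPartition]
  refine Finset.sum_congr rfl fun o _ => ?_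
  rw [wedge, Finset.smul_sum]
  exact Finset.sum_congr rfl fun ρ _ => (tprod_blockProd_perm d o ρ hx).symm

/-- Reordering a product of homogeneous elements into blocks. -/
theorem prod_blockProd (o : OrderedFinpartition k)
    (hx : ∀ a b, x b * x a = (-1 : ℤ) ^ (d a * d b) • (x a * x b)) :
    partitionSign d o • (List.ofFn (blockProd x o)).prod = (List.ofFn x).prod := by
  have hnd : (List.ofFn fun j => List.ofFn (o.emb j)).flatten.Nodup := by
    rw [List.nodup_flatten]
    refine ⟨fun l hl => ?_, ?_⟩
    · obtain ⟨j, rfl⟩ := (List.mem_ofFn' _ _).mp hl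
      exact List.nodup_ofFn.mpr (o.emb_strictMono j).injective
    · rw [List.pairwise_ofFn]
      intro i j hij a hi hj
      obtain ⟨a, rfl⟩ := (List.mem_ofFn' _ _).mp hi
      obtain ⟨b, hb⟩ := (List.mem_ofFn' _ _).mp hj
      exact o.emb_ne_emb_of_ne hij.ne hb.symm
  have h := listSign_perm_smul d hx (l := (List.ofFn fun j => List.ofFn (o.emb j)).flatten)
    (l' := List.finRange k) ((List.perm_ext_iff_of_nodup hnd (List.nodup_finRange _)).mpr
      fun a => by
        simp only [List.mem_finRange, iff_true, List.mem_flatten]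
        exact ⟨_, (List.mem_ofFn' _ _).mpr ⟨o.index a, rfl⟩, (List.mem_ofFn' _ _).mpr
          ⟨_, o.emb_invEmbedding a⟩⟩) hnd
  rw [listSign_ofp, listSign_sorted d (List.pairwise_lt_finRange _), one_smul] at h
  have h1 : listProd x (List.finRange k) = (List.ofFn x).prod := by
    rw [listProd, List.ofFn_eq_map]
  have h2 : listProd x (List.ofFn fun j => List.ofFn (o.emb j)).flatten =
      (List.ofFn (blockProd x o)).prod := by
    rw [listProd, List.map_flatten, List.prod_flatten, List.map_ofFn, List.map_ofFn]
    congr 2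
    funext j
    simp only [Function.comp_apply, List.map_ofFn, blockProd]
    rfl
  rw [← h1, ← h, h2]

/-- Reordering a product of homogeneous elements. -/
theorem prod_ofFn_perm (π : Equiv.Perm (Fin k))
    (hx : ∀ a b, x b * x a = (-1 : ℤ) ^ (d a * d b) • (x a * x b)) :
    permSign d π • (List.ofFn (x ∘ π)).prod = (List.ofFn x).prod := by
  have h := listSign_perm_smul d hx (l := List.ofFn π) (l' := List.finRange k)
    ((List.perm_ext_iff_of_nodup (List.nodup_ofFn.mpr π.injective)
      (List.nodup_finRange _)).mpr fun a => by
        simp only [List.mem_ofFn, List.mem_finRange, iff_true]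
        exact π.surjective a) (List.nodup_ofFn.mpr π.injective)
  rw [listSign_ofFn_perm, listSign_sorted d (List.pairwise_lt_finRange _), one_smul, listProd,
    listProd, List.map_ofFn, ← List.ofFn_eq_map] at h
  exact h

end SignedWords

/-! ### Möbius numbers of set partitions -/

section Moebius

/-- The Möbius number `(-1)^{r-1} (r-1)!` of a partition into `r` blocks. -/
def moebius {k : ℕ} (o : OrderedFinpartition k) : ℤ :=
  (-1) ^ (o.length - 1) * ((o.length - 1).factorial : ℤ)

/-- Insert a new element into a partition with `r + 1` blocks. Joining one of them gives `r + 1`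
partitions of weight `(-1)^r r!`, and a block of its own gives one of weight `(-1)^{r+1} (r+1)!`;
these cancel. -/
theorem sum_moebius (k : ℕ) :
    ∑ o : OrderedFinpartition (k + 1), moebius o = if k = 0 then 1 else 0 := by
  rcases Nat.eq_zero_or_pos k with rfl | hk
  · rw [zero_add, Fintype.sum_unique]
    have h1 : (default : OrderedFinpartition 1).length = 1 :=
      le_antisymm (OrderedFinpartition.length_le _) (OrderedFinpartition.length_pos _ one_pos)
    rw [moebius, h1]
    rfl
  · rw [← (OrderedFinpartition.extendEquiv k).sum_comp, Fintype.sum_sigma, if_neg hk.ne']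
    refine Finset.sum_eq_zero fun o _ => ?_
    rw [Fintype.sum_option]
    have h1 := o.length_pos hk
    obtain ⟨r, hr⟩ := Nat.exists_eq_succ_of_ne_zero h1.ne'
    have h2 : ∀ i, moebius (o.extend (some i)) = (-1) ^ r * (r.factorial : ℤ) := by
      intro i
      have : (o.extend (some i)).length = o.length := rfl
      rw [moebius, this, hr]
      rfl
    have h3 : moebius (o.extend none) = (-1) ^ (r + 1) * ((r + 1).factorial : ℤ) := by
      have : (o.extend none).length = o.length + 1 := rfl
      rw [moebius, this, hr]
      rfl
    change moebius (o.extend none) + ∑ i, moebius (o.extend (some i)) = 0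
    rw [h3, Finset.sum_congr rfl fun i _ => h2 i, Finset.sum_const, Finset.card_univ,
      Fintype.card_fin, hr, Nat.factorial_succ, nsmul_eq_mul]
    push_cast
    ring

theorem factorial_mul_pred_inv (K : Type*) [Field K] [CharZero K] {r : ℕ} (hr : 0 < r) :
    (r.factorial : K) * ((-1) ^ (r - 1) / r) = (((-1) ^ (r - 1) * ((r - 1).factorial : ℤ) : ℤ) : K) := by
  obtain ⟨s, rfl⟩ := Nat.exists_eq_succ_of_ne_zero hr.ne'
  have : ((s : K) + 1) ≠ 0 := by exact_mod_cast Nat.succ_ne_zero s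
  simp only [Nat.succ_eq_add_one, Nat.add_sub_cancel, Nat.factorial_succ]
  push_cast
  field_simp

/-- There are `r!` orderings of `r` blocks, and `r! (-1)^{r-1} / r` is the Möbius number. Ordered
partitions are plain surjections, free of the normalisation by maxima, and hence convenient for a
change of the ground set. -/
theorem sum_moebius_eq_orderedPartition {k : ℕ} (hk : 0 < k) (P : OrderedPartition k → Prop)
    [DecidablePred P] (Q : OrderedFinpartition k → Prop) [DecidablePred Q]
    (hPQ : ∀ o ρ, P (OrderedPartition.ofPerm ⟨o, ρ⟩) ↔ Q o) :
    ((∑ o with Q o, moebius o : ℤ) : ℚ) = ∑ y with P y, (-1 : ℚ) ^ ((y.1 : ℕ) - 1) / (y.1 : ℕ) := by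
  rw [Finset.sum_filter, Finset.sum_filter, sum_orderedPartition, Int.cast_sum]
  refine Finset.sum_congr rfl fun o _ => ?_
  simp only [hPQ]
  split_ifs
  · change _ = ∑ _ρ : Equiv.Perm (Fin o.length), (-1 : ℚ) ^ (o.length - 1) / o.length
    rw [Finset.sum_const, Finset.card_univ, Fintype.card_perm, Fintype.card_fin, nsmul_eq_mul,
      moebius, ← factorial_mul_pred_inv ℚ (o.length_pos hk)]
  · simp

/-- The Möbius numbers of the partitions that are coarser than a given partition with at least
two blocks add up to zero. -/
theorem sum_moebius_coarser {k : ℕ} (s : Setoid (Fin k)) (h : ∃ a b, ¬ s a b)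
    [DecidablePred fun o : OrderedFinpartition k => ∀ a b, s a b → o.index a = o.index b] :
    ∑ o : OrderedFinpartition k with ∀ a b, s a b → o.index a = o.index b, moebius o = 0 := by
  classical
  obtain ⟨a₀, b₀, hab⟩ := h
  have hk : 0 < k := Fin.pos a₀
  let m := Fintype.card (Quotient s)
  let e : Quotient s ≃ Fin m := Fintype.equivFin _
  let q : Fin k → Fin m := fun a => e (Quotient.mk s a)
  have hq : Function.Surjective q := e.surjective.comp Quotient.mk_surjective
  have hqs : ∀ a b, q a = q b ↔ s a b := fun a b => by
    rw [e.apply_eq_iff_eq, Quotient.eq]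
  have hm : 2 ≤ m := by
    have : Nontrivial (Quotient s) := ⟨⟨Quotient.mk s a₀, Quotient.mk s b₀, fun h =>
      hab (Quotient.exact h)⟩⟩
    exact Fintype.one_lt_card
  have hmk : m ≤ k := by simpa using Fintype.card_le_of_surjective q hq
  have h1 := sum_moebius_eq_orderedPartition hk
    (fun y : OrderedPartition k => ∀ a b, s a b → y.2.1 a = y.2.1 b)
    (fun o => ∀ a b, s a b → o.index a = o.index b) (fun o ρ => by
      refine forall_congr' fun a => forall_congr' fun b => imp_congr_right fun _ => ?_
      exact ρ.symm.apply_eq_iff_eq)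
  have h2 := sum_moebius_eq_orderedPartition (show 0 < m by omega) (fun _ => True)
    (fun _ => True) (fun o ρ => Iff.rfl)
  obtain ⟨m', hm'⟩ : ∃ m', m = m' + 1 := ⟨m - 1, by omega⟩
  have h3 : ∑ o : OrderedFinpartition m, moebius o = 0 := by
    rw [hm', sum_moebius, if_neg (by omega)]
  rw [Finset.filter_true, Finset.filter_true, h3] at h2
  suffices hs : ((∑ o with ∀ a b, s a b → o.index a = o.index b, moebius o : ℤ) : ℚ) = 0 by
    exact_mod_cast hs
  rw [h1]
  rw [Int.cast_zero] at h2
  rw [h2]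
  symm
  -- Surjections that are constant on the classes of `s` are surjections from the quotient. The
  -- quotient has `m ≥ 2` elements, and over all partitions of `Fin m` the sum is zero.
  refine Finset.sum_bij (fun y _ => ⟨⟨y.1, by omega⟩, fun a => y.2.1 (q a), y.2.2.comp hq⟩)
    ?_ ?_ ?_ ?_
  · intro y _
    refine Finset.mem_filter.mpr ⟨Finset.mem_univ _, fun a b hs => ?_⟩
    change y.2.1 (q a) = y.2.1 (q b)
    rw [(hqs a b).mpr hs]
  · rintro ⟨r, f, hf⟩ _ ⟨r', f', hf'⟩ _ h
    have h4 : (r : ℕ) = r' := congrArg (fun y : OrderedPartition k => (y.1 : ℕ)) h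
    obtain rfl : r = r' := Fin.ext h4
    have h5 := Subtype.mk.inj (eq_of_heq (Sigma.mk.inj h).2)
    refine OrderedPartition.ext rfl fun c => ?_
    obtain ⟨a, rfl⟩ := hq c
    exact congrArg Fin.val (congrFun h5 a)
  · rintro ⟨⟨r, hr⟩, f, hf⟩ hy
    have hc := (Finset.mem_filter.mp hy).2
    dsimp only at f hf hc
    let g : Fin m → Fin r := fun c => Quotient.lift f hc (e.symm c)
    have hg : ∀ a, g (q a) = f a := fun a => by simp [g, q]
    have hgs : Function.Surjective g := fun j => by
      obtain ⟨a, rfl⟩ := hf j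
      exact ⟨q a, hg a⟩
    have hrm : r ≤ m := by simpa using Fintype.card_le_of_surjective g hgs
    exact ⟨⟨⟨r, by omega⟩, g, hgs⟩, Finset.mem_univ _, OrderedPartition.ext rfl fun a =>
      congrArg Fin.val (hg a)⟩
  · intro y _
    rfl

end Moebius

/-! ### The cumulant bijection of `S^*V` and the logarithm -/

section Symmetric

variable {K : Type*} [Field K] {V : Type*} [Ring V] [Algebra K V]

/-- `𝒱` makes `V` a graded commutative algebra (up to the decomposition into homogeneous parts). -/
structure IsGradedComm (𝒱 : ℕ → Submodule K V) : Prop where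
  one_mem : (1 : V) ∈ 𝒱 0
  mul_mem : ∀ d e, ∀ v ∈ 𝒱 d, ∀ w ∈ 𝒱 e, v * w ∈ 𝒱 (d + e)
  comm : ∀ d e, ∀ v ∈ 𝒱 d, ∀ w ∈ 𝒱 e, w * v = (-1 : ℤ) ^ (d * e) • (v * w)

theorem IsGradedComm.prod_mem {𝒱 : ℕ → Submodule K V} (h𝒱 : IsGradedComm 𝒱) {k : ℕ}
    (d : Fin k → ℕ) (x : Fin k → V) (hx : ∀ i, x i ∈ 𝒱 (d i)) :
    (List.ofFn x).prod ∈ 𝒱 (∑ i, d i) := by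
  induction k with
  | zero => simpa using h𝒱.one_mem
  | succ k ih =>
    rw [List.ofFn_succ, List.prod_cons, Fin.sum_univ_succ]
    exact h𝒱.mul_mem _ _ _ (hx 0) _ (ih _ _ fun i => hx i.succ)

theorem IsGradedComm.blockProd_mem {𝒱 : ℕ → Submodule K V} (h𝒱 : IsGradedComm 𝒱) {k : ℕ}
    {d : Fin k → ℕ} {x : Fin k → V} (hx : ∀ i, x i ∈ 𝒱 (d i)) (o : OrderedFinpartition k)
    (j : Fin o.length) : blockProd x o j ∈ 𝒱 (blockDeg d o j) :=
  h𝒱.prod_mem _ _ fun _ => hx _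

theorem wedge_mem_Sym (𝒱 : ℕ → Submodule K V) {k : ℕ} (hk : 0 < k) {d : Fin k → ℕ} {x : Fin k → V}
    (hx : ∀ i, x i ∈ 𝒱 (d i)) : wedge K d x ∈ Sym 𝒱 := by
  obtain ⟨k, rfl⟩ := Nat.exists_eq_succ_of_ne_zero hk.ne'
  exact Submodule.subset_span ⟨k, d, x, hx, rfl⟩

theorem IsGradedComm.cumulantMap_mem [CharZero K] {𝒱 : ℕ → Submodule K V} (h𝒱 : IsGradedComm 𝒱)
    {t : TensorAlgebra K V} (ht : t ∈ Sym 𝒱) : cumulantMap K V t ∈ Sym 𝒱 := by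
  have : Sym 𝒱 ≤ (Sym 𝒱).comap (cumulantMap K V) := by
    refine Submodule.span_le.mpr ?_
    rintro _ ⟨k, d, x, hx, rfl⟩
    rw [SetLike.mem_coe, Submodule.mem_comap,
      cumulantMap_wedge d fun a b => h𝒱.comm _ _ _ (hx a) _ (hx b)]
    refine Submodule.sum_mem _ fun o _ => zsmul_mem ?_ _
    exact wedge_mem_Sym 𝒱 (o.length_pos k.succ_pos) fun j => h𝒱.blockProd_mem hx o j
  exact this ht

/-- One inclusion is the partition formula. Conversely, `τ` minus the identity preserves `S^*V` and
shortens words, so preimages inside `S^*V` are found by induction on the length. -/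
theorem IsGradedComm.map_cumulantMap [CharZero K] {𝒱 : ℕ → Submodule K V} (h𝒱 : IsGradedComm 𝒱) :
    (Sym 𝒱).map (cumulantMap K V) = Sym 𝒱 := by
  refine le_antisymm (Submodule.map_le_iff_le_comap.mpr fun t ht => h𝒱.cumulantMap_mem ht) ?_
  have key : ∀ r, ∀ t ∈ Sym 𝒱, t ∈ lengthLE K V r → t ∈ (Sym 𝒱).map (cumulantMap K V) := by
    intro r
    induction r with
    | zero => exact fun t ht hr => ⟨t, ht, cumulantMap_eq_of_mem_zero t hr⟩
    | succ r ih =>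
      intro t ht hr
      have h1 := ih _ (Submodule.sub_mem _ (h𝒱.cumulantMap_mem ht) ht)
        (cumulantMap_sub_mem_of_mem r t hr)
      have h2 : t = cumulantMap K V t - (cumulantMap K V t - t) := by abel
      rw [h2]
      exact Submodule.sub_mem _ ⟨t, ht, rfl⟩ h1
  intro t ht
  obtain ⟨r, hr⟩ := exists_mem_lengthLE t
  exact key r t ht hr

theorem cumulantEquiv_symm_cumulantMap (t : TensorAlgebra K V) :
    (cumulantEquiv K V).symm (cumulantMap K V t) = t :=
  (cumulantEquiv K V).symm_apply_apply t

theorem cumulantMap_cumulantEquiv_symm (t : TensorAlgebra K V) :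
    cumulantMap K V ((cumulantEquiv K V).symm t) = t :=
  (cumulantEquiv K V).apply_symm_apply t

theorem IsGradedComm.cumulantEquiv_symm_mem [CharZero K] {𝒱 : ℕ → Submodule K V} (h𝒱 : IsGradedComm 𝒱)
    {t : TensorAlgebra K V} (ht : t ∈ Sym 𝒱) : (cumulantEquiv K V).symm t ∈ Sym 𝒱 := by
  rw [← h𝒱.map_cumulantMap] at ht
  obtain ⟨u, hu, rfl⟩ := ht
  rwa [cumulantEquiv_symm_cumulantMap]

/-- The logarithm `x₁ ⊗ ⋯ ⊗ x_k ↦ (-1)^{k-1} / k • x₁ ⋯ x_k`. -/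
def logProd (K : Type*) [Field K] (V : Type*) [Ring V] [Algebra K V] :
    TensorAlgebra K V →ₗ[K] V :=
  liftWords fun k => ((-1 : K) ^ (k - 1) / k) • MultilinearMap.mkPiAlgebraFin K k V

theorem logProd_tprod (k : ℕ) (x : Fin k → V) : logProd K V (TensorAlgebra.tprod K V k x) =
    ((-1 : K) ^ (k - 1) / k) • (List.ofFn x).prod := by
  rw [logProd, liftWords_tprod, smul_apply, MultilinearMap.mkPiAlgebraFin_apply]

/-- All `k!` words have the same signed product, and `k! / k = (k - 1)!`. -/
theorem logProd_wedge [CharZero K] {k : ℕ} (hk : 0 < k) (d : Fin k → ℕ) (x : Fin k → V)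
    (hx : ∀ a b, x b * x a = (-1 : ℤ) ^ (d a * d b) • (x a * x b)) :
    logProd K V (wedge K d x) =
      ((-1 : ℤ) ^ (k - 1) * ((k - 1).factorial : ℤ)) • (List.ofFn x).prod := by
  have : ∀ π : Equiv.Perm (Fin k), logProd K V (permSign d π • TensorAlgebra.tprod K V k (x ∘ π)) =
      ((-1 : K) ^ (k - 1) / k) • (List.ofFn x).prod := by
    intro π
    rw [map_zsmul, logProd_tprod, smul_comm, prod_ofFn_perm d π hx]
  rw [wedge, map_sum, Finset.sum_congr rfl fun π _ => this π, Finset.sum_const, Finset.card_univ,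
    Fintype.card_perm, Fintype.card_fin, ← Nat.cast_smul_eq_nsmul K, smul_smul,
    factorial_mul_pred_inv K hk, Int.cast_smul_eq_zsmul]

theorem proj₁_ι (v : V) : proj₁ K V (TensorAlgebra.ι K v) = v :=
  TensorAlgebra.ι_leftInverse v

/-- The projection is read off in the trivial square-zero extension, where the product of the images
of two letters vanishes. -/
theorem proj₁_ι_mul_ι (v w : V) (t : TensorAlgebra K V) :
    proj₁ K V (TensorAlgebra.ι K v * (TensorAlgebra.ι K w * t)) = 0 := by
  let _ : Module Kᵐᵒᵖ V := Module.compHom _ ((RingHom.id K).fromOpposite mul_comm)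
  have : IsCentralScalar K V := ⟨fun r m => rfl⟩
  change (TensorAlgebra.toTrivSqZeroExt (R := K) (M := V)
    (TensorAlgebra.ι K v * (TensorAlgebra.ι K w * t))).snd = 0
  rw [map_mul, map_mul, TensorAlgebra.toTrivSqZeroExt_ι, TensorAlgebra.toTrivSqZeroExt_ι,
    ← mul_assoc, TrivSqZeroExt.inr_mul_inr, zero_mul, TrivSqZeroExt.snd_zero]

theorem proj₁_tprod_one (x : Fin 1 → V) : proj₁ K V (TensorAlgebra.tprod K V 1 x) = x 0 := by
  rw [TensorAlgebra.tprod_apply]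
  simp [proj₁_ι]

theorem proj₁_tprod (k : ℕ) (x : Fin (k + 2) → V) :
    proj₁ K V (TensorAlgebra.tprod K V (k + 2) x) = 0 := by
  rw [TensorAlgebra.tprod_apply, List.ofFn_succ, List.ofFn_succ, List.prod_cons, List.prod_cons,
    proj₁_ι_mul_ι]

/-- On `S^*V` the linear part of `τ⁻¹` is the logarithm. -/
theorem IsGradedComm.proj₁_cumulantEquiv_symm [CharZero K] {𝒱 : ℕ → Submodule K V} (h𝒱 : IsGradedComm 𝒱)
    {t : TensorAlgebra K V} (ht : t ∈ Sym 𝒱) :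
    proj₁ K V ((cumulantEquiv K V).symm t) = logProd K V t := by
  rw [← h𝒱.map_cumulantMap] at ht
  obtain ⟨u, hu, rfl⟩ := ht
  rw [cumulantEquiv_symm_cumulantMap]
  have : Sym 𝒱 ≤ LinearMap.eqLocus (proj₁ K V) (logProd K V ∘ₗ cumulantMap K V) := by
    refine Submodule.span_le.mpr ?_
    rintro _ ⟨k, d, x, hx, rfl⟩
    have hc := fun a b => h𝒱.comm _ _ _ (hx a) _ (hx b)
    change proj₁ K V _ = logProd K V (cumulantMap K V _)
    rw [cumulantMap_wedge d hc, map_sum]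
    have h1 : ∀ o : OrderedFinpartition (k + 1), logProd K V
        (partitionSign d o • wedge K (blockDeg d o) (blockProd x o)) =
        moebius o • (List.ofFn x).prod := by
      intro o
      rw [map_zsmul, logProd_wedge (o.length_pos k.succ_pos) _ _ fun a b =>
        h𝒱.comm _ _ _ (h𝒱.blockProd_mem hx o a) _ (h𝒱.blockProd_mem hx o b), smul_comm,
        prod_blockProd d o hc, moebius]
    -- Every partition contributes the same product, so only the total of the Möbius numbers
    -- matters: one for a single letter and zero for longer words, just like the projection.
    rw [Finset.sum_congr rfl fun o _ => h1 o, ← Finset.sum_smul, sum_moebius, wedge, map_sum]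
    rcases k with _ | k
    · have h2 : ∀ π : Equiv.Perm (Fin (0 + 1)), π = 1 := fun π =>
        Equiv.ext fun i => Subsingleton.elim (α := Fin 1) _ _
      rw [if_pos rfl, Fintype.sum_eq_single 1 fun π hπ => absurd (h2 π) hπ, map_zsmul,
        proj₁_tprod_one]
      simp [permSign]
    · rw [if_neg k.succ_ne_zero, zero_smul]
      refine Finset.sum_eq_zero fun π _ => ?_
      rw [map_zsmul, proj₁_tprod, smul_zero]
  exact this hu

variable {W : Type*} [Ring W] [Algebra K W]

theorem tensorMap_tprod (f : V →ₗ[K] W) (k : ℕ) (x : Fin k → V) :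
    tensorMap f (TensorAlgebra.tprod K V k x) = TensorAlgebra.tprod K W k fun i => f (x i) := by
  rw [TensorAlgebra.tprod_apply, TensorAlgebra.tprod_apply, map_list_prod, List.map_ofFn]
  congr 2
  funext i
  simp [tensorMap]

theorem tensorMap_wedge (f : V →ₗ[K] W) {k : ℕ} (d : Fin k → ℕ) (x : Fin k → V) :
    tensorMap f (wedge K d x) = wedge K d fun i => f (x i) := by
  simp only [wedge, map_sum, map_zsmul, tensorMap_tprod]
  rfl

theorem tensorMap_mem_Sym {𝒱 : ℕ → Submodule K V} {𝒲 : ℕ → Submodule K W} {f : V →ₗ[K] W}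
    (hf : ∀ d, ∀ v ∈ 𝒱 d, f v ∈ 𝒲 d) {t : TensorAlgebra K V} (ht : t ∈ Sym 𝒱) :
    tensorMap f t ∈ Sym 𝒲 := by
  have : Sym 𝒱 ≤ (Sym 𝒲).comap (tensorMap f).toLinearMap := by
    refine Submodule.span_le.mpr ?_
    rintro _ ⟨k, d, x, hx, rfl⟩
    change tensorMap f _ ∈ Sym 𝒲
    rw [tensorMap_wedge]
    exact wedge_mem_Sym 𝒲 k.succ_pos fun i => hf _ _ (hx i)
  exact this ht

theorem cumulantConj_mem_Sym [CharZero K] {𝒱 : ℕ → Submodule K V} {𝒲 : ℕ → Submodule K W}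
    (h𝒱 : IsGradedComm 𝒱) (h𝒲 : IsGradedComm 𝒲) {f : V →ₗ[K] W}
    (hf : ∀ d, ∀ v ∈ 𝒱 d, f v ∈ 𝒲 d) {t : TensorAlgebra K V} (ht : t ∈ Sym 𝒱) :
    cumulantConj f t ∈ Sym 𝒲 :=
  h𝒲.cumulantEquiv_symm_mem (tensorMap_mem_Sym hf (h𝒱.cumulantMap_mem ht))

/-- The Taylor coefficients of `σ` are the cumulants. -/
theorem proj₁_cumulantConj_wedge [CharZero K] {𝒱 : ℕ → Submodule K V} {𝒲 : ℕ → Submodule K W}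
    (h𝒱 : IsGradedComm 𝒱) (h𝒲 : IsGradedComm 𝒲) {f : V →ₗ[K] W}
    (hf : ∀ d, ∀ v ∈ 𝒱 d, f v ∈ 𝒲 d) {k : ℕ} (hk : 0 < k) {d : Fin k → ℕ} {x : Fin k → V}
    (hx : ∀ i, x i ∈ 𝒱 (d i)) :
    proj₁ K W (cumulantConj f (wedge K d x)) = cumulant f d x := by
  have h1 := wedge_mem_Sym 𝒱 hk hx
  change proj₁ K W ((cumulantEquiv K W).symm (tensorMap f (cumulantMap K V _))) = _
  rw [h𝒲.proj₁_cumulantEquiv_symm (tensorMap_mem_Sym hf (h𝒱.cumulantMap_mem h1)),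
    cumulantMap_wedge d fun a b => h𝒱.comm _ _ _ (hx a) _ (hx b), map_sum, map_sum, cumulant]
  refine Finset.sum_congr rfl fun o _ => ?_
  rw [map_zsmul, map_zsmul, tensorMap_wedge, logProd_wedge (o.length_pos hk) _ _ fun a b =>
    h𝒲.comm _ _ _ (hf _ _ (h𝒱.blockProd_mem hx o a)) _ (hf _ _ (h𝒱.blockProd_mem hx o b)),
    smul_smul, mul_comm]
  rfl

theorem cumulant_mem {𝒱 : ℕ → Submodule K V} {𝒲 : ℕ → Submodule K W}
    (h𝒱 : IsGradedComm 𝒱) (h𝒲 : IsGradedComm 𝒲) {f : V →ₗ[K] W}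
    (hf : ∀ d, ∀ v ∈ 𝒱 d, f v ∈ 𝒲 d) {k : ℕ} {d : Fin k → ℕ} {x : Fin k → V}
    (hx : ∀ i, x i ∈ 𝒱 (d i)) : cumulant f d x ∈ 𝒲 (∑ i, d i) := by
  refine Submodule.sum_mem _ fun o _ => zsmul_mem ?_ _
  have := h𝒲.prod_mem (blockDeg d o) (fun j => f (blockProd x o j))
    fun j => hf _ _ (h𝒱.blockProd_mem hx o j)
  rwa [show ∑ j, blockDeg d o j = ∑ i, d i from o.sum_sigma_eq_sum d] at this

/-- `x₁ ∧ … ∧ x_k` as a multilinear function of the `x_i`. -/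
def wedgeMultilinear (K : Type*) [Field K] (V : Type*) [Ring V] [Algebra K V] {k : ℕ}
    (d : Fin k → ℕ) : MultilinearMap K (fun _ : Fin k => V) (TensorAlgebra K V) :=
  ∑ π : Equiv.Perm (Fin k), permSign d π • (TensorAlgebra.tprod K V k).domDomCongr π

theorem wedgeMultilinear_apply {k : ℕ} (d : Fin k → ℕ) (x : Fin k → V) :
    wedgeMultilinear K V d x = wedge K d x := by
  simp only [wedgeMultilinear, wedge, sum_apply, smul_apply,
    MultilinearMap.domDomCongr_apply]
  rfl

end Symmetric

/-! ### Coderivations on signed symmetrisations and the brackets -/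

section Coderivation

variable {K : Type*} [Field K] {V : Type*} [Ring V] [Algebra K V]
  {W : Type*} [Ring W] [Algebra K W]

theorem tensorAlgebra_hom_ext {X : Type*} [AddCommGroup X] [Module K X]
    {f g : TensorAlgebra K V →ₗ[K] X}
    (h : ∀ k (x : Fin k → V), f (TensorAlgebra.tprod K V k x) = g (TensorAlgebra.tprod K V k x)) :
    f = g := by
  ext t
  obtain ⟨r, hr⟩ := exists_mem_lengthLE t
  have : lengthLE K V r ≤ LinearMap.eqLocus f g := by
    refine Submodule.span_le.mpr ?_
    rintro _ ⟨k, hk, x, rfl⟩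
    exact h k x
  exact this hr

theorem tprod_succ (k : ℕ) (x : Fin (k + 1) → V) : TensorAlgebra.tprod K V (k + 1) x =
    TensorAlgebra.ι K (x 0) * TensorAlgebra.tprod K V k (fun i => x i.succ) := by
  rw [TensorAlgebra.tprod_apply, TensorAlgebra.tprod_apply, List.ofFn_succ, List.prod_cons]

theorem tprod_zero (x : Fin 0 → V) : TensorAlgebra.tprod K V 0 x = 1 := by
  simp [TensorAlgebra.tprod_apply]

theorem coderivationExt_tprod (s del : V →ₗ[K] V) (k : ℕ) (x : Fin k → V) :
    coderivationExt s del (TensorAlgebra.tprod K V k x) = ∑ i, TensorAlgebra.tprod K V k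
      (fun j => if j < i then s (x j) else if j = i then del (x j) else x j) := by
  rw [coderivationExt, liftWords_tprod, sum_apply]
  refine Finset.sum_congr rfl fun i _ => ?_
  rw [MultilinearMap.compLinearMap_apply]
  congr 1
  funext j
  split_ifs <;> rfl

/-- A twisted Leibniz rule in the first letter, which makes induction over words available for
coderivations. -/
theorem coderivationExt_ι_mul (s del : V →ₗ[K] V) (v : V) (t : TensorAlgebra K V) :
    coderivationExt s del (TensorAlgebra.ι K v * t) = TensorAlgebra.ι K (del v) * t +
      TensorAlgebra.ι K (s v) * coderivationExt s del t := by
  have : coderivationExt s del ∘ₗ LinearMap.mulLeft K (TensorAlgebra.ι K v) =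
      LinearMap.mulLeft K (TensorAlgebra.ι K (del v)) +
      LinearMap.mulLeft K (TensorAlgebra.ι K (s v)) ∘ₗ coderivationExt s del := by
    refine tensorAlgebra_hom_ext fun k x => ?_
    have h1 : TensorAlgebra.ι K v * TensorAlgebra.tprod K V k x =
        TensorAlgebra.tprod K V (k + 1) (Fin.cons v x) := by
      rw [tprod_succ]
      rfl
    simp only [LinearMap.comp_apply, LinearMap.mulLeft_apply, LinearMap.add_apply]
    rw [h1, coderivationExt_tprod, coderivationExt_tprod, Fin.sum_univ_succ, Finset.mul_sum]
    congr 1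
    · rw [tprod_succ]
      simp [Fin.succ_ne_zero]
    · refine Finset.sum_congr rfl fun i _ => ?_
      rw [tprod_succ]
      simp [Fin.succ_lt_succ_iff, Fin.succ_pos]
  exact LinearMap.congr_fun this t

theorem coderivationExt_one (s del : V →ₗ[K] V) : coderivationExt s del 1 = 0 := by
  rw [← tprod_zero (K := K) (V := V) Fin.elim0, coderivationExt_tprod]
  simp

/-- Induction over words. -/
theorem word_induction {P : TensorAlgebra K V → Prop} (h1 : P 1)
    (hmul : ∀ v t, P t → P (TensorAlgebra.ι K v * t)) (hadd : ∀ t u, P t → P u → P (t + u))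
    (hsmul : ∀ (a : K) t, P t → P (a • t)) (t : TensorAlgebra K V) : P t := by
  have key : ∀ k (x : Fin k → V), P (TensorAlgebra.tprod K V k x) := by
    intro k
    induction k with
    | zero => intro x; rwa [tprod_zero]
    | succ k ih => intro x; rw [tprod_succ]; exact hmul _ _ (ih _)
  obtain ⟨r, hr⟩ := exists_mem_lengthLE t
  refine Submodule.span_induction (p := fun t _ => P t) ?_ ?_ (fun t u _ _ => hadd t u)
    (fun a t _ => hsmul a t) hr
  · rintro _ ⟨k, _, x, rfl⟩
    exact key k x
  · have := hsmul 0 1 h1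
    rwa [zero_smul] at this

/-- The two cross terms carry `s (del v)` and `del (s v)`, and these cancel. -/
theorem coderivationExt_comp_self {s del : V →ₗ[K] V} (hdel : del ∘ₗ del = 0)
    (hs : ∀ v, s (del v) = - del (s v)) (t : TensorAlgebra K V) :
    coderivationExt s del (coderivationExt s del t) = 0 := by
  induction t using word_induction with
  | h1 => rw [coderivationExt_one, map_zero]
  | hmul v t ih =>
    have : del (del v) = 0 := LinearMap.congr_fun hdel v
    rw [coderivationExt_ι_mul, map_add, coderivationExt_ι_mul, coderivationExt_ι_mul, ih, this, hs]
    simp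
  | hadd t u ht hu => rw [map_add, map_add, ht, hu, add_zero]
  | hsmul a t ht => rw [map_smul, map_smul, ht, smul_zero]

theorem tensorMap_ι_mul (f : V →ₗ[K] W) (v : V) (t : TensorAlgebra K V) :
    tensorMap f (TensorAlgebra.ι K v * t) = TensorAlgebra.ι K (f v) * tensorMap f t := by
  rw [map_mul]
  simp [tensorMap]

theorem tensorMap_coderivationExt {s del : V →ₗ[K] V} {s' del' : W →ₗ[K] W} {f : V →ₗ[K] W}
    (hs : ∀ v, f (s v) = s' (f v)) (hdel : ∀ v, f (del v) = del' (f v)) (t : TensorAlgebra K V) :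
    tensorMap f (coderivationExt s del t) = coderivationExt s' del' (tensorMap f t) := by
  induction t using word_induction with
  | h1 => rw [coderivationExt_one, map_zero, map_one, coderivationExt_one]
  | hmul v t ih =>
    rw [coderivationExt_ι_mul, map_add, tensorMap_ι_mul, tensorMap_ι_mul, tensorMap_ι_mul,
      coderivationExt_ι_mul, ih, hs, hdel]
  | hadd t u ht hu => rw [map_add, map_add, ht, hu, map_add, map_add]
  | hsmul a t ht => rw [map_smul, map_smul, ht, map_smul, map_smul]

/-- The sign of moving an odd element to position `a` past the elements before it. -/
def passSign {k : ℕ} (d : Fin k → ℕ) (a : Fin k) : ℤ := ∏ b, if b < a then (-1) ^ d b else 1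

/-- Raising the degree at `a` by one multiplies the sign by `(-1) ^ d b` for each `b` inverted with
`a`. The elements before `a` in the permuted order and those before `a` in the original order differ
by exactly these `b`, so both sides change by the same factor. -/
theorem permSign_update {k : ℕ} (d : Fin k → ℕ) (a : Fin k) (π : Equiv.Perm (Fin k)) :
    permSign d π * (∏ b, if π.symm b < π.symm a then (-1 : ℤ) ^ d b else 1) =
      passSign d a * permSign (Function.update d a (d a + 1)) π := by
  have h1 : permSign (Function.update d a (d a + 1)) π = permSign d π *
      ((∏ b, if b < a ∧ π.symm a < π.symm b then (-1 : ℤ) ^ d b else 1) *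
        ∏ b, if a < b ∧ π.symm b < π.symm a then (-1 : ℤ) ^ d b else 1) := by
    have e1 : (∏ b, if b < a ∧ π.symm a < π.symm b then (-1 : ℤ) ^ d b else 1) =
        ∏ i, ∏ j, if i = a then (if j < i ∧ π.symm i < π.symm j then (-1 : ℤ) ^ d j else 1)
          else 1 := by
      symm
      rw [Finset.prod_eq_single a]
      · simp
      · intro i _ hi
        simp [hi]
      · simp
    have e2 : (∏ b, if a < b ∧ π.symm b < π.symm a then (-1 : ℤ) ^ d b else 1) =
        ∏ i, ∏ j, if j = a then (if j < i ∧ π.symm i < π.symm j then (-1 : ℤ) ^ d i else 1)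
          else 1 := by
      refine Finset.prod_congr rfl fun i _ => ?_
      rw [Finset.prod_ite_eq' Finset.univ a]
      simp
    rw [e1, e2, permSign, permSign, ← Finset.prod_mul_distrib, ← Finset.prod_mul_distrib]
    refine Finset.prod_congr rfl fun i _ => ?_
    rw [← Finset.prod_mul_distrib, ← Finset.prod_mul_distrib]
    refine Finset.prod_congr rfl fun j _ => ?_
    by_cases h : j < i ∧ π.symm i < π.symm j
    · simp only [h, and_self, if_true]
      by_cases hi : i = a
      · subst hi
        have hj : j ≠ i := h.1.ne
        simp only [Function.update_self, Function.update_of_ne hj, hj, if_true, if_false]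
        ring
      · by_cases hj : j = a
        · subst hj
          simp only [Function.update_self, Function.update_of_ne hi, hi, if_true, if_false]
          ring
        · simp [hi, hj]
    · simp [h]
  have h2 : (∏ b, if π.symm b < π.symm a then (-1 : ℤ) ^ d b else 1) = passSign d a *
      ((∏ b, if b < a ∧ π.symm a < π.symm b then (-1 : ℤ) ^ d b else 1) *
        ∏ b, if a < b ∧ π.symm b < π.symm a then (-1 : ℤ) ^ d b else 1) := by
    rw [passSign, ← Finset.prod_mul_distrib, ← Finset.prod_mul_distrib]
    refine Finset.prod_congr rfl fun b _ => ?_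
    have hsq : (-1 : ℤ) ^ d b * (-1) ^ d b = 1 := by rw [← mul_pow]; simp
    rcases lt_trichotomy b a with h | h | h
    · rcases lt_trichotomy (π.symm b) (π.symm a) with h' | h' | h'
      · simp [h, h', h.not_gt, h'.not_gt]
      · exact absurd (π.symm.injective h') h.ne
      · simp [h, h', h.not_gt, h'.not_gt, hsq]
    · simp [h]
    · rcases lt_trichotomy (π.symm b) (π.symm a) with h' | h' | h'
      · simp [h, h', h.not_gt]
      · exact absurd (π.symm.injective h') h.ne'
      · simp [h, h', h.not_gt, h'.not_gt]
  rw [h1, h2]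
  ring

/-- The involution `s` on the letters before the differentiated one supplies exactly the sign that
`permSign_update` needs to produce the permutation sign for the new degrees. So the outcome consists
of wedges again, and `S^*V` is preserved. -/
theorem coderivationExt_wedge {s del : V →ₗ[K] V} {k : ℕ} {d : Fin k → ℕ} {x : Fin k → V}
    (hs : ∀ i, s (x i) = (-1 : ℤ) ^ d i • x i) :
    coderivationExt s del (wedge K d x) = ∑ a, passSign d a •
      wedge K (Function.update d a (d a + 1)) (Function.update x a (del (x a))) := by
  have h1 : ∀ π : Equiv.Perm (Fin k), ∀ a, TensorAlgebra.tprod K V k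
      (fun j => if j < π.symm a then s ((x ∘ π) j) else if j = π.symm a then del ((x ∘ π) j)
        else (x ∘ π) j) = (∏ b, if π.symm b < π.symm a then (-1 : ℤ) ^ d b else 1) •
        TensorAlgebra.tprod K V k (Function.update x a (del (x a)) ∘ π) := by
    intro π a
    have h2 : (fun j => if j < π.symm a then s ((x ∘ π) j) else if j = π.symm a then
        del ((x ∘ π) j) else (x ∘ π) j) = fun j =>
          (((if j < π.symm a then (-1 : ℤ) ^ d (π j) else 1 : ℤ) : K)) •
            (Function.update x a (del (x a)) ∘ π) j := by
      funext j
      simp only [Function.comp_apply]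
      rcases lt_trichotomy j (π.symm a) with h | h | h
      · have : π j ≠ a := by
          rintro rfl
          simp at h
        rw [if_pos h, if_pos h, Function.update_of_ne this, hs, Int.cast_smul_eq_zsmul]
      · subst h
        simp
      · have : π j ≠ a := by
          rintro rfl
          simp at h
        rw [if_neg h.not_gt, if_neg h.ne', if_neg h.not_gt, Function.update_of_ne this,
          Int.cast_one, one_smul]
    rw [h2, MultilinearMap.map_smul_univ, ← Int.cast_prod, Int.cast_smul_eq_zsmul]
    congr 1
    exact Fintype.prod_equiv π _ _ fun j => by simp
  simp only [wedge, map_sum, map_zsmul, coderivationExt_tprod, Finset.smul_sum]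
  have h3 : ∀ π : Equiv.Perm (Fin k), (∑ i, permSign d π • TensorAlgebra.tprod K V k
      (fun j => if j < i then s ((x ∘ π) j) else if j = i then del ((x ∘ π) j) else (x ∘ π) j)) =
      ∑ a, passSign d a • permSign (Function.update d a (d a + 1)) π •
        TensorAlgebra.tprod K V k (Function.update x a (del (x a)) ∘ π) := by
    intro π
    rw [← Equiv.sum_comp π.symm]
    refine Finset.sum_congr rfl fun a _ => ?_
    rw [h1, smul_smul, permSign_update, mul_smul]
  rw [Finset.sum_congr rfl fun π _ => h3 π, Finset.sum_comm]

theorem coderivationExt_mem_Sym {𝒱 : ℕ → Submodule K V} {s del : V →ₗ[K] V}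
    (hs : ∀ d, ∀ v ∈ 𝒱 d, s v = (-1 : ℤ) ^ d • v) (hdel : ∀ d, ∀ v ∈ 𝒱 d, del v ∈ 𝒱 (d + 1))
    {t : TensorAlgebra K V} (ht : t ∈ Sym 𝒱) : coderivationExt s del t ∈ Sym 𝒱 := by
  have : Sym 𝒱 ≤ (Sym 𝒱).comap (coderivationExt s del) := by
    refine Submodule.span_le.mpr ?_
    rintro _ ⟨k, d, x, hx, rfl⟩
    rw [SetLike.mem_coe, Submodule.mem_comap, coderivationExt_wedge fun i => hs _ _ (hx i)]
    refine Submodule.sum_mem _ fun a _ => zsmul_mem (wedge_mem_Sym 𝒱 k.succ_pos fun i => ?_) _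
    by_cases h : i = a
    · subst h
      simpa using hdel _ _ (hx i)
    · simpa [Function.update_of_ne h] using hx i
  exact this ht

theorem cumulantCoderivation_mem_Sym [CharZero K] {𝒱 : ℕ → Submodule K V} (h𝒱 : IsGradedComm 𝒱)
    {s del : V →ₗ[K] V} (hs : ∀ d, ∀ v ∈ 𝒱 d, s v = (-1 : ℤ) ^ d • v)
    (hdel : ∀ d, ∀ v ∈ 𝒱 d, del v ∈ 𝒱 (d + 1)) {t : TensorAlgebra K V} (ht : t ∈ Sym 𝒱) :
    cumulantCoderivation s del t ∈ Sym 𝒱 :=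
  h𝒱.cumulantEquiv_symm_mem (coderivationExt_mem_Sym hs hdel (h𝒱.cumulantMap_mem ht))

/-- Moving an odd factor at position `a` to the front of a product. -/
theorem prod_update_odd {k : ℕ} {d : Fin k → ℕ} {x : Fin k → V} {θ : V}
    (hθ : ∀ i, x i * θ = (-1 : ℤ) ^ d i • (θ * x i)) (a : Fin k) (y : V) :
    passSign d a • (List.ofFn (Function.update x a (θ * y))).prod =
      θ * (List.ofFn (Function.update x a y)).prod := by
  induction k with
  | zero => exact a.elim0
  | succ k ih =>
    rw [List.ofFn_succ, List.ofFn_succ, List.prod_cons, List.prod_cons]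
    rcases Fin.eq_zero_or_eq_succ a with rfl | ⟨a, rfl⟩
    · have h1 : passSign d 0 = 1 := by simp [passSign]
      rw [h1, one_smul, Function.update_self, Function.update_self, mul_assoc]
      congr 4
    · have h1 : passSign d a.succ = (-1) ^ d 0 * passSign (fun i => d i.succ) a := by
        rw [passSign, Fin.prod_univ_succ]
        simp [passSign, Fin.succ_lt_succ_iff]
      have h2 : ∀ z, (fun i : Fin k => Function.update x a.succ z i.succ) =
          Function.update (fun i => x i.succ) a z := fun z => by
        funext i
        by_cases h : i = a
        · subst h; simp
        · rw [Function.update_of_ne h, Function.update_of_ne (fun h' => h (Fin.succ_injective _ h'))]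
      rw [h2, h2, Function.update_of_ne (Fin.succ_ne_zero a).symm,
        Function.update_of_ne (Fin.succ_ne_zero a).symm, h1, mul_smul, ← mul_smul_comm (passSign _ a),
        ih (fun i => hθ i.succ), ← mul_assoc, hθ 0, smul_mul_assoc, smul_smul, ← mul_pow]
      simp [mul_assoc]

/-- The brackets of a differential that is a linear combination of the operators `θ (T - T')` with
`θ` odd and automorphisms `T`, `T'`. -/
theorem proj₁_cumulantCoderivation_wedge [CharZero K] {𝒱 : ℕ → Submodule K V}
    (h𝒱 : IsGradedComm 𝒱) {s del : V →ₗ[K] V} (hs : ∀ d, ∀ v ∈ 𝒱 d, s v = (-1 : ℤ) ^ d • v)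
    (hdel : ∀ d, ∀ v ∈ 𝒱 d, del v ∈ 𝒱 (d + 1)) {U : Type*} [Fintype U] (c : K) (θ : U → V)
    (T T' : U → V →ₐ[K] V) (hθ : ∀ u d, ∀ v ∈ 𝒱 d, v * θ u = (-1 : ℤ) ^ d • (θ u * v))
    (hT : ∀ u d, ∀ v ∈ 𝒱 d, T u v ∈ 𝒱 d) (hT' : ∀ u d, ∀ v ∈ 𝒱 d, T' u v ∈ 𝒱 d)
    (hd : ∀ v, del v = c • ∑ u, θ u * (T u v - T' u v))
    {k : ℕ} (hk : 0 < k) {d : Fin k → ℕ} {x : Fin k → V} (hx : ∀ i, x i ∈ 𝒱 (d i)) :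
    proj₁ K V (cumulantCoderivation s del (wedge K d x)) = c • ∑ u, θ u *
      ∑ o : OrderedFinpartition k, moebius o • ∑ j : Fin o.length,
        ((List.ofFn fun i => if o.index i = j then T u (x i) else x i).prod -
          (List.ofFn fun i => if o.index i = j then T' u (x i) else x i).prod) := by
  have h1 := wedge_mem_Sym 𝒱 hk hx
  have h2 : ∀ (S : V →ₐ[K] V) (_ : ∀ d, ∀ v ∈ 𝒱 d, S v ∈ 𝒱 d) (o : OrderedFinpartition k)
      (j : Fin o.length), partitionSign d o •
        (List.ofFn (Function.update (blockProd x o) j (S (blockProd x o j)))).prod =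
      (List.ofFn fun i => if o.index i = j then S (x i) else x i).prod := by
    intro S hS o j
    have hx' : ∀ i, (if o.index i = j then S (x i) else x i) ∈ 𝒱 (d i) := by
      intro i
      split_ifs
      · exact hS _ _ (hx i)
      · exact hx i
    rw [← prod_blockProd d o fun a b => h𝒱.comm _ _ _ (hx' a) _ (hx' b)]
    congr 4
    funext l
    by_cases hl : l = j
    · subst hl
      -- Multiplicativity of `S` enters here: acting on a block product means acting on each of its
      -- factors.
      rw [Function.update_self, blockProd, blockProd, map_list_prod, List.map_ofFn]
      congr 2
      funext a
      rw [ofp_index_emb, if_pos rfl, Function.comp_apply]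
    · rw [Function.update_of_ne hl, blockProd, blockProd]
      congr 2
      funext a
      rw [ofp_index_emb, if_neg hl]
  have h3 : ∀ o : OrderedFinpartition k, logProd K V (coderivationExt s del
      (partitionSign d o • wedge K (blockDeg d o) (blockProd x o))) =
      moebius o • ∑ j : Fin o.length, c • ∑ u, θ u *
        ((List.ofFn fun i => if o.index i = j then T u (x i) else x i).prod -
          (List.ofFn fun i => if o.index i = j then T' u (x i) else x i).prod) := by
    intro o
    have hX := fun j => h𝒱.blockProd_mem hx o j
    rw [map_zsmul, map_zsmul, coderivationExt_wedge fun j => hs _ _ (hX j), map_sum,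
      Finset.smul_sum, Finset.smul_sum]
    refine Finset.sum_congr rfl fun j _ => ?_
    have hup : ∀ i, Function.update (blockProd x o) j (del (blockProd x o j)) i ∈
        𝒱 (Function.update (blockDeg d o) j (blockDeg d o j + 1) i) := by
      intro i
      by_cases h : i = j
      · subst h
        simpa using hdel _ _ (hX i)
      · simpa [Function.update_of_ne h] using hX i
    rw [map_zsmul, logProd_wedge (o.length_pos hk) _ _ fun a b =>
      h𝒱.comm _ _ _ (hup a) _ (hup b)]
    change _ • _ • moebius o • _ = _
    rw [smul_comm (passSign _ j), smul_comm (partitionSign d o)]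
    congr 1
    -- Linearity in the `j`-th factor allows the sum over `u` to leave the product.
    have h4 : ∀ z, (List.ofFn (Function.update (blockProd x o) j z)).prod =
        (MultilinearMap.mkPiAlgebraFin K o.length V).toLinearMap (blockProd x o) j z := by
      intro z
      rw [MultilinearMap.toLinearMap_apply, MultilinearMap.mkPiAlgebraFin_apply]
    rw [hd, h4, map_smul, map_sum, smul_comm (passSign _ j), smul_comm (partitionSign d o),
      Finset.smul_sum, Finset.smul_sum]
    congr 1
    refine Finset.sum_congr rfl fun u _ => ?_
    -- The odd factor moves to the front of the product, which uses up the sign `passSign` of the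
    -- coderivation.
    rw [← h4, prod_update_odd fun i => hθ u _ _ (hX i), h4, map_sub, ← h4, ← h4, ← mul_smul_comm,
      smul_sub, h2 _ (hT u), h2 _ (hT' u)]
  change proj₁ K V ((cumulantEquiv K V).symm (coderivationExt s del (cumulantMap K V _))) = _
  rw [h𝒱.proj₁_cumulantEquiv_symm (coderivationExt_mem_Sym hs hdel (h𝒱.cumulantMap_mem h1)),
    cumulantMap_wedge d fun a b => h𝒱.comm _ _ _ (hx a) _ (hx b), map_sum, map_sum,
    Finset.sum_congr rfl fun o _ => h3 o]
  simp only [← Finset.smul_sum]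
  simp only [smul_comm _ c, ← Finset.smul_sum]
  congr 1
  simp only [Finset.mul_sum, Finset.smul_sum, mul_smul_comm]
  rw [Finset.sum_comm]
  conv_lhs =>
    enter [2, o]
    rw [Finset.sum_comm]

end Coderivation

/-! ### Compatibility with the coproduct, conjugation and filtration -/

section Coalgebra

variable {K : Type*} [Field K] {V : Type*} [Ring V] [Algebra K V]
  {W : Type*} [Ring W] [Algebra K W]

/-- The word with the given letters. -/
def word (K : Type*) [Field K] {V : Type*} [Ring V] [Algebra K V] (l : List V) :
    TensorAlgebra K V := (l.map (TensorAlgebra.ι K)).prod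

theorem word_cons (v : V) (l : List V) : word K (v :: l) = TensorAlgebra.ι K v * word K l := by
  simp [word]

theorem word_nil : word K ([] : List V) = 1 := by simp [word]

theorem tprod_eq_word (k : ℕ) (x : Fin k → V) :
    TensorAlgebra.tprod K V k x = word K (List.ofFn x) := by
  rw [word, TensorAlgebra.tprod_apply, List.map_ofFn]
  rfl

theorem word_eq_tprod (l : List V) : word K l = TensorAlgebra.tprod K V l.length l.get := by
  rw [tprod_eq_word, List.ofFn_get]

theorem coproduct_tprod (k : ℕ) (x : Fin k → V) : coproduct K V (TensorAlgebra.tprod K V k x) =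
    ∑ i : Fin (k - 1), (((TensorAlgebra.tprod K V (i + 1)).domCoprod
      (TensorAlgebra.tprod K V (k - (i + 1)))).domDomCongr
        (finSumFinEquiv.trans (finCongr (by omega : (i : ℕ) + 1 + (k - (i + 1)) = k)))) x := by
  rw [coproduct, liftWords_tprod, sum_apply]

theorem domCoprod_tprod (p q k : ℕ) (h : p + q = k) (x : Fin k → V) :
    (((TensorAlgebra.tprod K V p).domCoprod (TensorAlgebra.tprod K V q)).domDomCongr
      (finSumFinEquiv.trans (finCongr h))) x =
    word K ((List.ofFn x).take p) ⊗ₜ[K] word K ((List.ofFn x).drop p) := by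
  subst h
  rw [MultilinearMap.domDomCongr_apply, MultilinearMap.domCoprod_apply, tprod_eq_word,
    tprod_eq_word]
  congr 2
  · refine List.ext_getElem (by simp) fun i h₁ h₂ => ?_
    simp
  · refine List.ext_getElem (by simp) fun i h₁ h₂ => ?_
    simp

theorem coproduct_word (l : List V) : coproduct K V (word K l) =
    ∑ i ∈ Finset.range (l.length - 1), word K (l.take (i + 1)) ⊗ₜ[K] word K (l.drop (i + 1)) := by
  rw [word_eq_tprod, coproduct_tprod, Finset.sum_range]
  refine Finset.sum_congr rfl fun i _ => ?_
  rw [domCoprod_tprod, List.ofFn_get]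

/-- The full deconcatenation coproduct. -/
def fullCoproduct (K : Type*) [Field K] (V : Type*) [Ring V] [Algebra K V] :
    TensorAlgebra K V →ₗ[K] TensorAlgebra K V ⊗[K] TensorAlgebra K V :=
  coproduct K V + TensorProduct.mk K _ _ 1 + (TensorProduct.mk K _ _).flip 1 -
    (LinearMap.toSpanSingleton K _ (1 ⊗ₜ[K] 1)) ∘ₗ
      (TensorAlgebra.algebraMapInv (R := K) (M := V)).toLinearMap

theorem fullCoproduct_apply (t : TensorAlgebra K V) : fullCoproduct K V t =
    coproduct K V t + 1 ⊗ₜ[K] t + t ⊗ₜ[K] 1 -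
      TensorAlgebra.algebraMapInv (R := K) (M := V) t • (1 ⊗ₜ[K] 1) := rfl

theorem fullCoproduct_word (l : List V) : fullCoproduct K V (word K l) =
    ∑ i ∈ Finset.range (l.length + 1), word K (l.take i) ⊗ₜ[K] word K (l.drop i) := by
  rw [fullCoproduct_apply, coproduct_word]
  rcases l with _ | ⟨v, l⟩
  · simp [word_nil]
  · have h : TensorAlgebra.algebraMapInv (R := K) (M := V) (word K (v :: l)) = 0 := by
      rw [word_cons, map_mul]
      simp [TensorAlgebra.algebraMapInv]
    rw [h, zero_smul, sub_zero, List.length_cons, Nat.add_sub_cancel, Finset.sum_range_succ,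
      Finset.sum_range_succ']
    simp [word_nil]

/-- With the two trivial cuts included, deconcatenation has a uniform recursion in the first letter.
Identities are therefore proved for the full coproduct and transferred to the reduced one
afterwards. -/
theorem fullCoproduct_ι_mul (v : V) (t : TensorAlgebra K V) :
    fullCoproduct K V (TensorAlgebra.ι K v * t) =
      1 ⊗ₜ[K] (TensorAlgebra.ι K v * t) +
        (TensorAlgebra.ι K v ⊗ₜ[K] 1) * fullCoproduct K V t := by
  have : fullCoproduct K V ∘ₗ LinearMap.mulLeft K (TensorAlgebra.ι K v) =
      TensorProduct.mk K _ _ 1 ∘ₗ LinearMap.mulLeft K (TensorAlgebra.ι K v) +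
      LinearMap.mulLeft K (TensorAlgebra.ι K v ⊗ₜ[K] (1 : TensorAlgebra K V)) ∘ₗ
        fullCoproduct K V := by
    refine tensorAlgebra_hom_ext fun k x => ?_
    simp only [LinearMap.comp_apply, LinearMap.mulLeft_apply, LinearMap.add_apply,
      TensorProduct.mk_apply]
    rw [tprod_eq_word, ← word_cons, fullCoproduct_word, fullCoproduct_word, List.length_cons,
      Finset.sum_range_succ', Finset.mul_sum, add_comm]
    simp [word_nil, word_cons]
  exact LinearMap.congr_fun this t

theorem fullCoproduct_one : fullCoproduct K V 1 = 1 ⊗ₜ[K] 1 := by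
  rw [← word_nil, fullCoproduct_word]
  simp [word_nil]

/-- The full and the reduced coproduct differ by terms made from the unit and the counit, so a map
respecting both transfers the identity. -/
theorem coproduct_comp_eq {f : TensorAlgebra K V →ₗ[K] TensorAlgebra K W} (h1 : f 1 = 1)
    (hε : ∀ t, TensorAlgebra.algebraMapInv (R := K) (M := W) (f t) =
      TensorAlgebra.algebraMapInv (R := K) (M := V) t)
    (hf : ∀ t, fullCoproduct K W (f t) = TensorProduct.map f f (fullCoproduct K V t))
    (t : TensorAlgebra K V) : coproduct K W (f t) = TensorProduct.map f f (coproduct K V t) := by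
  have := hf t
  rw [fullCoproduct_apply, fullCoproduct_apply, map_sub, map_add, map_add, map_smul,
    TensorProduct.map_tmul, TensorProduct.map_tmul, TensorProduct.map_tmul, h1, hε] at this
  exact add_right_cancel (add_right_cancel (sub_left_injective this))

theorem fullCoproduct_tensorMap (f : V →ₗ[K] W) (t : TensorAlgebra K V) :
    fullCoproduct K W (tensorMap f t) =
      TensorProduct.map (tensorMap f).toLinearMap (tensorMap f).toLinearMap
        (fullCoproduct K V t) := by
  induction t using word_induction with
  | h1 => simp [fullCoproduct_one]
  | hmul v t ih =>
    rw [tensorMap_ι_mul, fullCoproduct_ι_mul, fullCoproduct_ι_mul, ih, map_add,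
      TensorProduct.map_tmul]
    congr 1
    · simp [tensorMap_ι_mul]
    · generalize fullCoproduct K V t = z
      induction z using TensorProduct.induction_on with
      | zero => simp
      | tmul a b => simp [tensorMap]
      | add a b ha hb => rw [map_add, mul_add, mul_add, map_add, ha, hb]
  | hadd t u ht hu => rw [map_add, map_add, ht, hu, map_add, map_add]
  | hsmul a t ht => rw [map_smul, map_smul, ht, map_smul, map_smul]

theorem coproduct_tensorMap (f : V →ₗ[K] W) (t : TensorAlgebra K V) :
    coproduct K W (tensorMap f t) =
      TensorProduct.map (tensorMap f).toLinearMap (tensorMap f).toLinearMap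
        (coproduct K V t) := by
  refine coproduct_comp_eq (f := (tensorMap f).toLinearMap) (by simp) (fun t => ?_)
    (fullCoproduct_tensorMap f) t
  have : (TensorAlgebra.algebraMapInv (R := K) (M := W)).comp (tensorMap f) =
      TensorAlgebra.algebraMapInv (R := K) (M := V) := by
    apply TensorAlgebra.hom_ext
    ext v
    simp [TensorAlgebra.algebraMapInv, tensorMap]
  exact AlgHom.congr_fun this t

theorem fullCoproduct_coderivationExt (s del : V →ₗ[K] V) (t : TensorAlgebra K V) :
    fullCoproduct K V (coderivationExt s del t) =
      TensorProduct.map (coderivationExt s del) LinearMap.id (fullCoproduct K V t) +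
      TensorProduct.map (tensorMap s).toLinearMap (coderivationExt s del)
        (fullCoproduct K V t) := by
  induction t using word_induction with
  | h1 => simp [fullCoproduct_one, coderivationExt_one]
  | hmul v t ih =>
    have h : ∀ z : TensorAlgebra K V ⊗[K] TensorAlgebra K V,
        TensorProduct.map (coderivationExt s del) LinearMap.id
          ((TensorAlgebra.ι K v ⊗ₜ[K] 1) * z) +
        TensorProduct.map (tensorMap s).toLinearMap (coderivationExt s del)
          ((TensorAlgebra.ι K v ⊗ₜ[K] 1) * z) =
        (TensorAlgebra.ι K (del v) ⊗ₜ[K] 1) * z + (TensorAlgebra.ι K (s v) ⊗ₜ[K] 1) *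
          (TensorProduct.map (coderivationExt s del) LinearMap.id z +
            TensorProduct.map (tensorMap s).toLinearMap (coderivationExt s del) z) := by
      intro z
      induction z using TensorProduct.induction_on with
      | zero => simp
      | tmul a b =>
        simp only [Algebra.TensorProduct.tmul_mul_tmul, one_mul, TensorProduct.map_tmul,
          coderivationExt_ι_mul, LinearMap.id_apply, AlgHom.toLinearMap_apply, tensorMap_ι_mul,
          TensorProduct.add_tmul, mul_add]
        abel
      | add a b ha hb =>
        simp only [mul_add, map_add] at ha hb ⊢
        rw [add_add_add_comm, ha, hb]
        abel
    have h' := h (fullCoproduct K V t)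
    rw [coderivationExt_ι_mul, map_add, fullCoproduct_ι_mul, fullCoproduct_ι_mul,
      fullCoproduct_ι_mul, map_add, map_add, ih]
    refine Eq.trans ?_ (add_add_add_comm _ _ _ _)
    rw [h', TensorProduct.map_tmul, TensorProduct.map_tmul, coderivationExt_one, TensorProduct.zero_tmul, coderivationExt_ι_mul]
    simp only [AlgHom.toLinearMap_apply, map_one, TensorProduct.tmul_add]
    abel
  | hadd t u ht hu =>
    simp only [map_add, ht, hu]
    abel
  | hsmul a t ht => simp only [map_smul, ht, smul_add]

theorem algebraMapInv_ι_mul (v : V) (t : TensorAlgebra K V) :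
    TensorAlgebra.algebraMapInv (R := K) (M := V) (TensorAlgebra.ι K v * t) = 0 := by
  rw [map_mul]
  simp [TensorAlgebra.algebraMapInv]

theorem coproduct_coderivationExt (s del : V →ₗ[K] V) (t : TensorAlgebra K V) :
    coproduct K V (coderivationExt s del t) =
      TensorProduct.map (coderivationExt s del) LinearMap.id (coproduct K V t) +
      TensorProduct.map (tensorMap s).toLinearMap (coderivationExt s del) (coproduct K V t) := by
  have hε : TensorAlgebra.algebraMapInv (R := K) (M := V) (coderivationExt s del t) = 0 := by
    induction t using word_induction with
    | h1 => rw [coderivationExt_one, map_zero]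
    | hmul v t _ => rw [coderivationExt_ι_mul, map_add, algebraMapInv_ι_mul, algebraMapInv_ι_mul,
        add_zero]
    | hadd t u ht hu => rw [map_add, map_add, ht, hu, add_zero]
    | hsmul a t ht => rw [map_smul, map_smul, ht, smul_zero]
  have h := fullCoproduct_coderivationExt s del t
  rw [fullCoproduct_apply, fullCoproduct_apply, hε, zero_smul, sub_zero] at h
  simp only [map_sub, map_add, map_smul, TensorProduct.map_tmul, coderivationExt_one,
    TensorProduct.zero_tmul, TensorProduct.tmul_zero, smul_zero, sub_zero, add_zero,
    LinearMap.id_apply, AlgHom.toLinearMap_apply, map_one] at h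
  have h2 : coproduct K V (coderivationExt s del t) =
      (coproduct K V (coderivationExt s del t) + 1 ⊗ₜ[K] coderivationExt s del t +
        coderivationExt s del t ⊗ₜ[K] 1) - 1 ⊗ₜ[K] coderivationExt s del t -
        coderivationExt s del t ⊗ₜ[K] 1 := by abel
  rw [h2, h]
  abel

/-! The cumulant map is a coalgebra map. -/

theorem cumulantMap_one : cumulantMap K V 1 = 1 := by
  rw [← tprod_zero (K := K) (V := V) Fin.elim0, cumulantMap_tprod_zero]

/-- The composition with first block `m + 1`, followed by the blocks of `c`. -/
def consComposition {k : ℕ} (p : Σ m : Fin (k + 1), Composition (k - m)) : Composition (k + 1) where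
  blocks := (p.1 + 1) :: p.2.blocks
  blocks_pos := by
    intro i hi
    rcases List.mem_cons.mp hi with rfl | hi
    · exact Nat.succ_pos _
    · exact p.2.blocks_pos hi
  blocks_sum := by
    rw [List.sum_cons, p.2.blocks_sum]
    have := p.1.is_lt
    omega

theorem consComposition_bijective {k : ℕ} : Function.Bijective (consComposition (k := k)) := by
  constructor
  · rintro ⟨m, c⟩ ⟨m', c'⟩ h
    have h1 := List.cons.inj (congrArg Composition.blocks h)
    obtain rfl : m = m' := Fin.ext (Nat.succ_injective h1.1)
    have h2 : c = c' := Composition.ext h1.2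
    rw [h2]
  · intro c
    obtain ⟨b, B, hb⟩ : ∃ b B, c.blocks = b :: B := by
      rcases hc : c.blocks with _ | ⟨b, B⟩
      · exact absurd (c.blocks_eq_nil.mp hc) k.succ_ne_zero
      · exact ⟨b, B, rfl⟩
    have hpos : 0 < b := c.blocks_pos (by rw [hb]; exact List.mem_cons_self)
    have hsum := c.blocks_sum
    rw [hb, List.sum_cons] at hsum
    refine ⟨⟨⟨b - 1, by omega⟩, ⟨B, fun {i} hi => c.blocks_pos
      (by rw [hb]; exact List.mem_cons_of_mem _ hi), by dsimp only; omega⟩⟩, Composition.ext ?_⟩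
    change (b - 1 + 1) :: B = c.blocks
    rw [hb, Nat.sub_add_cancel hpos]

/-- The contribution to `τ` of cutting a word into blocks of the given lengths. -/
def cutWord (K : Type*) [Field K] {V : Type*} [Ring V] [Algebra K V] :
    List V → List ℕ → TensorAlgebra K V
  | _, [] => 1
  | l, b :: B => ((b.factorial : K)⁻¹ • TensorAlgebra.ι K (l.take b).prod) *
      cutWord K (l.drop b) B

theorem cutWord_eq (l : List V) (B : List ℕ) : cutWord K l B =
    (B.map fun b => ((b.factorial : K)⁻¹)).prod •
      ((l.splitWrtCompositionAux B).map fun m => TensorAlgebra.ι K m.prod).prod := by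
  induction B generalizing l with
  | nil => simp [cutWord, List.splitWrtCompositionAux]
  | cons b B ih =>
    rw [cutWord, ih, List.splitWrtCompositionAux_cons, List.map_cons, List.map_cons,
      List.prod_cons, List.prod_cons, smul_mul_smul_comm]

theorem cumulantMap_word (l : List V) : cumulantMap K V (word K l) =
    ∑ c : Composition l.length, cutWord K l c.blocks := by
  rw [word_eq_tprod, cumulantMap_tprod]
  refine Finset.sum_congr rfl fun c _ => ?_
  rw [cutWord_eq]
  congr 1
  · conv_rhs => rw [← c.ofFn_blocksFun, List.map_ofFn, List.prod_ofFn]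
    rfl
  · rw [TensorAlgebra.tprod_apply]
    congr 1
    refine List.ext_getElem ?_ fun i h₁ h₂ => ?_
    · rw [List.length_ofFn, List.length_map, List.length_splitWrtCompositionAux]
    · have hi : i < c.length := by simpa using h₁
      rw [List.getElem_ofFn, List.getElem_map]
      congr 2
      have h3 := List.getElem_splitWrtComposition' l c (i := i) (by
        rw [List.length_splitWrtComposition]; exact hi)
      change _ = (l.splitWrtComposition c)[i]'(by
        rw [List.length_splitWrtComposition]; exact hi)
      rw [h3]
      refine List.ext_getElem ?_ fun j h₄ h₅ => ?_
      · rw [List.length_ofFn, List.length_drop, List.length_take, c.sizeUpTo_succ hi,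
          min_eq_left]
        · simp [Composition.blocksFun]
        · rw [← c.sizeUpTo_succ hi]
          exact c.sizeUpTo_le _
      · simp

/-- Compositions are grouped by their first block, whose length `m + 1` is positive. -/
theorem cumulantMap_word_recursion (v : V) (l : List V) : cumulantMap K V (word K (v :: l)) =
    ∑ m ∈ Finset.range (l.length + 1), (((m + 1).factorial : K)⁻¹ •
      TensorAlgebra.ι K ((v :: l).take (m + 1)).prod) *
        cumulantMap K V (word K ((v :: l).drop (m + 1))) := by
  rw [cumulantMap_word]
  change ∑ c : Composition (l.length + 1), cutWord K (v :: l) c.blocks = _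
  rw [← consComposition_bijective.sum_comp, Fintype.sum_sigma, Finset.sum_range]
  refine Finset.sum_congr rfl fun m _ => ?_
  rw [cumulantMap_word, Finset.mul_sum]
  have h : ((v :: l).drop (m + 1)).length = l.length - m := by simp
  have h2 : ∀ (j : ℕ) (_ : j = l.length - m), (∑ c : Composition (l.length - m),
      cutWord K (v :: l) (consComposition ⟨m, c⟩).blocks) = ∑ c : Composition j,
      (((m + 1 : ℕ).factorial : K)⁻¹ • TensorAlgebra.ι K ((v :: l).take (m + 1)).prod) *
        cutWord K ((v :: l).drop (m + 1)) c.blocks := by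
    rintro j rfl
    rfl
  exact h2 _ h

theorem fullCoproduct_cumulantMap (t : TensorAlgebra K V) :
    fullCoproduct K V (cumulantMap K V t) =
      TensorProduct.map (cumulantMap K V) (cumulantMap K V) (fullCoproduct K V t) := by
  have key : ∀ n, ∀ l : List V, l.length = n → fullCoproduct K V (cumulantMap K V (word K l)) =
      ∑ i ∈ Finset.range (l.length + 1), cumulantMap K V (word K (l.take i)) ⊗ₜ[K]
        cumulantMap K V (word K (l.drop i)) := by
    intro n
    induction n using Nat.strong_induction_on with
    | _ n ih =>
      intro l hl
      rcases l with _ | ⟨v, l⟩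
      · simp [word_nil, cumulantMap_one, fullCoproduct_one]
      · rw [cumulantMap_word_recursion, map_sum, List.length_cons,
          Finset.sum_range_succ' _ (l.length + 1), List.take_zero, List.drop_zero, word_nil,
          cumulantMap_one]
        have h1 : ∀ m ∈ Finset.range (l.length + 1), fullCoproduct K V
            ((((m + 1).factorial : K)⁻¹ • TensorAlgebra.ι K ((v :: l).take (m + 1)).prod) *
              cumulantMap K V (word K ((v :: l).drop (m + 1)))) =
            (∑ i ∈ Finset.range (l.length + 1 - m), ((((m + 1).factorial : K)⁻¹ •
              TensorAlgebra.ι K ((v :: l).take (m + 1)).prod) * cumulantMap K V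
                (word K (((v :: l).drop (m + 1)).take i))) ⊗ₜ[K]
              cumulantMap K V (word K ((v :: l).drop (i + (m + 1))))) +
            1 ⊗ₜ[K] ((((m + 1).factorial : K)⁻¹ • TensorAlgebra.ι K ((v :: l).take (m + 1)).prod) *
              cumulantMap K V (word K ((v :: l).drop (m + 1)))) := by
          intro m hm
          have hm' : m ≤ l.length := Nat.lt_succ_iff.mp (Finset.mem_range.mp hm)
          have hlen : ((v :: l).drop (m + 1)).length = l.length - m := by simp
          rw [smul_mul_assoc, map_smul, fullCoproduct_ι_mul, ih (l.length - m)
            (by rw [← hl, List.length_cons]; omega) _ hlen, hlen, smul_add, add_comm,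
            TensorProduct.tmul_smul, Finset.mul_sum, Finset.smul_sum,
            show l.length - m + 1 = l.length + 1 - m by omega]
          congr 1
          refine Finset.sum_congr rfl fun i _ => ?_
          rw [Algebra.TensorProduct.tmul_mul_tmul, one_mul, TensorProduct.smul_tmul', List.drop_drop,
            smul_mul_assoc, add_comm i]
        rw [Finset.sum_congr rfl h1, Finset.sum_add_distrib]
        congr 1
        -- The left part of a cut consists of a first block of `m + 1` letters and further letters.
        -- Grouped by the total length of the left part, the inner sum is the recursion for its
        -- image under `τ`.
        · rw [← Finset.sum_range_diag_flip]
          refine Finset.sum_congr rfl fun i hi => ?_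
          rw [List.take_succ_cons, cumulantMap_word_recursion, TensorProduct.sum_tmul]
          have hi' : i ≤ l.length := Nat.lt_succ_iff.mp (Finset.mem_range.mp hi)
          rw [List.length_take, min_eq_left hi']
          refine Finset.sum_congr rfl fun m hm => ?_
          have hm' : m ≤ i := Nat.lt_succ_iff.mp (Finset.mem_range.mp hm)
          have e1 : (v :: l.take i) = (v :: l).take (i + 1) := by simp
          rw [e1, List.take_take, min_eq_left (by omega : m + 1 ≤ i + 1), List.drop_take,
            show i + 1 - (m + 1) = i - m by omega, show i - m + (m + 1) = i + 1 by omega]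
        · rw [← TensorProduct.tmul_sum, ← cumulantMap_word_recursion]
  have : fullCoproduct K V ∘ₗ cumulantMap K V =
      TensorProduct.map (cumulantMap K V) (cumulantMap K V) ∘ₗ fullCoproduct K V := by
    refine tensorAlgebra_hom_ext fun k x => ?_
    rw [LinearMap.comp_apply, LinearMap.comp_apply, tprod_eq_word, key _ _ rfl, fullCoproduct_word,
      map_sum]
    rfl
  exact LinearMap.congr_fun this t

theorem coproduct_cumulantMap (t : TensorAlgebra K V) :
    coproduct K V (cumulantMap K V t) =
      TensorProduct.map (cumulantMap K V) (cumulantMap K V) (coproduct K V t) := by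
  refine coproduct_comp_eq cumulantMap_one (fun t => ?_) fullCoproduct_cumulantMap t
  have : (TensorAlgebra.algebraMapInv (R := K) (M := V)).toLinearMap ∘ₗ cumulantMap K V =
      (TensorAlgebra.algebraMapInv (R := K) (M := V)).toLinearMap := by
    refine tensorAlgebra_hom_ext fun k x => ?_
    rcases k with _ | k
    · rw [LinearMap.comp_apply, tprod_zero, cumulantMap_one]
    · rw [LinearMap.comp_apply, tprod_eq_word, List.ofFn_succ, cumulantMap_word_recursion, map_sum,
        word_cons]
      change _ = TensorAlgebra.algebraMapInv _
      rw [algebraMapInv_ι_mul]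
      refine Finset.sum_eq_zero fun m _ => ?_
      rw [smul_mul_assoc, map_smul]
      change _ • TensorAlgebra.algebraMapInv _ = _
      rw [algebraMapInv_ι_mul, smul_zero]
  exact LinearMap.congr_fun this t

theorem coproduct_cumulantEquiv_symm (t : TensorAlgebra K V) :
    coproduct K V ((cumulantEquiv K V).symm t) =
      TensorProduct.map (cumulantEquiv K V).symm.toLinearMap (cumulantEquiv K V).symm.toLinearMap
        (coproduct K V t) := by
  obtain ⟨u, rfl⟩ := (cumulantMap_bijective (K := K) (V := V)).2 t
  rw [cumulantEquiv_symm_cumulantMap, coproduct_cumulantMap, ← LinearMap.comp_apply,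
    ← TensorProduct.map_comp]
  have : (cumulantEquiv K V).symm.toLinearMap ∘ₗ cumulantMap K V = LinearMap.id :=
    LinearMap.ext cumulantEquiv_symm_cumulantMap
  rw [this, TensorProduct.map_id, LinearMap.id_apply]

theorem coproduct_cumulantConj (f : V →ₗ[K] W) (t : TensorAlgebra K V) :
    coproduct K W (cumulantConj f t) =
      TensorProduct.map (cumulantConj f) (cumulantConj f) (coproduct K V t) := by
  change coproduct K W ((cumulantEquiv K W).symm (tensorMap f (cumulantMap K V t))) = _
  rw [coproduct_cumulantEquiv_symm, coproduct_tensorMap, coproduct_cumulantMap]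
  simp only [TensorProduct.map_map]
  rfl

/-- `τ` is natural for homomorphisms of algebras; for a linear map the failure of naturality is what
the cumulants measure. It applies to the sign involution, which is therefore unchanged by
conjugation with `τ`. -/
theorem tensorMap_cumulantMap (f : V →ₐ[K] W) (t : TensorAlgebra K V) :
    tensorMap f.toLinearMap (cumulantMap K V t) = cumulantMap K W (tensorMap f.toLinearMap t) := by
  have : (tensorMap f.toLinearMap).toLinearMap ∘ₗ cumulantMap K V =
      cumulantMap K W ∘ₗ (tensorMap f.toLinearMap).toLinearMap := by
    refine tensorAlgebra_hom_ext fun k x => ?_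
    simp only [LinearMap.comp_apply, AlgHom.toLinearMap_apply]
    rw [tensorMap_tprod, cumulantMap_tprod, cumulantMap_tprod, map_sum]
    refine Finset.sum_congr rfl fun c _ => ?_
    rw [map_smul, tensorMap_tprod]
    congr 2
    funext j
    rw [AlgHom.toLinearMap_apply, map_list_prod, List.map_ofFn]
    rfl
  exact LinearMap.congr_fun this t

theorem coproduct_cumulantCoderivation (s : V →ₐ[K] V) (del : V →ₗ[K] V) (t : TensorAlgebra K V) :
    coproduct K V (cumulantCoderivation s.toLinearMap del t) =
      TensorProduct.map (cumulantCoderivation s.toLinearMap del) LinearMap.id (coproduct K V t) +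
      TensorProduct.map (tensorMap s.toLinearMap).toLinearMap
        (cumulantCoderivation s.toLinearMap del) (coproduct K V t) := by
  change coproduct K V ((cumulantEquiv K V).symm
    (coderivationExt s.toLinearMap del (cumulantMap K V t))) = _
  rw [coproduct_cumulantEquiv_symm, coproduct_coderivationExt, coproduct_cumulantMap, map_add]
  simp only [TensorProduct.map_map]
  have h1 : (cumulantEquiv K V).symm.toLinearMap ∘ₗ LinearMap.id ∘ₗ cumulantMap K V =
      LinearMap.id := LinearMap.ext cumulantEquiv_symm_cumulantMap
  have h2 : (cumulantEquiv K V).symm.toLinearMap ∘ₗ (tensorMap s.toLinearMap).toLinearMap ∘ₗ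
      cumulantMap K V = (tensorMap s.toLinearMap).toLinearMap := by
    refine LinearMap.ext fun t => ?_
    change (cumulantEquiv K V).symm (tensorMap s.toLinearMap (cumulantMap K V t)) = _
    rw [tensorMap_cumulantMap, cumulantEquiv_symm_cumulantMap]
    rfl
  rw [h1, h2]
  rfl

theorem cumulantCoderivation_comp_self {s del : V →ₗ[K] V} (hdel : del ∘ₗ del = 0)
    (hs : ∀ v, s (del v) = - del (s v)) (t : TensorAlgebra K V) :
    cumulantCoderivation s del (cumulantCoderivation s del t) = 0 := by
  change (cumulantEquiv K V).symm (coderivationExt s del (cumulantMap K V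
    ((cumulantEquiv K V).symm (coderivationExt s del (cumulantMap K V t))))) = 0
  rw [cumulantMap_cumulantEquiv_symm, coderivationExt_comp_self hdel hs, map_zero]

theorem cumulantConj_cumulantCoderivation {s del : V →ₗ[K] V} {s' del' : W →ₗ[K] W}
    {f : V →ₗ[K] W} (hs : ∀ v, f (s v) = s' (f v)) (hdel : ∀ v, f (del v) = del' (f v))
    (t : TensorAlgebra K V) :
    cumulantConj f (cumulantCoderivation s del t) =
      cumulantCoderivation s' del' (cumulantConj f t) := by
  change (cumulantEquiv K W).symm (tensorMap f (cumulantMap K V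
    ((cumulantEquiv K V).symm (coderivationExt s del (cumulantMap K V t))))) =
    (cumulantEquiv K W).symm (coderivationExt s' del' (cumulantMap K W
    ((cumulantEquiv K W).symm (tensorMap f (cumulantMap K V t)))))
  rw [cumulantMap_cumulantEquiv_symm, cumulantMap_cumulantEquiv_symm,
    tensorMap_coderivationExt hs hdel]

/-- The inner `τ` and `τ⁻¹` cancel, so conjugation is functorial for all linear maps. The inverse
system rests on this. -/
theorem cumulantConj_comp {X : Type*} [Ring X] [Algebra K X] (g : W →ₗ[K] X) (f : V →ₗ[K] W)
    (t : TensorAlgebra K V) : cumulantConj g (cumulantConj f t) = cumulantConj (g ∘ₗ f) t := by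
  change (cumulantEquiv K X).symm (tensorMap g (cumulantMap K W ((cumulantEquiv K W).symm
    (tensorMap f (cumulantMap K V t))))) = (cumulantEquiv K X).symm (tensorMap (g ∘ₗ f)
      (cumulantMap K V t))
  rw [cumulantMap_cumulantEquiv_symm]
  congr 1
  have : (tensorMap g).comp (tensorMap f) = tensorMap (g ∘ₗ f) := by
    apply TensorAlgebra.hom_ext
    ext v
    simp [tensorMap]
  exact AlgHom.congr_fun this _

theorem cumulantConj_id (t : TensorAlgebra K V) : cumulantConj LinearMap.id t = t := by
  change (cumulantEquiv K V).symm (tensorMap LinearMap.id (cumulantMap K V t)) = t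
  have : tensorMap (LinearMap.id : V →ₗ[K] V) = AlgHom.id K _ := by
    apply TensorAlgebra.hom_ext
    ext v
    simp [tensorMap]
  rw [this, AlgHom.id_apply, cumulantEquiv_symm_cumulantMap]

theorem cumulantMap_mem_lengthLE {r : ℕ} {t : TensorAlgebra K V} (ht : t ∈ lengthLE K V r) :
    cumulantMap K V t ∈ lengthLE K V r := by
  rcases r with _ | r
  · rwa [cumulantMap_eq_of_mem_zero t ht]
  · have := Submodule.add_mem _ (lengthLE_mono r.le_succ (cumulantMap_sub_mem_of_mem r t ht)) ht
    rwa [sub_add_cancel] at this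

theorem cumulantEquiv_symm_mem_lengthLE {r : ℕ} {t : TensorAlgebra K V}
    (ht : t ∈ lengthLE K V r) : (cumulantEquiv K V).symm t ∈ lengthLE K V r := by
  induction r generalizing t with
  | zero =>
    have := cumulantEquiv_symm_cumulantMap t
    rw [cumulantMap_eq_of_mem_zero t ht] at this
    rwa [this]
  | succ r ih =>
    have h1 := ih (cumulantMap_sub_mem_of_mem r t ht)
    rw [map_sub, cumulantEquiv_symm_cumulantMap] at h1
    have := Submodule.sub_mem _ ht (lengthLE_mono r.le_succ h1)
    rwa [sub_sub_cancel] at this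

theorem cumulantConj_mem_lengthLE (f : V →ₗ[K] W) {r : ℕ} {t : TensorAlgebra K V}
    (ht : t ∈ lengthLE K V r) : cumulantConj f t ∈ lengthLE K W r := by
  refine cumulantEquiv_symm_mem_lengthLE ?_
  have : lengthLE K V r ≤ (lengthLE K W r).comap (tensorMap f).toLinearMap := by
    refine Submodule.span_le.mpr ?_
    rintro _ ⟨k, hk, x, rfl⟩
    exact Submodule.subset_span ⟨k, hk, _, tensorMap_tprod f k x⟩
  exact this (cumulantMap_mem_lengthLE ht)

/-! The coproduct restricts to `S^*V`. -/

theorem listSign_ofFn_comp_perm {k p : ℕ} (d : Fin k → ℕ) {g : Fin p → Fin k}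
    (hg : Function.Injective g) (α : Equiv.Perm (Fin p)) :
    listSign d (List.ofFn (g ∘ α)) = listSign d (List.ofFn g) * permSign (d ∘ g) α := by
  have hperm : (List.ofFn α).Perm (List.finRange p) :=
    (List.perm_ext_iff_of_nodup (List.nodup_ofFn.mpr α.injective)
      (List.nodup_finRange _)).mpr fun a => by
        simp only [List.mem_ofFn, List.mem_finRange, iff_true]
        exact α.surjective a
  have h := listSign_flatten_perm d (fun j => [g j]) (d ∘ g) (fun j => by simp)
    (fun i j hij a ha b hb => by
      rw [List.mem_singleton] at ha hb
      rw [ha, hb]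
      exact hg.ne hij) hperm (List.nodup_ofFn.mpr α.injective)
  have hflat : ∀ M : List (Fin p), (M.map fun j => [g j]).flatten = M.map g := by
    intro M
    induction M with
    | nil => rfl
    | cons a M ih => rw [List.map_cons, List.flatten_cons, ih]; rfl
  rw [hflat, hflat, List.map_ofFn, ← List.ofFn_eq_map, listSign_ofFn_perm,
    listSign_sorted _ (List.pairwise_lt_finRange _), mul_one] at h
  have h2 := listSign_mul_self (d ∘ g) (List.ofFn α)
  rw [listSign_ofFn_perm] at h2
  rw [← h, mul_assoc, h2, mul_one]

/-- Averaging over permutations of the two halves of a cut word turns each half into a signed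
symmetrisation. Every term is then counted `p! q!` times, which is why the characteristic must be
zero. -/
theorem sum_perm_domCoprod_mem [CharZero K] (𝒱 : ℕ → Submodule K V) {p q k : ℕ} (h : p + q = k)
    (hp : 0 < p) (hq : 0 < q) {d : Fin k → ℕ} {x : Fin k → V} (hx : ∀ i, x i ∈ 𝒱 (d i)) :
    ∑ π : Equiv.Perm (Fin k), permSign d π •
      (((TensorAlgebra.tprod K V p).domCoprod (TensorAlgebra.tprod K V q)).domDomCongr
        (finSumFinEquiv.trans (finCongr h))) (x ∘ π) ∈
      LinearMap.range (TensorProduct.map (Sym 𝒱).subtype (Sym 𝒱).subtype) := by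
  subst h
  let E : Equiv.Perm (Fin (p + q)) → TensorAlgebra K V ⊗[K] TensorAlgebra K V := fun π =>
    permSign d π • (TensorAlgebra.tprod K V p (x ∘ π ∘ Fin.castAdd q) ⊗ₜ[K]
      TensorAlgebra.tprod K V q (x ∘ π ∘ Fin.natAdd p))
  have hE : ∀ π : Equiv.Perm (Fin (p + q)), permSign d π •
      (((TensorAlgebra.tprod K V p).domCoprod (TensorAlgebra.tprod K V q)).domDomCongr
        (finSumFinEquiv.trans (finCongr rfl))) (x ∘ π) = E π := by
    intro π
    rw [MultilinearMap.domDomCongr_apply, MultilinearMap.domCoprod_apply]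
    rfl
  rw [Finset.sum_congr rfl fun π _ => hE π]
  let γ : Equiv.Perm (Fin p) → Equiv.Perm (Fin q) → Equiv.Perm (Fin (p + q)) := fun α β =>
    finSumFinEquiv.permCongr (Equiv.sumCongr α β)
  have hγl : ∀ α β i, γ α β (Fin.castAdd q i) = Fin.castAdd q (α i) := by
    intro α β i
    simp [γ, Equiv.permCongr_apply]
  have hγr : ∀ α β i, γ α β (Fin.natAdd p i) = Fin.natAdd p (β i) := by
    intro α β i
    simp [γ, Equiv.permCongr_apply]
  have hsign : ∀ (π : Equiv.Perm (Fin (p + q))) α β, permSign d (π * γ α β) = permSign d π *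
      (permSign (d ∘ π ∘ Fin.castAdd q) α * permSign (d ∘ π ∘ Fin.natAdd p) β) := by
    intro π α β
    have hsplit : ∀ g : Fin (p + q) → Fin (p + q), List.ofFn g =
        List.ofFn (g ∘ Fin.castAdd q) ++ List.ofFn (g ∘ Fin.natAdd p) := by
      intro g
      rw [← List.ofFn_fin_append]
      congr 1
      funext i
      refine Fin.addCases (fun i => ?_) (fun i => ?_) i <;> simp
    have hl : ⇑(π * γ α β) ∘ Fin.castAdd q = (π ∘ Fin.castAdd q) ∘ α := by
      funext i
      simp [hγl]
    have hr : ⇑(π * γ α β) ∘ Fin.natAdd p = (π ∘ Fin.natAdd p) ∘ β := by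
      funext i
      simp [hγr]
    have hinjl : Function.Injective (π ∘ Fin.castAdd q) :=
      π.injective.comp (Fin.castAdd_injective p q)
    have hinjr : Function.Injective (π ∘ Fin.natAdd p) :=
      π.injective.comp (Fin.natAdd_injective q p)
    rw [← listSign_ofFn_perm, ← listSign_ofFn_perm, hsplit, hsplit π, listSign_append,
      listSign_append, hl, hr, listSign_ofFn_comp_perm d hinjl, listSign_ofFn_comp_perm d hinjr]
    -- Permutations within the halves do not affect the pairs across the cut.
    have hcross : crossSigns d (List.ofFn ((π ∘ Fin.castAdd q) ∘ α))
        (List.ofFn ((π ∘ Fin.natAdd p) ∘ β)) =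
        crossSigns d (List.ofFn (π ∘ Fin.castAdd q)) (List.ofFn (π ∘ Fin.natAdd p)) :=
      crossSigns_perm d (Equiv.Perm.ofFn_comp_perm α _) (Equiv.Perm.ofFn_comp_perm β _)
    rw [hcross]
    ring
  have hshift : ∀ α β, ∑ π, E π = ∑ π, E (π * γ α β) := fun α β =>
    (Equiv.sum_comp (Equiv.mulRight (γ α β)) E).symm
  have hsum : ∀ π, ∑ α, ∑ β, E (π * γ α β) = permSign d π •
      (wedge K (d ∘ π ∘ Fin.castAdd q) (x ∘ π ∘ Fin.castAdd q) ⊗ₜ[K]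
        wedge K (d ∘ π ∘ Fin.natAdd p) (x ∘ π ∘ Fin.natAdd p)) := by
    intro π
    rw [wedge, wedge, TensorProduct.sum_tmul, Finset.smul_sum]
    refine Finset.sum_congr rfl fun α _ => ?_
    rw [TensorProduct.tmul_sum, Finset.smul_sum]
    refine Finset.sum_congr rfl fun β _ => ?_
    have e1 : x ∘ ⇑(π * γ α β) ∘ Fin.castAdd q = (x ∘ π ∘ Fin.castAdd q) ∘ α := by
      funext i
      simp [hγl]
    have e2 : x ∘ ⇑(π * γ α β) ∘ Fin.natAdd p = (x ∘ π ∘ Fin.natAdd p) ∘ β := by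
      funext i
      simp [hγr]
    change permSign d (π * γ α β) • (_ ⊗ₜ[K] _) = _
    rw [e1, e2, hsign, mul_smul, mul_smul, TensorProduct.tmul_smul, ← TensorProduct.smul_tmul',
      smul_comm (permSign (d ∘ π ∘ Fin.castAdd q) α)]
  have havg : ((p.factorial * q.factorial : ℕ) : K) • ∑ π, E π = ∑ π, permSign d π •
      (wedge K (d ∘ π ∘ Fin.castAdd q) (x ∘ π ∘ Fin.castAdd q) ⊗ₜ[K]
        wedge K (d ∘ π ∘ Fin.natAdd p) (x ∘ π ∘ Fin.natAdd p)) := by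
    rw [← Finset.sum_congr rfl fun π _ => hsum π, Finset.sum_comm]
    have : ∀ α : Equiv.Perm (Fin p), ∑ π, ∑ β, E (π * γ α β) = q.factorial • ∑ π, E π := by
      intro α
      rw [Finset.sum_comm, Finset.sum_congr rfl fun β _ => (hshift α β).symm, Finset.sum_const,
        Finset.card_univ, Fintype.card_perm, Fintype.card_fin]
    rw [Finset.sum_congr rfl fun α _ => this α, Finset.sum_const, Finset.card_univ,
      Fintype.card_perm, Fintype.card_fin, Nat.cast_smul_eq_nsmul, mul_smul]
  have hne : ((p.factorial * q.factorial : ℕ) : K) ≠ 0 :=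
    Nat.cast_ne_zero.mpr (Nat.mul_ne_zero p.factorial_ne_zero q.factorial_ne_zero)
  rw [← inv_smul_smul₀ hne (∑ π, E π), havg]
  refine Submodule.smul_mem _ _ (Submodule.sum_mem _ fun π _ => zsmul_mem ?_ _)
  exact ⟨⟨_, wedge_mem_Sym 𝒱 hp fun i => hx _⟩ ⊗ₜ[K] ⟨_, wedge_mem_Sym 𝒱 hq fun i => hx _⟩, rfl⟩

/-- The coproduct maps `S^*V` to `S^*V ⊗ S^*V`. -/
theorem coproduct_mem_range [CharZero K] (𝒱 : ℕ → Submodule K V) {t : TensorAlgebra K V}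
    (ht : t ∈ Sym 𝒱) : coproduct K V t ∈
      LinearMap.range (TensorProduct.map (Sym 𝒱).subtype (Sym 𝒱).subtype) := by
  have : Sym 𝒱 ≤ (LinearMap.range (TensorProduct.map (Sym 𝒱).subtype (Sym 𝒱).subtype)).comap
      (coproduct K V) := by
    refine Submodule.span_le.mpr ?_
    rintro _ ⟨k, d, x, hx, rfl⟩
    rw [SetLike.mem_coe, Submodule.mem_comap, wedge, map_sum]
    simp only [map_zsmul, coproduct_tprod, Finset.smul_sum]
    rw [Finset.sum_comm]
    refine Submodule.sum_mem _ fun i _ => sum_perm_domCoprod_mem 𝒱 _ i.succ_pos ?_ hx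
    have := i.is_lt
    omega
  exact this ht

end Coalgebra

/-! ### Graded commutativity of the exterior algebra -/

section Exterior

variable {K : Type*} [Field K] {n : ℕ}

/-- Each pair is inverted in exactly one of the two orders, so the inversion counts add up to
`J.card * L.card`. -/
theorem wedgeSign_comm {J L : Finset (Fin n)} (h : Disjoint J L) :
    wedgeSign L J = (-1) ^ (J.card * L.card) * wedgeSign J L := by
  have h1 : ((L ×ˢ J).filter fun p => p.2 < p.1).card =
      ((J ×ˢ L).filter fun p => ¬ p.2 < p.1).card := by
    refine Finset.card_bij (fun p _ => (p.2, p.1)) ?_ ?_ ?_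
    · rintro ⟨a, b⟩ hp
      simp only [Finset.mem_filter, Finset.mem_product] at hp ⊢
      exact ⟨⟨hp.1.2, hp.1.1⟩, hp.2.not_gt⟩
    · rintro ⟨a, b⟩ _ ⟨a', b'⟩ _ h
      simp only [Prod.mk.injEq] at h ⊢
      exact ⟨h.2, h.1⟩
    · rintro ⟨a, b⟩ hp
      simp only [Finset.mem_filter, Finset.mem_product] at hp
      refine ⟨(b, a), ?_, rfl⟩
      simp only [Finset.mem_filter, Finset.mem_product]
      refine ⟨⟨hp.1.2, hp.1.1⟩, lt_of_le_of_ne (not_lt.mp hp.2) ?_⟩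
      rintro rfl
      exact Finset.disjoint_left.mp h hp.1.1 hp.1.2
  have h2 := Finset.card_filter_add_card_filter_not (s := J ×ˢ L)
    (fun p : Fin n × Fin n => p.2 < p.1)
  rw [wedgeSign, wedgeSign, h1, ← Finset.card_product, ← h2, pow_add, mul_right_comm, ← mul_pow]
  simp

theorem Ext.mul_comm_of_support {d e : ℕ} {v w : Ext K n} (hv : ∀ I, I.card ≠ d → v I = 0)
    (hw : ∀ I, I.card ≠ e → w I = 0) : w * v = (-1 : ℤ) ^ (d * e) • (v * w) := by
  funext I
  change (w * v) I = (-1 : ℤ) ^ (d * e) • (v * w) I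
  rw [Ext.mul_apply, Ext.mul_apply, Finset.smul_sum]
  refine Finset.sum_bij' (fun J _ => I \ J) (fun J _ => I \ J) ?_ ?_ ?_ ?_ ?_
  · intro J _
    exact Finset.mem_powerset.mpr Finset.sdiff_subset
  · intro J _
    exact Finset.mem_powerset.mpr Finset.sdiff_subset
  · intro J hJ
    exact Finset.sdiff_sdiff_eq_self (Finset.mem_powerset.mp hJ)
  · intro J hJ
    exact Finset.sdiff_sdiff_eq_self (Finset.mem_powerset.mp hJ)
  · intro J hJ
    rw [Finset.sdiff_sdiff_eq_self (Finset.mem_powerset.mp hJ)]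
    by_cases h1 : J.card = e
    · by_cases h2 : (I \ J).card = d
      · rw [wedgeSign_comm (J := I \ J) (L := J) Finset.sdiff_disjoint, h1, h2, mul_smul,
          mul_comm (w J)]
      · simp [hv _ h2]
    · simp [hw _ h1]

/-- The basis element `dJ` of the exterior algebra. -/
def Ext.basis (K : Type*) [Field K] {n : ℕ} (J : Finset (Fin n)) : Ext K n :=
  fun I => if I = J then 1 else 0

theorem Ext.basis_comm (J L : Finset (Fin n)) : Ext.basis K L * Ext.basis K J =
    (-1 : ℤ) ^ (J.card * L.card) • (Ext.basis K J * Ext.basis K L) :=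
  Ext.mul_comm_of_support (fun I hI => if_neg fun h => hI (by rw [h]))
    (fun I hI => if_neg fun h => hI (by rw [h]))

end Exterior

/-! ### The cochain algebra, translations and the coboundary -/

section Cochains

variable {K : Type*} [Field K] {n N m : ℕ}

theorem cochainDeg_gradedComm : IsGradedComm (cochainDeg K n N m) where
  one_mem := by
    intro p I hI
    change (1 : Ext K n) I = 0
    rw [Ext.one_apply, if_neg]
    rintro rfl
    exact hI Finset.card_empty
  mul_mem := by
    intro d e v hv w hw p I hI
    rw [Cochain.mul_apply]
    refine Finset.sum_eq_zero fun J hJ => ?_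
    by_cases h1 : J.card = d
    · have h2 : (I \ J).card ≠ e := by
        rw [Finset.card_sdiff_of_subset (Finset.mem_powerset.mp hJ)]
        have := Finset.card_le_card (Finset.mem_powerset.mp hJ)
        omega
      rw [hw p _ h2, mul_zero, smul_zero]
    · rw [hv p _ h1, zero_mul, smul_zero]
  comm := by
    intro d e v hv w hw
    funext p
    exact Ext.mul_comm_of_support (hv p) (hw p)

theorem isInternal_cochainDeg : DirectSum.IsInternal (cochainDeg K n N m) := by
  have key : ∀ (x : DirectSum ℕ fun d => cochainDeg K n N m d) p I,
      DirectSum.coeAddMonoidHom (cochainDeg K n N m) x p I =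
        (x I.card : Cochain K n N m) p I := by
    intro x p I
    induction x using DirectSum.induction_on with
    | zero => rw [map_zero]; rfl
    | of d f =>
      rw [DirectSum.coeAddMonoidHom_of]
      by_cases h : d = I.card
      · subst h
        rw [DirectSum.of_eq_same]
      · rw [DirectSum.of_eq_of_ne _ _ _ (Ne.symm h)]
        exact f.2 p I (Ne.symm h)
    | add x y hx hy =>
      rw [map_add, Cochain.add_apply, hx, hy]
      rfl
  constructor
  · rw [injective_iff_map_eq_zero]
    intro x hx
    ext d
    funext p I
    by_cases h : I.card = d
    · subst h
      rw [← key x p I, hx]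
      rfl
    · exact (x d).2 p I h
  · intro f
    let g : ∀ d, cochainDeg K n N m d := fun d =>
      ⟨fun p I => if I.card = d then f p I else 0, fun p I h => if_neg h⟩
    refine ⟨DirectSum.mk _ (Finset.range (n + 1)) fun d => g d, ?_⟩
    funext p I
    rw [key]
    have h : I.card ∈ Finset.range (n + 1) := by
      have := Finset.card_le_univ I
      rw [Fintype.card_fin] at this
      exact Finset.mem_range.mpr (by omega)
    rw [DirectSum.mk_apply_of_mem h]
    exact if_pos rfl

/-- The sign involution as a homomorphism of algebras. -/
def signHom (K : Type*) [Field K] (n N m : ℕ) : Cochain K n N m →ₐ[K] Cochain K n N m :=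
  AlgHom.ofLinearMap signInv
    (by
      funext p I
      change (-1) ^ I.card * (1 : Ext K n) I = (1 : Ext K n) I
      rw [Ext.one_apply]
      split_ifs with h
      · simp [h]
      · rw [mul_zero])
    (by
      intro f g
      funext p I
      change (-1) ^ I.card * (f * g) p I = (signInv f * signInv g) p I
      rw [Cochain.mul_apply, Cochain.mul_apply, Finset.mul_sum]
      refine Finset.sum_congr rfl fun J hJ => ?_
      change _ = _ • (((-1) ^ J.card * f p J) * ((-1) ^ (I \ J).card * g p (I \ J)))
      rw [← Finset.card_sdiff_add_card_eq_card (Finset.mem_powerset.mp hJ), pow_add, mul_smul_comm]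
      congr 1
      ring)

theorem signHom_toLinearMap : (signHom K n N m).toLinearMap = signInv := rfl

theorem signInv_apply_of_mem (d : ℕ) (v : Cochain K n N m) (hv : v ∈ cochainDeg K n N m d) :
    signInv v = (-1 : ℤ) ^ d • v := by
  funext p I
  change (-1) ^ I.card * v p I = (-1 : ℤ) ^ d • v p I
  by_cases h : I.card = d
  · rw [h, zsmul_eq_mul]
    push_cast
    rfl
  · rw [hv p I h, mul_zero, smul_zero]

/-- Translation by a lattice vector as a homomorphism of algebras. -/
def translate (K : Type*) [Field K] {n N m : ℕ} (z : Lat n N m) :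
    Cochain K n N m →ₐ[K] Cochain K n N m :=
  { toFun := fun f p => f (p + z)
    map_one' := rfl
    map_mul' := fun _ _ => rfl
    map_zero' := rfl
    map_add' := fun _ _ => rfl
    commutes' := fun _ => rfl }

theorem shift_eq (u : Fin n) : (shift u : Cochain K n N m →ₗ[K] _) =
    (translate K (Pi.single u 1)).toLinearMap := rfl

theorem shiftBack_eq (u : Fin n) : (shiftBack u : Cochain K n N m →ₗ[K] _) =
    (translate K (-Pi.single u 1)).toLinearMap := by
  refine LinearMap.ext fun f => funext fun p => ?_
  change f (p - Pi.single u 1) = f (p + -Pi.single u 1)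
  rw [sub_eq_add_neg]

theorem translate_mem (z : Lat n N m) (d : ℕ) (v : Cochain K n N m)
    (hv : v ∈ cochainDeg K n N m d) : translate K z v ∈ cochainDeg K n N m d :=
  fun p I h => hv (p + z) I h

/-- The constant cochain `du`. -/
def dcoord (K : Type*) [Field K] {n N m : ℕ} (u : Fin n) : Cochain K n N m :=
  fun _ => Ext.basis K {u}

theorem dcoord_mem (u : Fin n) : dcoord K u ∈ cochainDeg K n N m 1 := by
  intro p I h
  refine if_neg ?_
  rintro rfl
  exact h (Finset.card_singleton u)

theorem dcoord_mul_apply (u : Fin n) (f : Cochain K n N m) (p : Lat n N m) (I : Finset (Fin n)) :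
    (dcoord K u * f : Cochain K n N m) p I =
      if u ∈ I then (-1) ^ (I.filter (· < u)).card * f p (I.erase u) else 0 := by
  rw [Cochain.mul_apply]
  split_ifs with h
  · rw [Finset.sum_eq_single {u}]
    · have h1 : (dcoord K u : Cochain K n N m) p {u} = 1 := if_pos rfl
      rw [h1, one_mul, wedgeSign, ← Finset.erase_eq, zsmul_eq_mul]
      have h2 : (({u} ×ˢ I.erase u).filter fun p : Fin n × Fin n => p.2 < p.1).card =
          (I.filter (· < u)).card := by
        refine Finset.card_bij (fun p _ => p.2) ?_ ?_ ?_
        · rintro ⟨a, b⟩ hp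
          simp only [Finset.mem_filter, Finset.mem_product, Finset.mem_singleton,
            Finset.mem_erase] at hp ⊢
          obtain ⟨⟨rfl, -, hb⟩, hlt⟩ := hp
          exact ⟨hb, hlt⟩
        · rintro ⟨a, b⟩ hp ⟨a', b'⟩ hp' hbb
          simp only [Finset.mem_filter, Finset.mem_product, Finset.mem_singleton] at hp hp' hbb
          rw [hp.1.1, hp'.1.1, hbb]
        · intro b hb
          simp only [Finset.mem_filter] at hb
          refine ⟨(u, b), ?_, rfl⟩
          simp only [Finset.mem_filter, Finset.mem_product, Finset.mem_singleton,
            Finset.mem_erase]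
          exact ⟨⟨trivial, hb.2.ne, hb.1⟩, hb.2⟩
      rw [h2]
      push_cast
      rfl
    · intro J _ hJ
      have h1 : (dcoord K u : Cochain K n N m) p J = 0 := if_neg hJ
      rw [h1, zero_mul, smul_zero]
    · intro h'
      exact absurd (Finset.mem_powerset.mpr (Finset.singleton_subset_iff.mpr h)) h'
  · refine Finset.sum_eq_zero fun J hJ => ?_
    have h1 : (dcoord K u : Cochain K n N m) p J = 0 := by
      refine if_neg ?_
      rintro rfl
      exact h (Finset.singleton_subset_iff.mp (Finset.mem_powerset.mp hJ))
    rw [h1, zero_mul, smul_zero]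

theorem Cochain.sum_apply {ι : Type*} (s : Finset ι) (f : ι → Cochain K n N m) (p : Lat n N m)
    (I : Finset (Fin n)) : (∑ i ∈ s, f i) p I = ∑ i ∈ s, f i p I := by
  classical
  induction s using Finset.induction_on with
  | empty => rfl
  | insert a s ha ih => rw [Finset.sum_insert ha, Finset.sum_insert ha, Cochain.add_apply, ih]

/-- This puts the coboundary into the form `∑ θ (T - T')`, with `θ` odd and `T`, `T'` automorphisms,
that `proj₁_cumulantCoderivation_wedge` requires. -/
theorem coboundary_eq (f : Cochain K n N m) : coboundary f =
    ∑ u, dcoord K u * (translate K (Pi.single u 1) f - translate K (-Pi.single u 1) f) := by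
  funext p I
  rw [Cochain.sum_apply]
  rw [Finset.sum_congr rfl fun u _ => dcoord_mul_apply u _ p I, Finset.sum_ite_mem,
    Finset.univ_inter]
  refine Finset.sum_congr rfl fun u _ => ?_
  rw [shift_eq, shiftBack_eq]
  rfl

theorem coboundary_mem (d : ℕ) (v : Cochain K n N m) (hv : v ∈ cochainDeg K n N m d) :
    coboundary v ∈ cochainDeg K n N m (d + 1) := by
  rw [coboundary_eq, add_comm d]
  exact Submodule.sum_mem _ fun u _ => cochainDeg_gradedComm.mul_mem _ _ _ (dcoord_mem u) _
    (Submodule.sub_mem _ (translate_mem _ _ _ hv) (translate_mem _ _ _ hv))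

theorem signHom_dcoord (u : Fin n) :
    signHom K n N m (dcoord K u) = - dcoord K u := by
  change signInv (dcoord K u) = _
  rw [signInv_apply_of_mem 1 _ (dcoord_mem u)]
  simp

theorem signInv_coboundary (v : Cochain K n N m) :
    signInv (coboundary v) = - coboundary (signInv v) := by
  rw [coboundary_eq, coboundary_eq, ← signHom_toLinearMap, AlgHom.toLinearMap_apply, map_sum,
    ← Finset.sum_neg_distrib]
  refine Finset.sum_congr rfl fun u _ => ?_
  rw [map_mul, signHom_dcoord, map_sub, neg_mul]
  rfl

/-- Differences in two directions commute while `du` and `dw` anticommute. Exchanging the summation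
indices shows that the square equals its own negative. -/
theorem coboundary_coboundary [CharZero K] (f : Cochain K n N m) :
    coboundary (coboundary f) = 0 := by
  let D : Fin n → Cochain K n N m → Cochain K n N m := fun u f =>
    translate K (Pi.single u 1) f - translate K (-Pi.single u 1) f
  have hcomm : ∀ u w, D u (D w f) = D w (D u f) := by
    intro u w
    funext p
    simp only [D, map_sub]
    change f _ - f _ - (f _ - f _) = f _ - f _ - (f _ - f _)
    simp only [add_right_comm p (Pi.single w 1), add_right_comm p (-Pi.single w 1)]
    abel
  have h1 : ∀ u w (g : Cochain K n N m), D u (dcoord K w * g) = dcoord K w * D u g := by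
    intro u w g
    simp only [D, map_mul]
    rw [mul_sub]
    rfl
  have h2 : coboundary (coboundary f) = ∑ u, ∑ w, dcoord K u * (dcoord K w * D u (D w f)) := by
    rw [coboundary_eq]
    refine Finset.sum_congr rfl fun u _ => ?_
    rw [← Finset.mul_sum]
    congr 1
    change D u (coboundary f) = _
    rw [coboundary_eq]
    have : ∀ (g : Fin n → Cochain K n N m), D u (∑ w, g w) = ∑ w, D u (g w) := by
      intro g
      simp only [D, map_sum, Finset.sum_sub_distrib]
    rw [this]
    exact Finset.sum_congr rfl fun w _ => h1 u w _
  have h3 : coboundary (coboundary f) = - coboundary (coboundary f) := by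
    conv_lhs => rw [h2, Finset.sum_comm]
    rw [h2, ← Finset.sum_neg_distrib]
    refine Finset.sum_congr rfl fun u _ => ?_
    rw [← Finset.sum_neg_distrib]
    refine Finset.sum_congr rfl fun w _ => ?_
    rw [hcomm, ← mul_assoc, ← mul_assoc,
      cochainDeg_gradedComm.comm 1 1 _ (dcoord_mem u) _ (dcoord_mem w)]
    simp
  funext p I
  have h4 := congrArg (fun g : Cochain K n N m => g p I) h3
  exact self_eq_neg.mp h4

end Cochains

/-! ### The rescaled differential -/

instance : CharZero ℚ⸨X⸩ := algebraRat.charZero _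

section DeltaPrime

variable {n N m : ℕ}

theorem deltaPrime_eq (v : ACochain n N m) : deltaPrime n N m v = (2 * scale m)⁻¹ •
    ∑ u, dcoord ℚ⸨X⸩ u *
      (translate ℚ⸨X⸩ (Pi.single u 1) v - translate ℚ⸨X⸩ (-Pi.single u 1) v) := by
  rw [← coboundary_eq]
  rfl

theorem deltaPrime_mem (d : ℕ) (v : ACochain n N m) (hv : v ∈ cochainDeg ℚ⸨X⸩ n N m d) :
    deltaPrime n N m v ∈ cochainDeg ℚ⸨X⸩ n N m (d + 1) :=
  Submodule.smul_mem _ _ (coboundary_mem d v hv)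

theorem deltaPrime_comp_self : deltaPrime n N m ∘ₗ deltaPrime n N m = 0 := by
  refine LinearMap.ext fun v => ?_
  change (2 * scale m)⁻¹ • coboundary ((2 * scale m)⁻¹ • coboundary v) = 0
  rw [map_smul, coboundary_coboundary, smul_zero, smul_zero]

theorem signInv_deltaPrime (v : ACochain n N m) :
    signInv (deltaPrime n N m v) = - deltaPrime n N m (signInv v) := by
  change signInv ((2 * scale m)⁻¹ • coboundary v) = - ((2 * scale m)⁻¹ • coboundary (signInv v))
  rw [map_smul, signInv_coboundary, smul_neg]

theorem mul_dcoord (u : Fin n) (d : ℕ) (v : ACochain n N m) (hv : v ∈ cochainDeg ℚ⸨X⸩ n N m d) :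
    v * dcoord ℚ⸨X⸩ u = (-1 : ℤ) ^ d • (dcoord ℚ⸨X⸩ u * v) := by
  have := cochainDeg_gradedComm.comm 1 d _ (dcoord_mem u) _ hv
  rwa [one_mul] at this

theorem scale_ne_zero (m : ℕ) : scale m ≠ 0 := by
  rw [scale, Ne, HahnSeries.single_eq_zero_iff]
  positivity

end DeltaPrime

/-! ### Products of basis forms -/

section Exterior

variable {K : Type*} [Field K] {n : ℕ}

theorem Ext.smul_apply {R : Type*} [CommSemiring R] [Algebra R K] (a : R) (f : Ext K n)
    (I : Finset (Fin n)) : (a • f : Ext K n) I = a • f I := rfl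

theorem Ext.zsmul_apply (a : ℤ) (f : Ext K n)
    (I : Finset (Fin n)) : (a • f : Ext K n) I = a • f I := rfl

theorem Ext.zero_apply (I : Finset (Fin n)) : (0 : Ext K n) I = 0 := rfl

theorem Ext.sum_apply {ι : Type*} (s : Finset ι) (f : ι → Ext K n) (I : Finset (Fin n)) :
    (∑ i ∈ s, f i) I = ∑ i ∈ s, f i I := by
  classical
  induction s using Finset.induction_on with
  | empty => rfl
  | insert a s ha ih => rw [Finset.sum_insert ha, Finset.sum_insert ha, Ext.add_apply, ih]

theorem Ext.basis_apply (J I : Finset (Fin n)) : Ext.basis K J I = if I = J then 1 else 0 := rfl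

theorem Ext.basis_mul_basis (J L : Finset (Fin n)) : Ext.basis K J * Ext.basis K L =
    if Disjoint J L then wedgeSign J L • Ext.basis K (J ∪ L) else 0 := by
  funext I
  rw [Ext.mul_apply]
  have h0 : ∀ M ∈ I.powerset, ¬ (M = J ∧ I \ M = L) →
      wedgeSign M (I \ M) • (Ext.basis K J M * Ext.basis K L (I \ M)) = 0 := by
    intro M _ hM
    rw [Ext.basis_apply, Ext.basis_apply]
    by_cases h1 : M = J
    · rw [if_neg fun h => hM ⟨h1, h⟩, mul_zero, smul_zero]
    · rw [if_neg h1, zero_mul, smul_zero]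
  split_ifs with h
  · rw [Ext.zsmul_apply, Ext.basis_apply]
    split_ifs with hI
    · subst hI
      rw [Finset.sum_eq_single J, Finset.union_sdiff_cancel_left h, Ext.basis_apply,
        Ext.basis_apply, if_pos rfl, if_pos rfl, one_mul]
      · exact fun M hM hne => h0 M hM fun h => hne h.1
      · exact fun h' => absurd (Finset.mem_powerset.mpr Finset.subset_union_left) h'
    · rw [smul_zero]
      refine Finset.sum_eq_zero fun M hM => h0 M hM ?_
      rintro ⟨rfl, rfl⟩
      exact hI (Finset.union_sdiff_of_subset (Finset.mem_powerset.mp hM)).symm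
  · rw [Ext.zero_apply]
    refine Finset.sum_eq_zero fun M hM => h0 M hM ?_
    rintro ⟨rfl, rfl⟩
    exact h Finset.disjoint_sdiff

/-- A repeated direction annihilates the product; otherwise only a sign is left. That the
coefficient is an integer lets it act on the spans of allowed operations. -/
theorem Ext.prod_basis {k : ℕ} (J : Fin k → Finset (Fin n)) : ∃ z : ℤ,
    (List.ofFn fun a => Ext.basis K (J a)).prod = z • Ext.basis K (Finset.univ.biUnion J) ∧
      ((∃ a b, a ≠ b ∧ ¬ Disjoint (J a) (J b)) → z = 0) := by
  induction k with
  | zero =>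
    refine ⟨1, ?_, fun ⟨a, _⟩ => a.elim0⟩
    rw [List.ofFn_zero, List.prod_nil, one_smul]
    rfl
  | succ k ih =>
    obtain ⟨z, h1, h2⟩ := ih fun a => J a.succ
    have hU : J 0 ∪ Finset.univ.biUnion (fun a : Fin k => J a.succ) = Finset.univ.biUnion J := by
      ext u
      simp [Fin.exists_fin_succ]
    rw [List.ofFn_succ, List.prod_cons, h1, mul_smul_comm, Ext.basis_mul_basis]
    split_ifs with h
    · refine ⟨z * wedgeSign _ _, by rw [mul_smul, hU], ?_⟩
      rintro ⟨a, b, hab, hd⟩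
      rw [Finset.disjoint_biUnion_right] at h
      rw [h2, zero_mul]
      rcases Fin.eq_zero_or_eq_succ a with rfl | ⟨a, rfl⟩ <;>
        rcases Fin.eq_zero_or_eq_succ b with rfl | ⟨b, rfl⟩
      · exact absurd rfl hab
      · exact absurd (h b (Finset.mem_univ _)) hd
      · exact absurd (h a (Finset.mem_univ _)).symm hd
      · exact ⟨a, b, fun h => hab (by rw [h]), hd⟩
    · exact ⟨0, by rw [smul_zero, zero_smul], fun _ => rfl⟩

theorem List.prod_ofFn_smul {A : Type*} [Ring A] [Algebra K A] {k : ℕ} (c : Fin k → K)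
    (x : Fin k → A) :
    (List.ofFn fun a => c a • x a).prod = (∏ a, c a) • (List.ofFn x).prod := by
  have := (MultilinearMap.mkPiAlgebraFin K k A).map_smul_univ c x
  simpa only [MultilinearMap.mkPiAlgebraFin_apply] using this

end Exterior

/-! ### Evaluation and decomposition into components -/

section Pure

variable {K : Type*} [Field K] {n N m : ℕ}

/-- The value of a cochain at a point, as a homomorphism of algebras. -/
def evalAt (K : Type*) [Field K] {n N m : ℕ} (p : Lat n N m) : Cochain K n N m →ₐ[K] Ext K n :=
  { toFun := fun f => f p
    map_one' := rfl
    map_mul' := fun _ _ => rfl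
    map_zero' := rfl
    map_add' := fun _ _ => rfl
    commutes' := fun _ => rfl }

theorem evalAt_apply (p : Lat n N m) (f : Cochain K n N m) : evalAt K p f = f p := rfl

theorem prod_ofFn_apply {k : ℕ} (x : Fin k → Cochain K n N m) (p : Lat n N m) :
    (List.ofFn x).prod p = (List.ofFn fun a => x a p).prod := by
  change evalAt K p (List.ofFn x).prod = _
  rw [map_list_prod, List.map_ofFn]
  rfl

/-- The component `f_J dJ` of a cochain. -/
def component (J : Finset (Fin n)) : Cochain K n N m →ₗ[K] Cochain K n N m where
  toFun f p := f p J • Ext.basis K J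
  map_add' f g := by
    funext p
    exact add_smul _ _ _
  map_smul' a f := by
    funext p
    exact mul_smul _ _ _

theorem component_apply (J : Finset (Fin n)) (f : Cochain K n N m) (p : Lat n N m) :
    component J f p = f p J • Ext.basis K J := rfl

theorem component_mem (J : Finset (Fin n)) (f : Cochain K n N m) :
    component J f ∈ cochainDeg K n N m J.card := by
  intro p I hI
  rw [component_apply, Ext.smul_apply, Ext.basis_apply, if_neg, smul_zero]
  rintro rfl
  exact hI rfl

theorem sum_component {d : ℕ} {f : Cochain K n N m} (hf : f ∈ cochainDeg K n N m d) :
    ∑ J with J.card = d, component J f = f := by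
  funext p I
  rw [Cochain.sum_apply]
  by_cases h : I.card = d
  · rw [Finset.sum_eq_single I (fun J _ hJ => ?_) fun h' => ?_]
    · rw [component_apply, Ext.smul_apply, Ext.basis_apply, if_pos rfl, smul_eq_mul, mul_one]
    · rw [component_apply, Ext.smul_apply, Ext.basis_apply, if_neg hJ.symm, smul_zero]
    · exact (h' (Finset.mem_filter.mpr ⟨Finset.mem_univ _, h⟩)).elim
  · rw [hf p I h]
    refine Finset.sum_eq_zero fun J hJ => ?_
    rw [component_apply, Ext.smul_apply, Ext.basis_apply, if_neg, smul_zero]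
    rintro rfl
    exact h (Finset.mem_filter.mp hJ).2

end Pure

/-! ### Spans of products of difference quotients -/

section Allowed

variable {n N i j k : ℕ}

theorem multilinear_mem_of_span {R ι E F : Type*} [CommRing R] [Fintype ι] [AddCommGroup E]
    [Module R E] [AddCommGroup F] [Module R F] (M : MultilinearMap R (fun _ : ι => E) F)
    (S : Set E) (P : Submodule R F) (h : ∀ x : ι → E, (∀ a, x a ∈ S) → M x ∈ P)
    {x : ι → E} (hx : ∀ a, x a ∈ Submodule.span R S) : M x ∈ P := by
  classical
  have key : ∀ (s : Finset ι) (x : ι → E), (∀ a ∈ s, x a ∈ Submodule.span R S) →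
      (∀ a ∉ s, x a ∈ S) → M x ∈ P := by
    intro s
    induction s using Finset.induction_on with
    | empty => exact fun x _ hx => h x fun a => hx a (Finset.notMem_empty a)
    | insert b s hb ih =>
      intro x h1 h2
      have : ∀ y ∈ Submodule.span R S, M (Function.update x b y) ∈ P := by
        intro y hy
        induction hy using Submodule.span_induction with
        | mem y hy =>
          refine ih _ (fun a ha => ?_) fun a ha => ?_
          · rw [Function.update_of_ne (ne_of_mem_of_not_mem ha hb)]
            exact h1 a (Finset.mem_insert_of_mem ha)
          · by_cases hab : a = b
            · subst hab
              rwa [Function.update_self]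
            · rw [Function.update_of_ne hab]
              exact h2 a fun h => (Finset.mem_insert.mp h).elim hab ha
        | zero => rw [M.map_update_zero]; exact P.zero_mem
        | add y z _ _ hy hz => rw [M.map_update_add]; exact P.add_mem hy hz
        | smul c y _ hy => rw [M.map_update_smul]; exact P.smul_mem c hy
      have h3 := this (x b) (h1 b (Finset.mem_insert_self _ _))
      rwa [Function.update_eq_self] at h3
  exact key Finset.univ x (fun a _ => hx a) fun a ha => absurd (Finset.mem_univ a) ha

/-- The combinations of the values `(Δ_{u₁} ⋯ Δ_{u_s} v)_J(p)` of difference quotients in distinct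
directions. -/
def valueSpan (n N j : ℕ) : Submodule ℚ⟦X⟧ (ACochain n N j → ℚ⸨X⸩) :=
  Submodule.span ℚ⟦X⟧ {ψ | ∃ (l : List (Fin n)) (p : Lat n N j) (J : Finset (Fin n)),
    l.Nodup ∧ ψ = fun v => (l.map diffQuot).prod v p J}

/-- The combinations of products of values of difference quotients of the arguments. -/
def productSpan (n N j k : ℕ) : Submodule ℚ⟦X⟧ ((Fin k → ACochain n N j) → ℚ⸨X⸩) :=
  Submodule.span ℚ⟦X⟧
      {ψ : (Fin k → ACochain n N j) → ℚ⸨X⸩ |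
        ∃ (l : Fin k → List (Fin n)) (p : Fin k → Lat n N j) (J : Fin k → Finset (Fin n)),
          (∀ a, (l a).Nodup) ∧
          ψ = fun v => ∏ a, ((l a).map diffQuot).prod (v a) (p a) (J a)}

theorem mem_allowedOps {φ : (Fin k → ACochain n N j) → ACochain n N i} :
    φ ∈ allowedOps n N i j k ↔ ∀ q I, (fun v => φ v q I) ∈ productSpan n N j k := Iff.rfl

theorem diffQuot_mem_valueSpan {l : List (Fin n)} (hl : l.Nodup) (p : Lat n N j)
    (J : Finset (Fin n)) : (fun v => (l.map diffQuot).prod v p J) ∈ valueSpan n N j :=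
  Submodule.subset_span ⟨l, p, J, hl, rfl⟩

/-- The product is multilinear in the functionals `ψ a`, so generators suffice. -/
theorem prod_mem_productSpan {ψ : Fin k → ACochain n N j → ℚ⸨X⸩}
    (h : ∀ a, ψ a ∈ valueSpan n N j) : (fun v => ∏ a, ψ a (v a)) ∈ productSpan n N j k := by
  let M : MultilinearMap ℚ⟦X⟧ (fun _ : Fin k => ACochain n N j → ℚ⸨X⸩)
      ((Fin k → ACochain n N j) → ℚ⸨X⸩) :=
    MultilinearMap.pi fun v => (MultilinearMap.mkPiAlgebra ℚ⟦X⟧ (Fin k) ℚ⸨X⸩).compLinearMap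
      fun a => LinearMap.proj (v a)
  have hM : ∀ x, M x = fun v => ∏ a, x a (v a) := fun x => rfl
  rw [← hM]
  refine multilinear_mem_of_span M _ (productSpan n N j k) ?_ h
  intro x hx
  choose l p J hl hxl using hx
  refine Submodule.subset_span ⟨l, p, J, hl, ?_⟩
  rw [hM]
  funext v
  exact Finset.prod_congr rfl fun a _ => by rw [hxl]

/-- An operation is divisible if it is so on cochains with a single component. -/
theorem exists_allowedOps_of_component
    (L : MultilinearMap ℚ⸨X⸩ (fun _ : Fin k => ACochain n N j) (ACochain n N i))
    (d : Fin k → ℕ) (c : ℚ⸨X⸩)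
    (h : ∀ J : Fin k → Finset (Fin n), (∀ a, (J a).card = d a) → ∃ φ ∈ allowedOps n N i j k,
      ∀ v, L (fun a => component (J a) (v a)) = c • φ v) :
    ∃ φ ∈ allowedOps n N i j k, ∀ v, (∀ a, v a ∈ cochainDeg ℚ⸨X⸩ n N j (d a)) →
      L v = c • φ v := by
  classical
  choose! φ hφ hL using h
  let s : Finset (Fin k → Finset (Fin n)) :=
    Fintype.piFinset fun a => Finset.univ.filter fun J : Finset (Fin n) => J.card = d a
  have hs : ∀ J ∈ s, ∀ a, (J a).card = d a := by
    intro J hJ a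
    exact (Finset.mem_filter.mp (Fintype.mem_piFinset.mp hJ a)).2
  refine ⟨∑ J ∈ s, φ J, Submodule.sum_mem _ fun J hJ => hφ J (hs J hJ), fun v hv => ?_⟩
  have h1 : v = fun a => ∑ J with J.card = d a, component J (v a) :=
    funext fun a => (sum_component (hv a)).symm
  rw [Finset.sum_apply, Finset.smul_sum]
  conv_lhs => rw [h1, L.map_sum_finset]
  exact Finset.sum_congr rfl fun J hJ => hL J (hs J hJ) v

theorem smul_mem_productSpan (c : ℚ) {ψ : (Fin k → ACochain n N j) → ℚ⸨X⸩}
    (hψ : ψ ∈ productSpan n N j k) : c • ψ ∈ productSpan n N j k :=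
  Submodule.smul_of_tower_mem _ c hψ

end Allowed

/-! ### Möbius cancellation for differences in one block -/

section Moebius

theorem sum_moebius_single_block {k : ℕ} (hk : 0 < k)
    [DecidablePred fun o : OrderedFinpartition k => ∀ a b, o.index a = o.index b] :
    ∑ o : OrderedFinpartition k with ∀ a b, o.index a = o.index b, moebius o = 1 := by
  have h0 : ∀ o : OrderedFinpartition k, (∀ a b, o.index a = o.index b) → o.length = 1 := by
    intro o ho
    have h1 := o.length_pos hk
    by_contra h
    have h2 := ho (o.emb ⟨0, h1⟩ ⟨0, o.partSize_pos _⟩)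
      (o.emb ⟨1, by omega⟩ ⟨0, o.partSize_pos _⟩)
    rw [ofp_index_emb, ofp_index_emb] at h2
    exact absurd (Fin.mk.inj h2) zero_ne_one
  obtain ⟨⟨o, ρ⟩, ho⟩ := OrderedPartition.ofPerm_surjective (k := k)
    ⟨⟨1, by omega⟩, fun _ => 0, fun j => ⟨⟨0, hk⟩, Subsingleton.elim (α := Fin 1) _ _⟩⟩
  have hlen : o.length = 1 := congrArg (fun y : OrderedPartition k => (y.1 : ℕ)) ho
  have hone : ∀ a b, o.index a = o.index b := by
    intro a b
    apply Fin.ext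
    have := (o.index a).2
    have := (o.index b).2
    omega
  rw [Finset.sum_eq_single_of_mem o
    (Finset.mem_filter.mpr ⟨Finset.mem_univ _, hone⟩), moebius, hlen]
  · rfl
  · intro o' ho' hne
    have hlen' := h0 o' (Finset.mem_filter.mp ho').2
    refine absurd (ofp_eq_of_index (o := o) (o' := o') (hlen.trans hlen'.symm) 1 fun a => ?_).1.symm
      hne
    have h1 := (o'.index a).2
    have h2 := ((1 : Equiv.Perm (Fin o.length)) (o.index a)).2
    omega

/-- Only the factors with a difference in every argument survive. -/
theorem sum_moebius_prod_ite {k : ℕ} (hk : 0 < k) {R : Type*} [CommRing R] (F G : Fin k → R) :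
    ∑ o : OrderedFinpartition k, moebius o • ∑ j : Fin o.length,
        ∏ i, (if o.index i = j then F i else G i) =
      ∏ i, (F i - G i) + (∑ o : OrderedFinpartition k, moebius o * o.length) • ∏ i, G i := by
  classical
  -- On the block `j` write `F = (F - G) + G` and expand. The set `S` of arguments contributing a
  -- difference must lie in that block.
  have h1 : ∀ (o : OrderedFinpartition k) (j : Fin o.length),
      ∏ i, (if o.index i = j then F i else G i) = ∑ S : Finset (Fin k),
        if (∀ i ∈ S, o.index i = j) then (∏ i ∈ S, (F i - G i)) * ∏ i ∈ Sᶜ, G i else 0 := by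
    intro o j
    have : ∀ i, (if o.index i = j then F i else G i) =
        (if o.index i = j then F i - G i else 0) + G i := by
      intro i
      split_ifs <;> ring
    rw [Finset.prod_congr rfl fun i _ => this i, Finset.prod_add, Finset.powerset_univ]
    refine Finset.sum_congr rfl fun S _ => ?_
    rw [Finset.prod_ite_zero, ite_mul, zero_mul, Finset.compl_eq_univ_sdiff]
    split_ifs <;> rfl
  -- A non-empty `S` lies in at most one block, so counting the blocks that contain it is testing
  -- whether one exists.
  have h2 : ∀ (o : OrderedFinpartition k) (S : Finset (Fin k)), S.Nonempty →
      (∑ j : Fin o.length, if (∀ i ∈ S, o.index i = j) then (1 : ℤ) else 0) =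
        if ∀ a b, (a ∈ S ∧ b ∈ S) → o.index a = o.index b then 1 else 0 := by
    rintro o S ⟨a₀, ha₀⟩
    split_ifs with h
    · rw [Finset.sum_eq_single (o.index a₀)]
      · exact if_pos fun i hi => h i a₀ ⟨hi, ha₀⟩
      · intro j _ hj
        exact if_neg fun h' => hj (h' a₀ ha₀).symm
      · exact fun h' => absurd (Finset.mem_univ _) h'
    · refine Finset.sum_eq_zero fun j _ => if_neg fun h' => h ?_
      exact fun a b hab => (h' a hab.1).trans (h' b hab.2).symm
  have h3 : ∀ S : Finset (Fin k), (∑ o : OrderedFinpartition k, moebius o *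
      ∑ j : Fin o.length, if (∀ i ∈ S, o.index i = j) then (1 : ℤ) else 0) =
      if S = ∅ then ∑ o : OrderedFinpartition k, moebius o * o.length else
        if S = Finset.univ then 1 else 0 := by
    intro S
    split_ifs with hS hS'
    · subst hS
      simp
    · subst hS'
      refine Eq.trans ?_ (sum_moebius_single_block hk)
      rw [Finset.sum_filter]
      refine Finset.sum_congr rfl fun o _ => ?_
      rw [h2 o _ ⟨⟨0, hk⟩, Finset.mem_univ _⟩]
      simp
    · have hne := Finset.nonempty_iff_ne_empty.mpr hS
      -- The partition with the class `S` and singletons elsewhere; it has at least two classes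
      -- because `S` is neither empty nor everything.
      let s : Setoid (Fin k) :=
        { r := fun a b => a = b ∨ (a ∈ S ∧ b ∈ S)
          iseqv := ⟨fun _ => Or.inl rfl, fun h => h.imp Eq.symm And.symm, by
            rintro a b c (rfl | h) (rfl | h')
            · exact Or.inl rfl
            · exact Or.inr h'
            · exact Or.inr h
            · exact Or.inr ⟨h.1, h'.2⟩⟩ }
      obtain ⟨a, ha⟩ := hne
      obtain ⟨b, hb⟩ : ∃ b, b ∉ S := by
        by_contra h
        push Not at h
        exact hS' (Finset.eq_univ_iff_forall.mpr h)
      refine Eq.trans ?_ (sum_moebius_coarser s ⟨a, b, ?_⟩)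
      · rw [Finset.sum_filter]
        refine Finset.sum_congr rfl fun o _ => ?_
        rw [h2 o _ ⟨a, ha⟩, mul_ite, mul_one, mul_zero]
        refine if_congr (forall_congr' fun a => forall_congr' fun b => ?_) rfl rfl
        refine ⟨fun h h' => ?_, fun h h' => h (Or.inr h')⟩
        rcases h' with h' | h'
        · rw [h']
        · exact h h'
      · rintro (h | h)
        · exact hb (h ▸ ha)
        · exact hb h.2
  have h4 : ∑ o : OrderedFinpartition k, moebius o • ∑ j : Fin o.length,
        ∏ i, (if o.index i = j then F i else G i) = ∑ S : Finset (Fin k),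
      (∑ o : OrderedFinpartition k, moebius o *
        ∑ j : Fin o.length, if (∀ i ∈ S, o.index i = j) then (1 : ℤ) else 0) •
        ((∏ i ∈ S, (F i - G i)) * ∏ i ∈ Sᶜ, G i) := by
    simp only [Finset.sum_smul, mul_smul]
    rw [Finset.sum_comm]
    refine Finset.sum_congr rfl fun o _ => ?_
    rw [← Finset.smul_sum, Finset.sum_comm]
    congr 1
    refine Finset.sum_congr rfl fun j _ => ?_
    rw [h1]
    exact Finset.sum_congr rfl fun S _ => by split_ifs <;> simp
  have hne : (Finset.univ : Finset (Fin k)) ≠ ∅ := Finset.nonempty_iff_ne_empty.mp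
    ⟨⟨0, hk⟩, Finset.mem_univ _⟩
  -- The full set gives the product of all differences. The empty set lies in every block, which
  -- accounts for the factor `o.length`; its term does not involve `F`.
  rw [h4, ← Finset.add_sum_erase _ _ (Finset.mem_univ Finset.univ),
    Finset.sum_eq_single_of_mem ∅ (Finset.mem_erase.mpr ⟨hne.symm, Finset.mem_univ _⟩)]
  · rw [h3, h3, if_neg hne, if_pos rfl, if_pos rfl, Finset.compl_univ, Finset.compl_empty]
    simp
  · intro S hS hS'
    rw [h3, if_neg hS', if_neg (Finset.ne_of_mem_erase hS), zero_smul]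

end Moebius

/-! ### Divisibility of the brackets -/

section Bracket

variable {n N m : ℕ}

theorem scale_smul_diffQuot (u : Fin n) (v : ACochain n N m) (p : Lat n N m)
    (J : Finset (Fin n)) :
    v (p + Pi.single u 1) J - v p J = scale m * diffQuot u v p J := by
  change _ = scale m * ((scale m)⁻¹ * (v (p + Pi.single u 1) J - v p J))
  rw [mul_inv_cancel_left₀ (scale_ne_zero m)]

/-- On pure components the forms factor out, and each of the two shifts contributes a product of `k
+ 1` differences by `sum_moebius_prod_ite`. The prefactor of the differential removes one of the `k
+ 1` powers of the scale. -/
theorem bracket_component {k : ℕ} (J : Fin (k + 1) → Finset (Fin n)) (v : Fin (k + 1) → ACochain n N m)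
    (q : Lat n N m) :
    proj₁ ℚ⸨X⸩ (ACochain n N m) (cumulantCoderivation signInv (deltaPrime n N m)
      (wedge ℚ⸨X⸩ (fun a => (J a).card) fun a => component (J a) (v a))) q =
    scale m ^ k • ∑ u, ((1 / 2 : ℚ) • (∏ a, diffQuot u (v a) q (J a) -
      (-1) ^ (k + 1) * ∏ a, diffQuot u (v a) (q - Pi.single u 1) (J a))) •
        (Ext.basis ℚ⸨X⸩ {u} * (List.ofFn fun a => Ext.basis ℚ⸨X⸩ (J a)).prod) := by
  rw [proj₁_cumulantCoderivation_wedge cochainDeg_gradedComm signInv_apply_of_mem deltaPrime_mem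
    (2 * scale m)⁻¹ (fun u => dcoord ℚ⸨X⸩ u) (fun u => translate ℚ⸨X⸩ (Pi.single u 1))
    (fun u => translate ℚ⸨X⸩ (-Pi.single u 1)) mul_dcoord (fun u => translate_mem _)
    (fun u => translate_mem _) deltaPrime_eq (Nat.succ_pos k) fun a => component_mem (J a) (v a)]
  let e : Ext ℚ⸨X⸩ n := (List.ofFn fun a => Ext.basis ℚ⸨X⸩ (J a)).prod
  have h1 : ∀ (z : Lat n N m) (o : OrderedFinpartition (k + 1)) (j : Fin o.length),
      evalAt ℚ⸨X⸩ q (List.ofFn fun i => if o.index i = j then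
        translate ℚ⸨X⸩ z (component (J i) (v i)) else component (J i) (v i)).prod =
      (∏ i, if o.index i = j then v i (q + z) (J i) else v i q (J i)) • e := by
    intro z o j
    rw [← List.prod_ofFn_smul, evalAt_apply, prod_ofFn_apply]
    congr 2
    funext i
    split_ifs <;> rfl
  have h2 : ∀ z : Lat n N m, ∑ o : OrderedFinpartition (k + 1), moebius o • ∑ j : Fin o.length,
      (∏ i, if o.index i = j then v i (q + z) (J i) else v i q (J i)) • e =
      (∏ i, (v i (q + z) (J i) - v i q (J i)) +
        (∑ o : OrderedFinpartition (k + 1), moebius o * o.length) • ∏ i, v i q (J i)) • e := by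
    intro z
    rw [← sum_moebius_prod_ite (Nat.succ_pos k), Finset.sum_smul]
    refine Finset.sum_congr rfl fun o _ => ?_
    rw [← Finset.sum_smul, smul_assoc]
  have h3 : ∀ u : Fin n, ∏ i, (v i (q + Pi.single u 1) (J i) - v i q (J i)) =
      scale m ^ (k + 1) * ∏ a, diffQuot u (v a) q (J a) := by
    intro u
    rw [Finset.prod_congr rfl fun i _ => scale_smul_diffQuot u (v i) q (J i),
      Finset.prod_mul_distrib, Finset.prod_const, Finset.card_univ, Fintype.card_fin]
  -- A backward difference at `q` is minus a forward difference at the preceding point; hence the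
  -- sign `(-1) ^ (k + 1)`.
  have h4 : ∀ u : Fin n, ∏ i, (v i (q + -Pi.single u 1) (J i) - v i q (J i)) =
      scale m ^ (k + 1) * ((-1) ^ (k + 1) * ∏ a, diffQuot u (v a) (q - Pi.single u 1) (J a)) := by
    intro u
    have : ∀ i, v i (q + -Pi.single u 1) (J i) - v i q (J i) =
        (scale m * -1) * diffQuot u (v i) (q - Pi.single u 1) (J i) := by
      intro i
      have := scale_smul_diffQuot u (v i) (q - Pi.single u 1) (J i)
      rw [sub_add_cancel] at this
      rw [← sub_eq_add_neg, ← neg_sub, this]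
      ring
    rw [Finset.prod_congr rfl fun i _ => this i,
      Finset.prod_mul_distrib, Finset.prod_const, Finset.card_univ, Fintype.card_fin, mul_pow,
      mul_assoc]
  change evalAt ℚ⸨X⸩ q ((2 * scale m)⁻¹ • _) = _
  rw [map_smul, map_sum, Finset.smul_sum, Finset.smul_sum]
  refine Finset.sum_congr rfl fun u _ => ?_
  rw [map_mul, map_sum]
  have h6 : ∑ o : OrderedFinpartition (k + 1), evalAt ℚ⸨X⸩ q (moebius o • ∑ j : Fin o.length,
      ((List.ofFn fun i => if o.index i = j then
        translate ℚ⸨X⸩ (Pi.single u 1) (component (J i) (v i)) else component (J i) (v i)).prod -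
      (List.ofFn fun i => if o.index i = j then
        translate ℚ⸨X⸩ (-Pi.single u 1) (component (J i) (v i)) else component (J i) (v i)).prod)) =
      (scale m ^ (k + 1) * (∏ a, diffQuot u (v a) q (J a) -
        (-1) ^ (k + 1) * ∏ a, diffQuot u (v a) (q - Pi.single u 1) (J a))) • e := by
    -- The term without differences is the same for both shifts, so it may be added to each side of
    -- the subtraction.
    rw [mul_sub, ← h3, ← h4, sub_smul, ← add_sub_add_right_eq_sub _ _
      (((∑ o : OrderedFinpartition (k + 1), moebius o * o.length) • ∏ i, v i q (J i)) • e),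
      ← add_smul, ← add_smul, ← h2, ← h2, ← Finset.sum_sub_distrib]
    refine Finset.sum_congr rfl fun o _ => ?_
    refine Eq.trans ?_ (smul_sub _ _ _)
    rw [map_zsmul, map_sum, ← Finset.sum_sub_distrib]
    congr 1
    refine Finset.sum_congr rfl fun j _ => ?_
    rw [map_sub, h1, h1]
  rw [h6, mul_smul_comm, smul_smul, smul_smul]
  have h7 : evalAt ℚ⸨X⸩ q (dcoord ℚ⸨X⸩ u) = Ext.basis ℚ⸨X⸩ {u} := rfl
  rw [h7]
  congr 1
  generalize (∏ a, diffQuot u (v a) q (J a) -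
    (-1) ^ (k + 1) * ∏ a, diffQuot u (v a) (q - Pi.single u 1) (J a) : ℚ⸨X⸩) = x
  -- The factor `1 / 2` is kept as a rational scalar, under which the span over `ℚ⟦X⟧` is stable.
  have h8 : x = 2 * ((1 / 2 : ℚ) • x) := by
    rw [two_mul, ← add_smul, add_halves, one_smul]
  have h9 := scale_ne_zero m
  nth_rw 1 [h8]
  rw [pow_succ]
  field_simp

theorem bracket_divisible (k : ℕ) (d : Fin (k + 1) → ℕ) : ∃ φ ∈ allowedOps n N m m (k + 1),
    ∀ v : Fin (k + 1) → ACochain n N m, (∀ i, v i ∈ cochainDeg ℚ⸨X⸩ n N m (d i)) →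
      proj₁ ℚ⸨X⸩ (ACochain n N m) (cumulantCoderivation signInv (deltaPrime n N m)
        (wedge ℚ⸨X⸩ d v)) = scale m ^ k • φ v := by
  let L := (proj₁ ℚ⸨X⸩ (ACochain n N m) ∘ₗ
    cumulantCoderivation signInv (deltaPrime n N m)).compMultilinearMap
      (wedgeMultilinear ℚ⸨X⸩ (ACochain n N m) d)
  have hL : ∀ v, L v = proj₁ ℚ⸨X⸩ (ACochain n N m) (cumulantCoderivation signInv
      (deltaPrime n N m) (wedge ℚ⸨X⸩ d v)) := by
    intro v
    rw [← wedgeMultilinear_apply]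
    rfl
  simp only [← hL]
  refine exists_allowedOps_of_component L d (scale m ^ k) fun J hJ => ?_
  obtain rfl : (fun a => (J a).card) = d := funext hJ
  refine ⟨fun v q => ∑ u, ((1 / 2 : ℚ) • (∏ a, diffQuot u (v a) q (J a) -
      (-1) ^ (k + 1) * ∏ a, diffQuot u (v a) (q - Pi.single u 1) (J a))) •
        (Ext.basis ℚ⸨X⸩ {u} * (List.ofFn fun a => Ext.basis ℚ⸨X⸩ (J a)).prod),
    mem_allowedOps.mpr fun q I => ?_, fun v => ?_⟩
  · obtain ⟨z, hz, -⟩ := Ext.prod_basis (K := ℚ⸨X⸩) J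
    have h1 : ∀ u : Fin n, ∃ w : ℤ, (Ext.basis ℚ⸨X⸩ {u} *
        (List.ofFn fun a => Ext.basis ℚ⸨X⸩ (J a)).prod) I = w := by
      intro u
      rw [hz, mul_smul_comm, Ext.basis_mul_basis, Ext.zsmul_apply]
      split_ifs
      · rw [Ext.zsmul_apply, Ext.basis_apply]
        split_ifs
        · exact ⟨z * wedgeSign {u} (Finset.univ.biUnion J), by simp⟩
        · exact ⟨0, by simp⟩
      · exact ⟨0, by simp [Ext.zero_apply]⟩
    choose w hw using h1
    have h2 : (fun v : Fin (k + 1) → ACochain n N m => (∑ u, ((1 / 2 : ℚ) •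
        (∏ a, diffQuot u (v a) q (J a) -
          (-1) ^ (k + 1) * ∏ a, diffQuot u (v a) (q - Pi.single u 1) (J a))) •
        (Ext.basis ℚ⸨X⸩ {u} * (List.ofFn fun a => Ext.basis ℚ⸨X⸩ (J a)).prod)) I) =
        ∑ u, w u • (1 / 2 : ℚ) • ((fun v : Fin (k + 1) → ACochain n N m =>
          ∏ a, diffQuot u (v a) q (J a)) - (-1 : ℤ) ^ (k + 1) •
            fun v : Fin (k + 1) → ACochain n N m =>
              ∏ a, diffQuot u (v a) (q - Pi.single u 1) (J a)) := by
      funext v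
      rw [Ext.sum_apply, Finset.sum_apply]
      refine Finset.sum_congr rfl fun u _ => ?_
      rw [Ext.smul_apply, hw]
      change _ = w u • (1 / 2 : ℚ) • (∏ a, diffQuot u (v a) q (J a) - (-1 : ℤ) ^ (k + 1) •
        ∏ a, diffQuot u (v a) (q - Pi.single u 1) (J a))
      rw [smul_eq_mul, zsmul_eq_mul, zsmul_eq_mul, mul_comm]
      push_cast
      rfl
    rw [h2]
    have h3 : ∀ (u : Fin n) (p : Lat n N m), (fun v : Fin (k + 1) → ACochain n N m =>
        ∏ a, diffQuot u (v a) p (J a)) ∈ productSpan n N m (k + 1) := by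
      intro u p
      refine prod_mem_productSpan (ψ := fun a v => diffQuot u v p (J a)) fun a => ?_
      have := diffQuot_mem_valueSpan (j := m) (N := N) (List.nodup_singleton u) p (J a)
      simpa using this
    exact Submodule.sum_mem _ fun u _ => zsmul_mem (smul_mem_productSpan _
      (Submodule.sub_mem _ (h3 u q) (zsmul_mem (h3 u _) _))) _
  · funext q
    rw [hL, bracket_component]
    rfl

end Bracket

/-! ### Parity and sampling points on the line -/

section Points

variable {N m : ℕ}

/-- The modulus is even, so parity is defined for residues, and doubling is well defined into the
doubled modulus. Any integer representative may thus replace `y.val`, which removes the wrap-around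
at `y ± 1`. -/
theorem even_and_cast_of_cast_eq [NeZero N] {y : ZMod (4 * N * 2 ^ m)} {a : ℤ}
    (ha : (a : ZMod (4 * N * 2 ^ m)) = y) :
    (Even y.val ↔ Even a) ∧ ((2 * y.val : ℕ) : ZMod (4 * N * 2 ^ (m + 1))) = ((2 * a : ℤ)) := by
  have h1 : ((y.val : ℤ) : ZMod (4 * N * 2 ^ m)) = (a : ZMod (4 * N * 2 ^ m)) := by
    rw [ha, Int.cast_natCast, ZMod.natCast_zmod_val]
  rw [ZMod.intCast_eq_intCast_iff, Int.modEq_iff_dvd] at h1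
  obtain ⟨c, hc⟩ := h1
  have h2 : a = y.val + ((4 * N * 2 ^ m : ℕ) : ℤ) * c := by rw [← hc]; ring
  constructor
  · rw [h2, Int.even_add, Int.even_coe_nat]
    have : Even (((4 * N * 2 ^ m : ℕ) : ℤ) * c) :=
      (Int.even_coe_nat _ |>.mpr ⟨2 * N * 2 ^ m, by ring⟩).mul_right c
    exact ⟨fun h => ⟨fun _ => this, fun _ => h⟩, fun h => h.mpr this⟩
  · have h3 : (2 * a : ℤ) = ((2 * y.val : ℕ) : ℤ) + ((4 * N * 2 ^ (m + 1) : ℕ) : ℤ) * c := by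
      rw [h2]
      push_cast
      ring
    rw [h3, Int.cast_add, Int.cast_mul, Int.cast_natCast ((4 * N * 2 ^ (m + 1) : ℕ)),
      ZMod.natCast_self, zero_mul, add_zero, Int.cast_natCast]

theorem basePt_eq [NeZero N] {y : ZMod (4 * N * 2 ^ m)} {a : ℤ}
    (ha : (a : ZMod (4 * N * 2 ^ m)) = y) :
    basePt y = ((if Even a then 2 * a else 2 * a - 1 : ℤ) : ZMod (4 * N * 2 ^ (m + 1))) := by
  obtain ⟨h1, h2⟩ := even_and_cast_of_cast_eq ha
  rw [basePt]
  simp only [h1, h2]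
  split_ifs <;> push_cast <;> rfl

theorem otherPt_eq [NeZero N] {y : ZMod (4 * N * 2 ^ m)} {a : ℤ}
    (ha : (a : ZMod (4 * N * 2 ^ m)) = y) :
    otherPt y = ((if Even a then 2 * a - 2 else 2 * a + 1 : ℤ) : ZMod (4 * N * 2 ^ (m + 1))) := by
  obtain ⟨h1, h2⟩ := even_and_cast_of_cast_eq ha
  rw [otherPt]
  simp only [h1, h2]
  split_ifs <;> push_cast <;> rfl

/-- Integration of `1`-cochains on the line turns differences into differences. -/
theorem sum_difference_eq [NeZero N] {A : Type*} [AddCommGroup A] (y : ZMod (4 * N * 2 ^ m))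
    (g : ZMod (4 * N * 2 ^ (m + 1)) → A) :
    (g (basePt y + 1) - g (basePt y - 1)) + (g (otherPt y + 1) - g (otherPt y - 1)) =
      g (basePt (y + 1)) - g (basePt (y - 1)) := by
  have h0 : ((y.val : ℤ) : ZMod (4 * N * 2 ^ m)) = y := by
    rw [Int.cast_natCast, ZMod.natCast_zmod_val]
  have h1 : ((y.val + 1 : ℤ) : ZMod (4 * N * 2 ^ m)) = y + 1 := by
    rw [Int.cast_add, h0, Int.cast_one]
  have h2 : ((y.val - 1 : ℤ) : ZMod (4 * N * 2 ^ m)) = y - 1 := by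
    rw [Int.cast_sub, h0, Int.cast_one]
  rw [basePt_eq h0, otherPt_eq h0, basePt_eq h1, basePt_eq h2]
  generalize (y.val : ℤ) = a
  have e : ∀ b c d : ℤ, b + c = d → (b : ZMod (4 * N * 2 ^ (m + 1))) + (c : ℤ) = (d : ℤ) := by
    rintro b c _ rfl
    push_cast
    rfl
  simp only [← Int.cast_one (R := ZMod (4 * N * 2 ^ (m + 1))), ← Int.cast_add, ← Int.cast_sub]
  -- The four points are `2a ± 1` and `2a - 2 ± 1` for even `a`, and `2a - 1 ± 1` and `2a + 1 ± 1`
  -- for odd `a`. In both cases the shared middle point cancels.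
  by_cases ha : Even a
  · have h3 : ¬ Even (a + 1) := by rwa [Int.even_add_one, not_not]
    have h4 : ¬ Even (a - 1) := by rwa [Int.even_sub_one, not_not]
    rw [if_pos ha, if_pos ha, if_neg h3, if_neg h4, show 2 * (a + 1) - 1 = 2 * a + 1 by ring,
      show 2 * (a - 1) - 1 = 2 * a - 3 by ring, show 2 * a - 2 + 1 = 2 * a - 1 by ring,
      show 2 * a - 2 - 1 = 2 * a - 3 by ring]
    abel
  · have h3 : Even (a + 1) := by rwa [Int.even_add_one]
    have h4 : Even (a - 1) := by rwa [Int.even_sub_one]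
    rw [if_neg ha, if_neg ha, if_pos h3, if_pos h4, show 2 * (a + 1) = 2 * a + 2 by ring,
      show 2 * (a - 1) = 2 * a - 2 by ring, show 2 * a - 1 + 1 = 2 * a by ring,
      show 2 * a - 1 - 1 = 2 * a - 2 by ring, show 2 * a + 1 - 1 = 2 * a by ring,
      show 2 * a + 1 + 1 = 2 * a + 2 by ring]
    abel

end Points

/-! ### Integration maps as means over independent directions -/

section Average

variable {K : Type*} [Field K] {n N : ℕ}

/-- The component of type `I` at `y` of the value is the mean of the components of type `I`
at the points that have coordinates `pt ω (y u)` in the directions `u ∈ I` and `b (y u)` in the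
others, `ω` running independently in each direction over a finite set. -/
def IsAverage {i j : ℕ} (β : Cochain K n N j →ₗ[K] Cochain K n N i) : Prop :=
  ∃ (Ω : Type) (_ : Fintype Ω) (_ : Nonempty Ω) (b : ZMod (4 * N * 2 ^ i) → ZMod (4 * N * 2 ^ j))
    (pt : Ω → ZMod (4 * N * 2 ^ i) → ZMod (4 * N * 2 ^ j)), ∀ f y I,
      β f y I = ((Fintype.card Ω : K) ^ n)⁻¹ *
        ∑ ω : Fin n → Ω, f (fun u => if u ∈ I then pt (ω u) (y u) else b (y u)) I

theorem IsAverage.id {i : ℕ} : IsAverage (LinearMap.id : Cochain K n N i →ₗ[K] _) := by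
  refine ⟨Unit, inferInstance, inferInstance, fun y => y, fun _ y => y, fun f y I => ?_⟩
  simp

/-- A choice for the composite is a pair of choices, again independent between directions. Both maps
displace in the directions of the same type `I`, since neither changes the type. -/
theorem IsAverage.comp {i j l : ℕ} {β : Cochain K n N j →ₗ[K] Cochain K n N i}
    {γ : Cochain K n N l →ₗ[K] Cochain K n N j} (hβ : IsAverage β) (hγ : IsAverage γ) :
    IsAverage (β ∘ₗ γ) := by
  obtain ⟨Ω, _, _, b, pt, h⟩ := hβ
  obtain ⟨Ω', _, _, b', pt', h'⟩ := hγ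
  refine ⟨Ω × Ω', inferInstance, inferInstance, fun y => b' (b y),
    fun ω y => pt' ω.2 (pt ω.1 y), fun f y I => ?_⟩
  have hcard : ((Fintype.card (Ω × Ω') : K) ^ n)⁻¹ =
      ((Fintype.card Ω : K) ^ n)⁻¹ * ((Fintype.card Ω' : K) ^ n)⁻¹ := by
    rw [Fintype.card_prod, Nat.cast_mul, mul_pow, mul_inv]
  rw [LinearMap.comp_apply, h, ← (Equiv.arrowProdEquivProdArrow (Fin n) (fun _ => Ω)
    (fun _ => Ω')).symm.sum_comp, Fintype.sum_prod_type, hcard,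
    mul_assoc ((Fintype.card Ω : K) ^ n)⁻¹]
  congr 1
  rw [Finset.mul_sum]
  refine Finset.sum_congr rfl fun ω _ => (h' f _ I).trans ?_
  congr 1
  refine Finset.sum_congr rfl fun ω' _ => ?_
  congr 1
  funext u
  by_cases hu : u ∈ I
  · rw [if_pos hu, if_pos hu, if_pos hu]
    rfl
  · rw [if_neg hu, if_neg hu, if_neg hu]

/-- Choices outside `I` are irrelevant: each subset of `I` comes from `2 ^ (n - I.card)` functions.
The mean thereby acquires a normalisation that does not depend on `I`. -/
theorem sum_powerset_eq_sum_bool [CharZero K] (I : Finset (Fin n)) (g : Finset (Fin n) → K) :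
    (2⁻¹ : K) ^ I.card * ∑ E ∈ I.powerset, g E =
      ((2 : K) ^ n)⁻¹ * ∑ ω : Fin n → Bool, g (I.filter fun u => ω u = true) := by
  have h1 : ∀ E ∈ I.powerset, (Finset.univ.filter fun ω : Fin n → Bool =>
      (I.filter fun u => ω u = true) = E).card = 2 ^ (n - I.card) := by
    intro E hE
    have h2 : n - I.card = Iᶜ.card := by rw [Finset.card_compl, Fintype.card_fin]
    rw [h2, ← Finset.card_powerset]
    refine Finset.card_bij' (fun ω _ => Iᶜ.filter fun u => ω u = true)
      (fun F _ u => decide (u ∈ E ∪ F)) ?_ ?_ ?_ ?_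
    · intro ω _
      exact Finset.mem_powerset.mpr (Finset.filter_subset _ _)
    · intro F hF
      rw [Finset.mem_filter]
      refine ⟨Finset.mem_univ _, ?_⟩
      ext u
      have h3 : u ∈ E → u ∈ I := fun h => Finset.mem_powerset.mp hE h
      have h4 : u ∈ F → u ∈ Iᶜ := fun h => Finset.mem_powerset.mp hF h
      simp only [Finset.mem_filter, decide_eq_true_eq, Finset.mem_union, Finset.mem_compl] at h4 ⊢
      tauto
    · intro ω hω
      have h3 := (Finset.mem_filter.mp hω).2
      funext u
      rw [← h3]
      by_cases hu : u ∈ I <;> cases h : ω u <;> simp [hu, h]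
    · intro F hF
      ext u
      have h3 : u ∈ E → u ∈ I := fun h => Finset.mem_powerset.mp hE h
      have h4 : u ∈ F → u ∈ Iᶜ := fun h => Finset.mem_powerset.mp hF h
      simp only [Finset.mem_filter, decide_eq_true_eq, Finset.mem_union, Finset.mem_compl] at h4 ⊢
      tauto
  have h2 : ∑ ω : Fin n → Bool, g (I.filter fun u => ω u = true) =
      2 ^ (n - I.card) * ∑ E ∈ I.powerset, g E := by
    rw [← Finset.sum_fiberwise_of_maps_to (t := I.powerset)
      (g := fun ω : Fin n → Bool => I.filter fun u => ω u = true)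
      fun ω _ => Finset.mem_powerset.mpr (Finset.filter_subset _ _), Finset.mul_sum]
    refine Finset.sum_congr rfl fun E hE => ?_
    rw [Finset.sum_congr rfl fun ω hω => by rw [(Finset.mem_filter.mp hω).2], Finset.sum_const,
      h1 E hE, nsmul_eq_mul]
    push_cast
    rfl
  have h3 : I.card ≤ n := (Finset.card_le_univ I).trans_eq (Fintype.card_fin n)
  have h4 : (2 : K) ^ n = 2 ^ (n - I.card) * 2 ^ I.card := by
    rw [← pow_add, Nat.sub_add_cancel h3]
  rw [h2, h4, inv_pow]
  have : (2 : K) ≠ 0 := two_ne_zero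
  field_simp

theorem isAverage_integration [CharZero K] (m : ℕ) : IsAverage (integration K n N m) := by
  refine ⟨Bool, inferInstance, inferInstance, basePt,
    fun ω y => if ω then otherPt y else basePt y, fun f y I => ?_⟩
  refine (sum_powerset_eq_sum_bool I fun E =>
    f (fun u => if u ∈ E then otherPt (y u) else basePt (y u)) I).trans ?_
  rw [Fintype.card_bool, Nat.cast_ofNat]
  congr 1
  refine Finset.sum_congr rfl fun ω _ => ?_
  congr 1
  funext u
  by_cases hu : u ∈ I <;> simp [Finset.mem_filter, hu]

theorem integrationTo_self (i : ℕ) : integrationTo K n N (le_refl i) = LinearMap.id :=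
  Nat.leRec_self (motive := fun j _ => Cochain K n N j →ₗ[K] Cochain K n N i) _ _

theorem integrationTo_succ {i j : ℕ} (hij : i ≤ j) : integrationTo K n N (Nat.le_succ_of_le hij) =
    integrationTo K n N hij ∘ₗ integration K n N j :=
  Nat.leRec_succ (motive := fun j _ => Cochain K n N j →ₗ[K] Cochain K n N i) _ _ hij

theorem integrationTo_comp {i j l : ℕ} (hij : i ≤ j) (hjl : j ≤ l) :
    integrationTo K n N hij ∘ₗ integrationTo K n N hjl = integrationTo K n N (hij.trans hjl) := by
  induction l, hjl using Nat.le_induction with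
  | base => rw [integrationTo_self, LinearMap.comp_id]
  | succ l hl ih =>
    rw [integrationTo_succ hl, ← LinearMap.comp_assoc, ih, ← integrationTo_succ]

theorem isAverage_integrationTo [CharZero K] {i j : ℕ} (hij : i ≤ j) :
    IsAverage (integrationTo K n N hij) := by
  induction j, hij using Nat.le_induction with
  | base => rw [integrationTo_self]; exact IsAverage.id
  | succ j hj ih => rw [integrationTo_succ hj]; exact ih.comp (isAverage_integration j)

theorem IsAverage.mem {i j : ℕ} {β : Cochain K n N j →ₗ[K] Cochain K n N i} (hβ : IsAverage β)
    (d : ℕ) (f : Cochain K n N j) (hf : f ∈ cochainDeg K n N j d) :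
    β f ∈ cochainDeg K n N i d := by
  obtain ⟨Ω, _, _, b, pt, h⟩ := hβ
  intro y I hI
  rw [h, Finset.sum_eq_zero fun ω _ => hf _ I hI, mul_zero]

theorem IsAverage.signInv_comm {i j : ℕ} {β : Cochain K n N j →ₗ[K] Cochain K n N i}
    (hβ : IsAverage β) (f : Cochain K n N j) : β (signInv f) = signInv (β f) := by
  obtain ⟨Ω, _, _, b, pt, h⟩ := hβ
  funext y I
  change _ = (-1) ^ I.card * β f y I
  rw [h, h, mul_left_comm]
  congr 1
  rw [Finset.mul_sum]
  rfl

end Average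

/-! ### Integration is a cochain map -/

section Differential

variable {n N m : ℕ}

theorem scale_eq_two_mul (m : ℕ) : scale m = 2 * scale (m + 1) := by
  have h : ∀ r : ℚ, (HahnSeries.single (1 : ℤ) r : ℚ⸨X⸩) =
      2 * (HahnSeries.single (1 : ℤ) (r * (1 / 2)) : ℚ⸨X⸩) := by
    intro r
    rw [two_mul, ← HahnSeries.single_add]
    congr 1
    ring
  have h' := h ((1 / 2) ^ m)
  rwa [← pow_succ] at h'

/-- In the direction `u` of the difference, the two averaging points telescope to a difference on
the coarse lattice. The factor `1 / 2` is the weight of the average in direction `u`, which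
components of type `I.erase u` no longer have. -/
theorem integration_coboundary (hN : 0 < N) (f : ACochain n N (m + 1)) :
    integration ℚ⸨X⸩ n N m (coboundary f) = (2⁻¹ : ℚ⸨X⸩) • coboundary (integration ℚ⸨X⸩ n N m f) := by
  have : NeZero N := ⟨hN.ne'⟩
  funext y I
  let P : (Fin n → ZMod (4 * N * 2 ^ m)) → Finset (Fin n) → Lat n N (m + 1) := fun y E u =>
    if u ∈ E then otherPt (y u) else basePt (y u)
  have h1 : ∀ (g : ACochain n N (m + 1)) (y : Lat n N m) I, integration ℚ⸨X⸩ n N m g y I =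
    (2⁻¹ : ℚ⸨X⸩) ^ I.card * ∑ E ∈ I.powerset, g (P y E) I := fun _ _ _ => rfl
  have h2 : ∀ {m : ℕ} (g : ACochain n N m) (y : Lat n N m) I, coboundary g y I =
    ∑ u ∈ I, (-1 : ℚ⸨X⸩) ^ (I.filter (· < u)).card *
      (g (y + Pi.single u 1) (I.erase u) - g (y - Pi.single u 1) (I.erase u)) := fun _ _ _ => rfl
  rw [Cochain.smul_apply, h1, h2, smul_eq_mul]
  rw [Finset.sum_congr rfl fun E _ => h2 f (P y E) I, Finset.sum_comm, Finset.mul_sum,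
    Finset.mul_sum]
  refine Finset.sum_congr rfl fun u hu => ?_
  rw [← Finset.mul_sum, h1, h1, ← mul_sub, ← Finset.sum_sub_distrib,
    Finset.card_erase_of_mem hu]
  obtain ⟨r, hr⟩ := Nat.exists_eq_succ_of_ne_zero (Finset.card_ne_zero_of_mem hu)
  rw [hr, Nat.succ_eq_add_one, Nat.add_sub_cancel]
  have h3 : ∑ E ∈ I.powerset, (f (P y E + Pi.single u 1) (I.erase u) -
      f (P y E - Pi.single u 1) (I.erase u)) = ∑ E ∈ (I.erase u).powerset,
        (f (P (y + Pi.single u 1) E) (I.erase u) - f (P (y - Pi.single u 1) E) (I.erase u)) := by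
    conv_lhs => rw [← Finset.insert_erase hu]
    -- Subsets of `I` are paired as `E` and `insert u E`: base point and other point in direction
    -- `u`.
    rw [Finset.sum_powerset_insert (Finset.notMem_erase u I), ← Finset.sum_add_distrib,
      Finset.erase_insert (Finset.notMem_erase u I)]
    refine Finset.sum_congr rfl fun E hE => ?_
    have huE : u ∉ E := fun h => Finset.notMem_erase u I (Finset.mem_powerset.mp hE h)
    have e1 : ∀ z : ZMod (4 * N * 2 ^ (m + 1)), P y E + Pi.single u z =
        Function.update (P y E) u (basePt (y u) + z) := by
      intro z
      funext w
      by_cases hw : w = u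
      · subst hw
        rw [Pi.add_apply, Pi.single_eq_same, Function.update_self]
        exact congrArg (· + z) (if_neg huE)
      · rw [Pi.add_apply, Pi.single_eq_of_ne hw, Function.update_of_ne hw, add_zero]
    have e2 : ∀ z : ZMod (4 * N * 2 ^ (m + 1)), P y (insert u E) + Pi.single u z =
        Function.update (P y E) u (otherPt (y u) + z) := by
      intro z
      funext w
      by_cases hw : w = u
      · subst hw
        rw [Pi.add_apply, Pi.single_eq_same, Function.update_self]
        exact congrArg (· + z) (if_pos (Finset.mem_insert_self _ _))
      · rw [Pi.add_apply, Pi.single_eq_of_ne hw, Function.update_of_ne hw, add_zero]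
        refine if_congr ?_ rfl rfl
        rw [Finset.mem_insert]
        simp [hw]
    have e3 : ∀ z : ZMod (4 * N * 2 ^ m), P (y + Pi.single u z) E =
        Function.update (P y E) u (basePt (y u + z)) := by
      intro z
      funext w
      by_cases hw : w = u
      · subst hw
        rw [Function.update_self]
        refine (if_neg huE).trans ?_
        rw [Pi.add_apply, Pi.single_eq_same]
      · rw [Function.update_of_ne hw]
        change (if w ∈ E then otherPt ((y + Pi.single u z : Fin n → _) w) else
          basePt ((y + Pi.single u z : Fin n → _) w)) = _
        rw [Pi.add_apply, Pi.single_eq_of_ne hw, add_zero]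
    have e4 : ∀ {m : ℕ} (x : Lat n N m), x - Pi.single u 1 = x + Pi.single u (-1) := by
      intro m x
      rw [sub_eq_add_neg, Pi.single_neg]
    rw [e4, e4, e4, e1, e1, e2, e2, e3, e3, ← sub_eq_add_neg, ← sub_eq_add_neg, ← sub_eq_add_neg]
    exact sum_difference_eq (y u) fun z => f (Function.update (P y E) u z) (I.erase u)
  refine (congrArg (fun x => (2⁻¹ : ℚ⸨X⸩) ^ (r + 1) * ((-1) ^ (I.filter (· < u)).card * x))
    h3).trans ?_
  ring

theorem integration_deltaPrime (hN : 0 < N) : integration ℚ⸨X⸩ n N m ∘ₗ deltaPrime n N (m + 1) =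
    deltaPrime n N m ∘ₗ integration ℚ⸨X⸩ n N m := by
  refine LinearMap.ext fun f => ?_
  change integration ℚ⸨X⸩ n N m ((2 * scale (m + 1))⁻¹ • coboundary f) =
    (2 * scale m)⁻¹ • coboundary (integration ℚ⸨X⸩ n N m f)
  rw [map_smul, integration_coboundary hN, smul_smul, scale_eq_two_mul m, ← mul_inv]
  congr 2
  ring

theorem integrationTo_deltaPrime (hN : 0 < N) {i j : ℕ} (hij : i ≤ j) :
    integrationTo ℚ⸨X⸩ n N hij ∘ₗ deltaPrime n N j =
      deltaPrime n N i ∘ₗ integrationTo ℚ⸨X⸩ n N hij := by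
  induction j, hij using Nat.le_induction with
  | base => rw [integrationTo_self]; rfl
  | succ j hj ih =>
    rw [integrationTo_succ hj, LinearMap.comp_assoc, integration_deltaPrime hN,
      ← LinearMap.comp_assoc, ih, LinearMap.comp_assoc]

end Differential

/-! ### Translations and iterated differences -/

section Differences

variable {n N m k : ℕ}

/-- The group ring of the lattice acts on cochains by translations. -/
def translationAction (n N m : ℕ) :
    AddMonoidAlgebra ℤ (Lat n N m) →ₐ[ℤ] Module.End ℚ⸨X⸩ (ACochain n N m) :=
  AddMonoidAlgebra.lift ℤ _ _
    { toFun := fun z => (translate ℚ⸨X⸩ (Multiplicative.toAdd z)).toLinearMap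
      map_one' := by
        refine LinearMap.ext fun f => funext fun p => ?_
        change f (p + 0) = f p
        rw [add_zero]
      map_mul' := by
        intro z w
        refine LinearMap.ext fun f => funext fun p => ?_
        change f (p + (Multiplicative.toAdd z + Multiplicative.toAdd w)) =
          f (p + Multiplicative.toAdd z + Multiplicative.toAdd w)
        rw [add_assoc] }

theorem translationAction_single (z : Lat n N m) :
    translationAction n N m (AddMonoidAlgebra.single z 1) =
      (translate ℚ⸨X⸩ z).toLinearMap := by
  exact AddMonoidAlgebra.lift_of _ (Multiplicative.ofAdd z)

theorem exists_algebraMap_eq_scale (m : ℕ) : ∃ c : ℚ⟦X⟧, algebraMap ℚ⟦X⟧ ℚ⸨X⸩ c = scale m := by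
  refine ⟨PowerSeries.C ((1 / 2 : ℚ) ^ m) * PowerSeries.X, ?_⟩
  rw [map_mul]
  change HahnSeries.ofPowerSeries ℤ ℚ _ * HahnSeries.ofPowerSeries ℤ ℚ _ = _
  rw [HahnSeries.ofPowerSeries_C, HahnSeries.ofPowerSeries_X, HahnSeries.C_apply,
    HahnSeries.single_mul_single, zero_add, mul_one, scale]

/-- A translation only moves the point of evaluation, and the coefficients in the group ring are
integers. -/
theorem translationAction_mem_valueSpan (A : AddMonoidAlgebra ℤ (Lat n N m)) {l : List (Fin n)}
    (hl : l.Nodup) (p : Lat n N m) (J : Finset (Fin n)) :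
    (fun v => translationAction n N m A ((l.map diffQuot).prod v) p J) ∈ valueSpan n N m := by
  let E : AddMonoidAlgebra ℤ (Lat n N m) →+ (ACochain n N m → ℚ⸨X⸩) :=
    AddMonoidHom.mk' (fun A v => translationAction n N m A ((l.map diffQuot).prod v) p J) (by
      intro A B
      funext v
      rw [map_add]
      rfl)
  change E A ∈ _
  induction A using AddMonoidAlgebra.induction_linear with
  | zero =>
    rw [map_zero]
    exact Submodule.zero_mem _
  | add A B hA hB =>
    rw [map_add]
    exact Submodule.add_mem _ hA hB
  | single z c =>
    have h1 : (AddMonoidAlgebra.single z c : AddMonoidAlgebra ℤ (Lat n N m)) =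
        c • AddMonoidAlgebra.single z 1 := by
      rw [AddMonoidAlgebra.smul_single, smul_eq_mul, mul_one]
    have h2 : E (AddMonoidAlgebra.single z 1) =
        fun v => (l.map diffQuot).prod v (p + z) J := by
      funext v
      change translationAction n N m (AddMonoidAlgebra.single z 1) _ p J = _
      rw [translationAction_single]
      rfl
    rw [h1, map_zsmul, h2]
    exact zsmul_mem (diffQuot_mem_valueSpan hl (p + z) J) c

/-- The step in direction `u` as an element of the group ring of the lattice. -/
def stepElement (n N m : ℕ) (u : Fin n) : AddMonoidAlgebra ℤ (Lat n N m) :=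
  AddMonoidAlgebra.single (Pi.single u 1) 1

theorem translationAction_stepElement_sub_one (u : Fin n) :
    translationAction n N m (stepElement n N m u - 1) = scale m • diffQuot u := by
  rw [map_sub, map_one, stepElement, translationAction_single, diffQuot, smul_smul,
    mul_inv_cancel₀ (scale_ne_zero m), one_smul, shift_eq]
  rfl

theorem translationAction_prod_list (l : List (Fin n)) :
    translationAction n N m (l.map fun u => stepElement n N m u - 1).prod =
      scale m ^ l.length • (l.map diffQuot).prod := by
  induction l with
  | nil => simp
  | cons u l ih =>
    rw [List.map_cons, List.prod_cons, map_mul, ih, translationAction_stepElement_sub_one,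
      List.map_cons, List.prod_cons, List.length_cons, pow_succ', smul_mul_smul_comm]

theorem translationAction_prod (S : Finset (Fin n)) :
    translationAction n N m (∏ u ∈ S, (stepElement n N m u - 1)) =
      scale m ^ S.card • (S.toList.map diffQuot).prod := by
  rw [← Finset.prod_map_toList, translationAction_prod_list, Finset.length_toList]

/-- The value at a point that differs from `b` in the coordinates of `U` is a sum of iterated
differences at `b`. -/
theorem exists_sum_differences (hN : 0 < N) (b p : Lat n N m) (J : Finset (Fin n)) :
    ∃ ψ : Finset (Fin n) → ACochain n N m → ℚ⸨X⸩, (∀ S, ψ S ∈ valueSpan n N m) ∧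
      ∀ (v : ACochain n N m) (U : Finset (Fin n)),
        v (fun u => if u ∈ U then p u else b u) J = ∑ S ∈ U.powerset, scale m ^ S.card * ψ S v := by
  have : NeZero N := ⟨hN.ne'⟩
  -- The geometric sum with `(T - 1) G = T^r - 1`: a displacement of any length in one direction
  -- costs a single difference in that direction.
  let G : Fin n → AddMonoidAlgebra ℤ (Lat n N m) := fun u =>
    ∑ i ∈ Finset.range (p u - b u).val, stepElement n N m u ^ i
  refine ⟨fun S v => translationAction n N m (∏ u ∈ S, G u) ((S.toList.map diffQuot).prod v) b J,
    fun S => translationAction_mem_valueSpan _ S.nodup_toList b J, fun v U => ?_⟩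
  have h1 : ∀ u, (AddMonoidAlgebra.single (Pi.single u (p u - b u)) 1 :
      AddMonoidAlgebra ℤ (Lat n N m)) = 1 + (stepElement n N m u - 1) * G u := by
    intro u
    rw [mul_geom_sum, add_sub_cancel, stepElement, AddMonoidAlgebra.single_pow, one_pow,
      ← Pi.single_smul, nsmul_eq_mul, mul_one, ZMod.natCast_zmod_val]
  have h2 : ∀ U : Finset (Fin n), ∏ u ∈ U, (AddMonoidAlgebra.single (Pi.single u (p u - b u)) 1 :
      AddMonoidAlgebra ℤ (Lat n N m)) =
        AddMonoidAlgebra.single (∑ u ∈ U, Pi.single u (p u - b u)) 1 := by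
    intro U
    induction U using Finset.induction_on with
    | empty => rfl
    | insert a U ha ih =>
      rw [Finset.prod_insert ha, Finset.sum_insert ha, ih, AddMonoidAlgebra.single_mul_single,
        mul_one]
  have h3 : (fun u => if u ∈ U then p u else b u) =
      b + ∑ u ∈ U, (Pi.single u (p u - b u) : Lat n N m) := by
    funext w
    rw [Pi.add_apply, Finset.sum_apply, Finset.sum_pi_single]
    split_ifs
    · rw [add_sub_cancel]
    · rw [add_zero]
  have h4 : v (fun u => if u ∈ U then p u else b u) J =
      translationAction n N m (∏ u ∈ U, (1 + (stepElement n N m u - 1) * G u)) v b J := by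
    rw [← Finset.prod_congr rfl fun u _ => h1 u, h2, translationAction_single, h3]
    rfl
  -- In the expanded product `S` is the set of differenced directions. Each occurs at most once, as
  -- allowed operations demand.
  rw [h4, Finset.prod_one_add, map_sum, LinearMap.sum_apply, Cochain.sum_apply]
  refine Finset.sum_congr rfl fun S _ => ?_
  have h5 : translationAction n N m (∏ u ∈ S, (stepElement n N m u - 1) * G u) =
      translationAction n N m (∏ u ∈ S, G u) * (scale m ^ S.card • (S.toList.map diffQuot).prod) := by
    rw [Finset.prod_mul_distrib, mul_comm (∏ u ∈ S, (stepElement n N m u - 1)), map_mul,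
      translationAction_prod]
  rw [h5, mul_smul_comm]
  rfl

end Differences

/-! ### Connectivity and vanishing coefficients -/

section Coefficients

variable {n k : ℕ}

/-- Fewer than `k - 1` directions do not tie all the `k` arguments together, so that the Möbius
numbers of the partitions compatible with them add up to zero. -/
theorem sum_moebius_subset_eq_zero (J : Fin k → Finset (Fin n))
    (hJ : ∀ a b, a ≠ b → Disjoint (J a) (J b)) (S : Fin k → Finset (Fin n))
    (hS : ∑ a, (S a).card + 1 < k) :
    ∑ o : OrderedFinpartition k, (if ∀ a, S a ⊆ (Finset.univ.filter fun b =>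
      o.index b = o.index a).biUnion J then moebius o else 0) = 0 := by
  classical
  by_cases hcov : ∀ a, ∀ u ∈ S a, ∃ b, u ∈ J b
  swap
  -- A direction that belongs to no argument lies in no block, so every term vanishes.
  · push Not at hcov
    obtain ⟨a, u, hu, h⟩ := hcov
    refine Finset.sum_eq_zero fun o _ => if_neg fun h' => ?_
    obtain ⟨b, -, hb⟩ := Finset.mem_biUnion.mp (h' a hu)
    exact h b hb
  -- Each `u ∈ S a` ties `a` to the argument owning `u`, unique by disjointness. The condition on a
  -- partition says that tied arguments share a block.
  let r : Fin k → Fin k → Prop := fun a b => ∃ u ∈ S a, u ∈ J b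
  let s : Setoid (Fin k) := Relation.EqvGen.setoid r
  have h1 : ∀ o : OrderedFinpartition k, (∀ a, S a ⊆ (Finset.univ.filter fun b =>
      o.index b = o.index a).biUnion J) ↔ ∀ a b, s a b → o.index a = o.index b := by
    intro o
    constructor
    · intro h a b hab
      induction (hab : Relation.EqvGen r a b) with
      | rel a b hr =>
        obtain ⟨u, hu, hub⟩ := hr
        obtain ⟨c, hc, huc⟩ := Finset.mem_biUnion.mp (h a hu)
        have : b = c := by
          by_contra hbc
          exact Finset.disjoint_left.mp (hJ b c hbc) hub huc
        rw [this, (Finset.mem_filter.mp hc).2]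
      | refl a => rfl
      | symm a b _ ih => exact ih.symm
      | trans a b c _ _ ih ih' => exact ih.trans ih'
    · intro h a u hu
      obtain ⟨b, hb⟩ := hcov a u hu
      exact Finset.mem_biUnion.mpr ⟨b, Finset.mem_filter.mpr ⟨Finset.mem_univ _,
        (h a b (Relation.EqvGen.rel _ _ ⟨u, hu, hb⟩)).symm⟩, hb⟩
  rw [Finset.sum_congr rfl fun o _ => if_congr (h1 o) rfl rfl, ← Finset.sum_filter]
  -- The ties must not connect everything. A connected graph on `k` vertices has at least `k - 1`
  -- edges, whereas there are at most `∑ a, (S a).card` ties.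
  refine sum_moebius_coarser s ?_
  by_contra hcon
  push Not at hcon
  let Γ : SimpleGraph (Fin k) := SimpleGraph.fromRel r
  have hreach : ∀ a b, Γ.Reachable a b := by
    intro a b
    induction (hcon a b : Relation.EqvGen r a b) with
    | rel a b hr =>
      by_cases hab : a = b
      · rw [hab]
      · exact SimpleGraph.Adj.reachable ((SimpleGraph.fromRel_adj r a b).mpr ⟨hab, Or.inl hr⟩)
    | refl a => exact SimpleGraph.Reachable.refl _
    | symm a b _ ih => exact ih.symm
    | trans a b c _ _ ih ih' => exact ih.trans ih'
  have hconn : Γ.Connected :=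
    { preconnected := hreach
      nonempty := ⟨⟨0, by omega⟩⟩ }
  have hcard := hconn.card_vert_le_card_edgeSet_add_one
  choose! own hown using hcov
  let T : Finset (Sym2 (Fin k)) :=
    (Finset.univ.sigma S).image fun x : (_ : Fin k) × Fin n => s(x.1, own x.1 x.2)
  have hsub : Γ.edgeSet ⊆ T := by
    have key : ∀ a b, r a b → s(a, b) ∈ T := by
      rintro a b ⟨u, hu, hub⟩
      refine Finset.mem_image.mpr ⟨⟨a, u⟩, Finset.mem_sigma.mpr ⟨Finset.mem_univ _, hu⟩, ?_⟩
      have : own a u = b := by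
        by_contra hne
        exact Finset.disjoint_left.mp (hJ _ _ hne) (hown a u hu) hub
      rw [this]
    intro e
    induction e using Sym2.ind with
    | _ a b =>
      intro he
      rw [SimpleGraph.mem_edgeSet, SimpleGraph.fromRel_adj] at he
      rcases he.2 with h | h
      · exact key a b h
      · rw [Sym2.eq_swap]
        exact key b a h
  have h2 : Nat.card Γ.edgeSet ≤ T.card := by
    rw [Nat.card_coe_set_eq, ← Set.ncard_coe_finset T]
    exact Set.ncard_le_ncard hsub T.finite_toSet
  have h3 : T.card ≤ ∑ a, (S a).card := Finset.card_image_le.trans_eq (Finset.card_sigma _ _)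
  rw [Nat.card_eq_fintype_card, Fintype.card_fin] at hcard
  omega

end Coefficients

/-! ### Möbius sums of displaced values -/

section Core

variable {n N m k : ℕ}

/-- The scale itself lies in `ℚ⟦X⟧`, so surplus powers of it do no harm. -/
theorem pow_smul_mem_productSpan (e : ℕ) {ψ : (Fin k → ACochain n N m) → ℚ⸨X⸩}
    (hψ : ψ ∈ productSpan n N m k) : (fun v => scale m ^ e * ψ v) ∈ productSpan n N m k := by
  obtain ⟨c, hc⟩ := exists_algebraMap_eq_scale m
  have h := Submodule.smul_mem _ (c ^ e) hψ
  refine (congrArg (· ∈ productSpan n N m k) (funext fun v => ?_)).mp h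
  change c ^ e • ψ v = _
  rw [Algebra.smul_def, map_pow, hc]

/-- In the expanded product `S a` records the directions in which the argument `a` is differenced.
After exchanging the sums, the coefficient of a family `S` is the one in
`sum_moebius_subset_eq_zero`, so only families with at least `k` differences survive. -/
theorem sum_moebius_prod_sum_powerset (R : Type*) [CommRing R]
    (J : Fin (k + 1) → Finset (Fin n)) (hJ : ∀ a b, a ≠ b → Disjoint (J a) (J b)) :
    ∃ C : (Fin (k + 1) → Finset (Fin n)) → ℤ, ∀ (h : R) (ψ : Fin (k + 1) → Finset (Fin n) → R),
    ∑ o : OrderedFinpartition (k + 1), moebius o • ∏ a, ∑ S ∈ ((Finset.univ.filter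
      fun b => o.index b = o.index a).biUnion J).powerset, h ^ S.card * ψ a S =
    h ^ k * ∑ S, C S • (h ^ (∑ a, (S a).card - k) * ∏ a, ψ a (S a)) := by
  refine ⟨fun S => ∑ o : OrderedFinpartition (k + 1),
    if ∀ a, S a ⊆ (Finset.univ.filter fun b => o.index b = o.index a).biUnion J
      then moebius o else 0, fun h ψ => ?_⟩
  have h1 : ∀ o : OrderedFinpartition (k + 1), ∏ a, ∑ S ∈ ((Finset.univ.filter
      fun b => o.index b = o.index a).biUnion J).powerset, h ^ S.card * ψ a S =
      ∑ S : Fin (k + 1) → Finset (Fin n), if ∀ a, S a ⊆ (Finset.univ.filter fun b =>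
        o.index b = o.index a).biUnion J then
          h ^ (∑ a, (S a).card) * ∏ a, ψ a (S a) else 0 := by
    intro o
    rw [Finset.prod_univ_sum, ← Finset.sum_filter]
    refine Finset.sum_congr ?_ fun S _ => ?_
    · ext S
      simp only [Fintype.mem_piFinset, Finset.mem_powerset, Finset.mem_filter, Finset.mem_univ,
        true_and]
    · rw [Finset.prod_mul_distrib, Finset.prod_pow_eq_pow_sum]
  simp only [h1, Finset.smul_sum]
  rw [Finset.sum_comm, Finset.mul_sum]
  refine Finset.sum_congr rfl fun S _ => ?_
  simp only [smul_ite, smul_zero]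
  -- Where the subtraction in the exponent would be truncated, the coefficient is zero.
  by_cases hS : ∑ a, (S a).card + 1 < k + 1
  · rw [sum_moebius_subset_eq_zero J hJ S hS, zero_smul, mul_zero, ← Finset.sum_filter,
      ← Finset.sum_smul, Finset.sum_filter, sum_moebius_subset_eq_zero J hJ S hS, zero_smul]
  · rw [mul_smul_comm, ← mul_assoc, ← pow_add, Nat.add_sub_cancel' (by omega),
      ← Finset.sum_filter, ← Finset.sum_smul, Finset.sum_filter]

theorem sum_mem_productSpan (e : (Fin k → Finset (Fin n)) → ℕ)
    (C : (Fin k → Finset (Fin n)) → ℤ) (ψ : Fin k → Finset (Fin n) → ACochain n N m → ℚ⸨X⸩)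
    (hψ : ∀ a S, ψ a S ∈ valueSpan n N m) :
    (fun v : Fin k → ACochain n N m => ∑ S : Fin k → Finset (Fin n),
      C S • (scale m ^ e S * ∏ a, ψ a (S a) (v a))) ∈ productSpan n N m k := by
  have h1 : ∀ S : Fin k → Finset (Fin n), (fun v : Fin k → ACochain n N m =>
      scale m ^ e S * ∏ a, ψ a (S a) (v a)) ∈ productSpan n N m k := fun S =>
    pow_smul_mem_productSpan _ (prod_mem_productSpan fun a => hψ a (S a))
  have h2 := Submodule.sum_mem (productSpan n N m k) fun (S : Fin k → Finset (Fin n))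
    (_ : S ∈ Finset.univ) => zsmul_mem (h1 S) (C S)
  refine (congrArg (· ∈ productSpan n N m k) (funext fun v => ?_)).mp h2
  rw [Finset.sum_apply]
  rfl

/-- The alternating sum over partitions of products of values at points that depend on the blocks
is divisible. -/
theorem exists_productSpan_moebius (hN : 0 < N) (b p : Lat n N m)
    (J : Fin (k + 1) → Finset (Fin n)) (hJ : ∀ a b, a ≠ b → Disjoint (J a) (J b)) :
    ∃ ψ ∈ productSpan n N m (k + 1), ∀ v : Fin (k + 1) → ACochain n N m,
      ∑ o : OrderedFinpartition (k + 1), moebius o • ∏ a, v a (fun u =>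
        if u ∈ (Finset.univ.filter fun b => o.index b = o.index a).biUnion J then p u else b u) (J a)
      = scale m ^ k * ψ v := by
  choose ψ hψ hv using fun a => exists_sum_differences hN b p (J a)
  obtain ⟨C, hC⟩ := sum_moebius_prod_sum_powerset ℚ⸨X⸩ J hJ
  refine ⟨_, sum_mem_productSpan (fun S => ∑ a, (S a).card - k) C ψ hψ, fun v => ?_⟩
  refine Eq.trans ?_ (hC (scale m) fun a S => ψ a S (v a))
  refine Finset.sum_congr rfl fun o _ => ?_
  rw [Finset.prod_congr rfl fun a _ => hv a (v a) _]

end Core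

/-! ### Means of functions of independent variables -/

section Independence

variable {K : Type*} [Field K] {n : ℕ} {Ω : Type*} [Fintype Ω]

/-- The mean of a function of `n` independent variables. -/
def mean (F : (Fin n → Ω) → K) : K := ((Fintype.card Ω : K) ^ n)⁻¹ * ∑ ω, F ω

/-- Gluing the `U`-coordinates of one point to the other coordinates of a second point is an
involution on pairs. It makes `F p.1 * G p.2` a function of the first point alone, and the free
second point yields the factor. -/
theorem sum_mul_sum_of_dependsOn {F G : (Fin n → Ω) → K} {U V : Finset (Fin n)}
    (hF : DependsOn F U) (hG : DependsOn G V) (h : Disjoint U V) :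
    (∑ ω, F ω) * ∑ ω, G ω = (Fintype.card Ω : K) ^ n * ∑ ω, F ω * G ω := by
  let s : (Fin n → Ω) × (Fin n → Ω) → (Fin n → Ω) × (Fin n → Ω) := fun p =>
    (fun u => if u ∈ U then p.1 u else p.2 u, fun u => if u ∈ U then p.2 u else p.1 u)
  have hs : Function.Involutive s := by
    rintro ⟨a, b⟩
    refine Prod.ext (funext fun u => ?_) (funext fun u => ?_) <;> by_cases hu : u ∈ U <;> simp [s, hu]
  rw [Finset.sum_mul_sum, ← Fintype.sum_prod_type']
  have h1 : ∀ p : (Fin n → Ω) × (Fin n → Ω), F p.1 * G p.2 = F (s p).1 * G (s p).1 := by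
    intro p
    congr 1
    · exact hF fun u hu => (if_pos hu).symm
    · exact hG fun u hu => (if_neg fun h' => Finset.disjoint_left.mp h h' hu).symm
  rw [Finset.sum_congr rfl fun p _ => h1 p,
    hs.bijective.sum_comp (fun p : (Fin n → Ω) × (Fin n → Ω) => F p.1 * G p.1),
    Fintype.sum_prod_type]
  simp only [Finset.sum_const, Finset.card_univ, Fintype.card_fun, Fintype.card_fin, nsmul_eq_mul,
    Nat.cast_pow, Finset.mul_sum]

theorem mean_mul_left (c : K) (F : (Fin n → Ω) → K) : mean (fun ω => c * F ω) = c * mean F := by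
  rw [mean, mean, ← Finset.mul_sum, mul_left_comm]

theorem mean_sum_zsmul {ι : Type*} (s : Finset ι) (c : ι → ℤ) (F : ι → (Fin n → Ω) → K) :
    mean (fun ω => ∑ j ∈ s, c j • F j ω) = ∑ j ∈ s, c j • mean (F j) := by
  rw [mean, Finset.sum_comm, Finset.mul_sum]
  refine Finset.sum_congr rfl fun j _ => ?_
  rw [mean, ← Finset.smul_sum, mul_smul_comm]

variable [CharZero K] [Nonempty Ω]

theorem mean_mul {F G : (Fin n → Ω) → K} {U V : Finset (Fin n)}
    (hF : DependsOn F U) (hG : DependsOn G V) (h : Disjoint U V) :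
    mean (fun ω => F ω * G ω) = mean F * mean G := by
  have hc : (Fintype.card Ω : K) ^ n ≠ 0 := pow_ne_zero _ (Nat.cast_ne_zero.mpr Fintype.card_ne_zero)
  rw [mean, mean, mean, mul_mul_mul_comm, sum_mul_sum_of_dependsOn hF hG h]
  field_simp

theorem mean_one : mean (fun _ : Fin n → Ω => (1 : K)) = 1 := by
  have hc : (Fintype.card Ω : K) ^ n ≠ 0 := pow_ne_zero _ (Nat.cast_ne_zero.mpr Fintype.card_ne_zero)
  rw [mean]
  simp only [Finset.sum_const, Finset.card_univ, Fintype.card_fun, Fintype.card_fin, nsmul_eq_mul,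
    Nat.cast_pow, mul_one]
  exact inv_mul_cancel₀ hc

theorem mean_prod {ι : Type*} [DecidableEq ι] (s : Finset ι) {F : ι → (Fin n → Ω) → K}
    {U : ι → Finset (Fin n)} (hF : ∀ j, DependsOn (F j) (U j))
    (h : ∀ i j, i ≠ j → Disjoint (U i) (U j)) :
    mean (fun ω => ∏ j ∈ s, F j ω) = ∏ j ∈ s, mean (F j) := by
  induction s using Finset.induction_on with
  | empty => simp only [Finset.prod_empty]; exact mean_one
  | insert a s ha ih =>
    simp only [Finset.prod_insert ha]
    rw [mean_mul (hF a) (V := s.biUnion U), ih]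
    · intro ω ω' hω
      refine Finset.prod_congr rfl fun j hj => hF j fun u hu => hω u ?_
      exact Finset.mem_coe.mpr (Finset.mem_biUnion.mpr ⟨j, hj, hu⟩)
    · rw [Finset.disjoint_biUnion_right]
      exact fun j hj => h a j fun h' => ha (h' ▸ hj)

end Independence

/-! ### Cumulants of averages on pure components -/

section Cumulant

variable {K : Type*} [Field K] {n N i j k : ℕ}

/-- The directions that occur in a block. -/
def blockDirections (J : Fin k → Finset (Fin n)) (o : OrderedFinpartition k) (B : Fin o.length) :
    Finset (Fin n) :=
  (Finset.univ.filter fun b => o.index b = B).biUnion J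

theorem blockDirections_eq (J : Fin k → Finset (Fin n)) (o : OrderedFinpartition k)
    (B : Fin o.length) : Finset.univ.biUnion (fun r => J (o.emb B r)) = blockDirections J o B := by
  ext u
  simp only [blockDirections, Finset.mem_biUnion, Finset.mem_univ, true_and, Finset.mem_filter]
  constructor
  · rintro ⟨r, hr⟩
    exact ⟨_, ofp_index_emb o B r, hr⟩
  · rintro ⟨a, rfl, ha⟩
    exact ⟨o.invEmbedding a, by rwa [o.emb_invEmbedding]⟩

theorem disjoint_blockDirections {J : Fin k → Finset (Fin n)}
    (hJ : ∀ a b, a ≠ b → Disjoint (J a) (J b)) (o : OrderedFinpartition k) {B C : Fin o.length}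
    (hBC : B ≠ C) : Disjoint (blockDirections J o B) (blockDirections J o C) := by
  rw [blockDirections, blockDirections, Finset.disjoint_biUnion_left]
  intro a ha
  rw [Finset.disjoint_biUnion_right]
  intro b hb
  refine hJ a b ?_
  rintro rfl
  exact hBC ((Finset.mem_filter.mp ha).2.symm.trans (Finset.mem_filter.mp hb).2)

variable {Ω : Type} [Fintype Ω] {b : ZMod (4 * N * 2 ^ i) → ZMod (4 * N * 2 ^ j)}
  {pt : Ω → ZMod (4 * N * 2 ^ i) → ZMod (4 * N * 2 ^ j)}
  {β : Cochain K n N j →ₗ[K] Cochain K n N i}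

/-- The point with coordinates `pt (ω u) (y u)` in the directions of `U` and `b (y u)` in the
others. -/
def averagePoint (b : ZMod (4 * N * 2 ^ i) → ZMod (4 * N * 2 ^ j))
    (pt : Ω → ZMod (4 * N * 2 ^ i) → ZMod (4 * N * 2 ^ j)) (y : Lat n N i) (ω : Fin n → Ω)
    (U : Finset (Fin n)) : Lat n N j :=
  fun u => if u ∈ U then pt (ω u) (y u) else b (y u)

/-- The product over a block has at most the one type formed by all its directions. In every other
type both sides vanish, so the displacement may be taken in the directions of the block. -/
theorem average_blockProd
    (hβ : ∀ f y I, β f y I = mean fun ω : Fin n → Ω => f (averagePoint b pt y ω I) I)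
    (J : Fin k → Finset (Fin n)) (v : Fin k → Cochain K n N j) (y : Lat n N i)
    (o : OrderedFinpartition k) (B : Fin o.length) :
    β (blockProd (fun a => component (J a) (v a)) o B) y =
      (mean fun ω : Fin n → Ω => ∏ r, v (o.emb B r)
        (averagePoint b pt y ω (blockDirections J o B)) (J (o.emb B r))) •
        blockProd (fun a => Ext.basis K (J a)) o B := by
  obtain ⟨z, hz, -⟩ := Ext.prod_basis (K := K) fun r => J (o.emb B r)
  rw [blockDirections_eq] at hz
  replace hz : blockProd (fun a => Ext.basis K (J a)) o B =
    z • Ext.basis K (blockDirections J o B) := hz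
  have h1 : ∀ p, blockProd (fun a => component (J a) (v a)) o B p =
      (∏ r, v (o.emb B r) p (J (o.emb B r))) • z • Ext.basis K (blockDirections J o B) := by
    intro p
    rw [← hz]
    exact (prod_ofFn_apply _ _).trans (List.prod_ofFn_smul _ _)
  funext I
  rw [hβ, hz, Ext.smul_apply]
  have h2 : ∀ ω : Fin n → Ω, blockProd (fun a => component (J a) (v a)) o B
      (averagePoint b pt y ω I) I = (∏ r, v (o.emb B r) (averagePoint b pt y ω I)
        (J (o.emb B r))) * (z • Ext.basis K (blockDirections J o B)) I := fun ω => by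
    rw [h1]
    rfl
  simp only [h2]
  rw [mean, mean, ← Finset.sum_mul, smul_eq_mul, mul_assoc]
  by_cases hI : I = blockDirections J o B
  · rw [hI]
  · rw [Ext.zsmul_apply, Ext.basis_apply, if_neg hI, smul_zero]
    ring

/-- Reordering the basis forms absorbs all signs, and a scalar Möbius sum times one fixed form
remains. -/
theorem cumulant_component
    (hβ : ∀ f y I, β f y I = mean fun ω : Fin n → Ω => f (averagePoint b pt y ω I) I)
    (J : Fin k → Finset (Fin n)) (v : Fin k → Cochain K n N j) (y : Lat n N i) :
    cumulant β (fun a => (J a).card) (fun a => component (J a) (v a)) y =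
      (∑ o : OrderedFinpartition k, moebius o • ∏ B, mean fun ω : Fin n → Ω => ∏ r, v (o.emb B r)
        (averagePoint b pt y ω (blockDirections J o B)) (J (o.emb B r))) •
        (List.ofFn fun a => Ext.basis K (J a)).prod := by
  have h1 : ∀ o : OrderedFinpartition k,
      evalAt K y (List.ofFn fun B => β (blockProd (fun a => component (J a) (v a)) o B)).prod =
      (∏ B, mean fun ω : Fin n → Ω => ∏ r, v (o.emb B r)
        (averagePoint b pt y ω (blockDirections J o B)) (J (o.emb B r))) •
        (List.ofFn (blockProd (fun a => Ext.basis K (J a)) o)).prod := fun o =>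
    (prod_ofFn_apply _ _).trans ((congrArg (fun f => (List.ofFn f).prod)
      (funext fun B => average_blockProd hβ J v y o B)).trans (List.prod_ofFn_smul _ _))
  have h2 : ∀ o : OrderedFinpartition k, partitionSign (fun a => (J a).card) o •
      (List.ofFn (blockProd (fun a => Ext.basis K (J a)) o)).prod =
      (List.ofFn fun a => Ext.basis K (J a)).prod := fun o =>
    prod_blockProd (x := fun a => Ext.basis K (J a)) (fun a => (J a).card) o
      fun a b => Ext.basis_comm (J a) (J b)
  have h3 : evalAt K y (cumulant β (fun a => (J a).card) (fun a => component (J a) (v a))) =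
      ∑ o : OrderedFinpartition k, (moebius o * partitionSign (fun a => (J a).card) o) •
        evalAt K y (List.ofFn fun B => β (blockProd (fun a => component (J a) (v a)) o B)).prod := by
    rw [cumulant, map_sum]
    exact Finset.sum_congr rfl fun o _ => map_zsmul _ _ _
  refine h3.trans ?_
  rw [Finset.sum_smul]
  refine Finset.sum_congr rfl fun o _ => ?_
  rw [h1, mul_smul, smul_comm (partitionSign _ o), h2, smul_assoc]

/-- For disjoint sets of directions the blocks are independent. -/
theorem prod_mean_eq [CharZero K] [Nonempty Ω] {J : Fin k → Finset (Fin n)}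
    (hJ : ∀ a b, a ≠ b → Disjoint (J a) (J b)) (v : Fin k → Cochain K n N j) (y : Lat n N i)
    (o : OrderedFinpartition k) :
    ∏ B, (mean fun ω : Fin n → Ω => ∏ r, v (o.emb B r)
      (averagePoint b pt y ω (blockDirections J o B)) (J (o.emb B r))) =
    mean fun ω : Fin n → Ω => ∏ a, v a
      (averagePoint b pt y ω (blockDirections J o (o.index a))) (J a) := by
  rw [← mean_prod Finset.univ (U := blockDirections J o)]
  · congr 1
    funext ω
    rw [← o.prod_sigma_eq_prod]
    refine Finset.prod_congr rfl fun B _ => Finset.prod_congr rfl fun r _ => ?_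
    rw [ofp_index_emb]
  -- The factor of a block reads `ω` only in the directions of that block.
  · intro B ω ω' hω
    have : averagePoint b pt y ω (blockDirections J o B) =
        averagePoint b pt y ω' (blockDirections J o B) := by
      funext u
      rw [averagePoint, averagePoint]
      split_ifs with hu
      · rw [hω u hu]
      · rfl
    simp only [this]
  · exact fun B C hBC => disjoint_blockDirections hJ o hBC

end Cumulant

/-! ### Divisibility of the cumulants -/

section Divisibility

variable {n N i j : ℕ}

/-- The `(k+1)`-st cumulant of an averaging map is divisible by `h ^ k`. -/
theorem cumulant_divisible (hN : 0 < N) {β : ACochain n N j →ₗ[ℚ⸨X⸩] ACochain n N i}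
    (hβ : IsAverage β) (k : ℕ) (d : Fin (k + 1) → ℕ) :
    ∃ φ ∈ allowedOps n N i j (k + 1), ∀ v : Fin (k + 1) → ACochain n N j,
      (∀ a, v a ∈ cochainDeg ℚ⸨X⸩ n N j (d a)) → cumulant β d v = scale j ^ k • φ v := by
  have hmem := hβ.mem
  obtain ⟨Ω, _, _, b, pt, h⟩ := hβ
  -- As a Taylor coefficient, the cumulant is the restriction of a multilinear map, so the reduction
  -- to pure components applies.
  let L := (proj₁ ℚ⸨X⸩ (ACochain n N i) ∘ₗ cumulantConj β).compMultilinearMap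
      (wedgeMultilinear ℚ⸨X⸩ (ACochain n N j) d)
  have hL : ∀ v, (∀ a, v a ∈ cochainDeg ℚ⸨X⸩ n N j (d a)) → L v = cumulant β d v := by
    intro v hv
    rw [← proj₁_cumulantConj_wedge cochainDeg_gradedComm cochainDeg_gradedComm hmem
      (Nat.succ_pos k) hv, ← wedgeMultilinear_apply]
    rfl
  suffices H : ∃ φ ∈ allowedOps n N i j (k + 1), ∀ v : Fin (k + 1) → ACochain n N j,
      (∀ a, v a ∈ cochainDeg ℚ⸨X⸩ n N j (d a)) → L v = scale j ^ k • φ v by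
    obtain ⟨φ, hφ, hv⟩ := H
    exact ⟨φ, hφ, fun v hv' => by rw [← hL v hv', hv v hv']⟩
  refine exists_allowedOps_of_component L d (scale j ^ k) fun J hd => ?_
  obtain rfl : (fun a => (J a).card) = d := funext hd
  have hL' : ∀ (v : Fin (k + 1) → ACochain n N j) (y : Lat n N i), L (fun a => component (J a) (v a)) y =
      (∑ o : OrderedFinpartition (k + 1), moebius o • ∏ B, mean fun ω : Fin n → Ω => ∏ r,
        v (o.emb B r) (averagePoint b pt y ω (blockDirections J o B)) (J (o.emb B r))) •
        (List.ofFn fun a => Ext.basis ℚ⸨X⸩ (J a)).prod := by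
    intro v y
    rw [hL _ fun a => component_mem (J a) (v a)]
    exact cumulant_component h J v y
  obtain ⟨z, hz, hz0⟩ := Ext.prod_basis (K := ℚ⸨X⸩) J
  -- If two arguments share a direction, the product of the forms is zero and the operation vanishes
  -- on these components.
  by_cases hJ : ∃ a b, a ≠ b ∧ ¬ Disjoint (J a) (J b)
  · refine ⟨0, Submodule.zero_mem _, fun v => ?_⟩
    have hE : (List.ofFn fun a => Ext.basis ℚ⸨X⸩ (J a)).prod = 0 := by
      rw [hz, hz0 hJ]
      exact zero_zsmul _
    funext y
    refine (hL' v y).trans ?_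
    rw [hE, smul_zero, Pi.zero_apply, smul_zero]
    rfl
  push Not at hJ
  have key := fun (y : Lat n N i) (ω : Fin n → Ω) =>
    exists_productSpan_moebius (k := k) hN (fun u => b (y u)) (fun u => pt (ω u) (y u)) J hJ
  choose ψ hψ hv using key
  refine ⟨fun v y => (mean fun ω => ψ y ω v) • (List.ofFn fun a => Ext.basis ℚ⸨X⸩ (J a)).prod,
    mem_allowedOps.mpr fun y I => ?_, fun v => ?_⟩
  · have h1 : ((Fintype.card Ω : ℚ) ^ n)⁻¹ • ∑ ω, ψ y ω ∈ productSpan n N j (k + 1) :=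
      smul_mem_productSpan _ (Submodule.sum_mem _ fun ω _ => hψ y ω)
    have h2 : ∃ w : ℤ, (z • Ext.basis ℚ⸨X⸩ (Finset.univ.biUnion J)) I = w := by
      rw [Ext.zsmul_apply, Ext.basis_apply]
      split_ifs
      · exact ⟨z, by simp⟩
      · exact ⟨0, by simp⟩
    obtain ⟨w, hw⟩ := h2
    have h3 := zsmul_mem h1 w
    have h4 : ∀ x : ℚ⸨X⸩, ((Fintype.card Ω : ℚ) ^ n)⁻¹ • x = ((Fintype.card Ω : ℚ⸨X⸩) ^ n)⁻¹ * x := by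
      intro x
      have := inv_natCast_smul_eq ℚ ℚ⸨X⸩ (Fintype.card Ω ^ n) x
      rwa [Nat.cast_pow, Nat.cast_pow, smul_eq_mul] at this
    refine (congrArg (· ∈ productSpan n N j (k + 1)) (funext fun v => ?_)).mp h3
    rw [hz, Ext.smul_apply, hw, mean, smul_eq_mul, mul_comm, ← zsmul_eq_mul, ← h4]
    change w • ((Fintype.card Ω : ℚ) ^ n)⁻¹ • (∑ ω, ψ y ω) v = _
    rw [Finset.sum_apply]
  · funext y
    -- Independence turns the product of means into one mean. The Möbius sum is divisible for each
    -- fixed `ω`, hence on average.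
    have h5 : ∑ o : OrderedFinpartition (k + 1), moebius o • ∏ B, (mean fun ω : Fin n → Ω => ∏ r,
        v (o.emb B r) (averagePoint b pt y ω (blockDirections J o B)) (J (o.emb B r))) =
        scale j ^ k * mean fun ω => ψ y ω v :=
      (Finset.sum_congr rfl fun o _ => congrArg (moebius o • ·) (prod_mean_eq hJ v y o)).trans
        ((mean_sum_zsmul _ _ _).symm.trans ((congrArg mean (funext fun ω => hv y ω v)).trans
          (mean_mul_left _ _)))
    refine (hL' v y).trans ?_
    rw [h5, mul_smul]
    rfl

end Divisibility

/-! ### Assembly of the algebras and morphisms -/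

section Assembly

variable {n N : ℕ}

theorem isBinaryQFTAlgebra_cochain (m : ℕ) :
    IsBinaryQFTAlgebra (cochainDeg ℚ⸨X⸩ n N m) signInv (deltaPrime n N m)
      (allowedOps n N m m) (scale m) where
  isInternal := isInternal_cochainDeg
  one_mem := cochainDeg_gradedComm.one_mem
  mul_mem := cochainDeg_gradedComm.mul_mem
  graded_comm := cochainDeg_gradedComm.comm
  sign_apply := signInv_apply_of_mem
  del_mem := deltaPrime_mem
  del_del := deltaPrime_comp_self
  map_cumulantMap := cochainDeg_gradedComm.map_cumulantMap
  coder_mem _ hx :=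
    cumulantCoderivation_mem_Sym cochainDeg_gradedComm signInv_apply_of_mem deltaPrime_mem hx
  coder_coproduct x _ := coproduct_cumulantCoderivation (signHom ℚ⸨X⸩ n N m) (deltaPrime n N m) x
  coder_coder x _ := cumulantCoderivation_comp_self deltaPrime_comp_self signInv_deltaPrime x
  bracket_divisible := bracket_divisible

/-- The map of symmetric coalgebras induced by an averaging map. -/
def symCumulantConj {i j : ℕ} {β : ACochain n N j →ₗ[ℚ⸨X⸩] ACochain n N i} (hβ : IsAverage β) :
    Sym (cochainDeg ℚ⸨X⸩ n N j) →ₗ[ℚ⸨X⸩] Sym (cochainDeg ℚ⸨X⸩ n N i) :=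
  (cumulantConj β).restrict fun _ ht =>
    cumulantConj_mem_Sym cochainDeg_gradedComm cochainDeg_gradedComm hβ.mem ht

theorem coe_symCumulantConj {i j : ℕ} {β : ACochain n N j →ₗ[ℚ⸨X⸩] ACochain n N i}
    (hβ : IsAverage β) (x : Sym (cochainDeg ℚ⸨X⸩ n N j)) :
    (symCumulantConj hβ x : TensorAlgebra ℚ⸨X⸩ (ACochain n N i)) = cumulantConj β x := rfl

theorem proj₁_symCumulantConj {i j : ℕ} {β : ACochain n N j →ₗ[ℚ⸨X⸩] ACochain n N i}
    (hβ : IsAverage β) (k : ℕ) (d : Fin (k + 1) → ℕ) (v : Fin (k + 1) → ACochain n N j)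
    (hv : ∀ a, v a ∈ cochainDeg ℚ⸨X⸩ n N j (d a)) :
    proj₁ ℚ⸨X⸩ (ACochain n N i) (symCumulantConj hβ (symWedge (cochainDeg ℚ⸨X⸩ n N j) d v hv)) =
      cumulant β d v :=
  proj₁_cumulantConj_wedge cochainDeg_gradedComm cochainDeg_gradedComm hβ.mem (Nat.succ_pos k) hv

theorem isBinaryQFTMorphism_symCumulantConj (hN : 0 < N) {i j : ℕ}
    {β : ACochain n N j →ₗ[ℚ⸨X⸩] ACochain n N i} (hβ : IsAverage β)
    (hdel : β ∘ₗ deltaPrime n N j = deltaPrime n N i ∘ₗ β) :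
    IsBinaryQFTMorphism (cochainDeg ℚ⸨X⸩ n N j) signInv (deltaPrime n N j)
      (cochainDeg ℚ⸨X⸩ n N i) signInv (deltaPrime n N i) (allowedOps n N i j) (scale j)
      (symCumulantConj hβ) where
  coalgebra x := by
    obtain ⟨z, hz⟩ := coproduct_mem_range _ x.2
    refine ⟨z, hz, ?_⟩
    rw [coe_symCumulantConj, coproduct_cumulantConj, ← hz, TensorProduct.map_map]
    rfl
  filtration _ _ hx := cumulantConj_mem_lengthLE _ hx
  intertwines x := ⟨⟨_, cumulantCoderivation_mem_Sym cochainDeg_gradedComm signInv_apply_of_mem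
    deltaPrime_mem x.2⟩, rfl, cumulantConj_cumulantCoderivation hβ.signInv_comm
      (fun v => LinearMap.congr_fun hdel v) x⟩
  degree k d v hv := by
    rw [proj₁_symCumulantConj]
    exact cumulant_mem cochainDeg_gradedComm cochainDeg_gradedComm hβ.mem hv
  divisible k d := by
    obtain ⟨φ, hφ, h⟩ := cumulant_divisible hN hβ k d
    exact ⟨φ, hφ, fun v hv => (proj₁_symCumulantConj hβ k d v hv).trans (h v hv)⟩

end Assembly

end LatticeQFT

end

open LatticeQFT in
theorem theorem7p10 (n N : ℕ) (hN : 0 < N) :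
    (∀ m, IsBinaryQFTAlgebra (cochainDeg ℚ⸨X⸩ n N m) signInv (deltaPrime n N m)
      (allowedOps n N m m) (scale m)) ∧
    (∀ m, (∀ d, ∀ f ∈ cochainDeg ℚ⸨X⸩ n N (m + 1) d,
        integration ℚ⸨X⸩ n N m f ∈ cochainDeg ℚ⸨X⸩ n N m d) ∧
      integration ℚ⸨X⸩ n N m ∘ₗ deltaPrime n N (m + 1) =
        deltaPrime n N m ∘ₗ integration ℚ⸨X⸩ n N m) ∧
    ∃ σ : ∀ ⦃i j : ℕ⦄, i ≤ j →
        (Sym (cochainDeg ℚ⸨X⸩ n N j) →ₗ[ℚ⸨X⸩] Sym (cochainDeg ℚ⸨X⸩ n N i)),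
      (∀ (i j : ℕ) (hij : i ≤ j) (x : Sym (cochainDeg ℚ⸨X⸩ n N j)),
        (σ hij x : TensorAlgebra ℚ⸨X⸩ (ACochain n N i)) =
          cumulantConj (integrationTo ℚ⸨X⸩ n N hij) x) ∧
      InverseSystem (fun (i j : ℕ) (hij : i ≤ j) => ⇑(σ hij)) ∧
      ∀ (i j : ℕ) (hij : i ≤ j),
        IsBinaryQFTMorphism (cochainDeg ℚ⸨X⸩ n N j) signInv (deltaPrime n N j)
          (cochainDeg ℚ⸨X⸩ n N i) signInv (deltaPrime n N i)
          (allowedOps n N i j) (scale j) (σ hij) ∧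
        ∀ (k : ℕ) (d : Fin (k + 1) → ℕ) (v : Fin (k + 1) → ACochain n N j)
          (hv : ∀ a, v a ∈ cochainDeg ℚ⸨X⸩ n N j (d a)),
          proj₁ ℚ⸨X⸩ (ACochain n N i) (σ hij (symWedge (cochainDeg ℚ⸨X⸩ n N j) d v hv)) =
            cumulant (integrationTo ℚ⸨X⸩ n N hij) d v := by
  refine ⟨isBinaryQFTAlgebra_cochain, fun m => ⟨(isAverage_integration m).mem,
    integration_deltaPrime hN⟩, fun i j hij => symCumulantConj (isAverage_integrationTo hij),
    fun i j hij x => rfl, ⟨fun i x => Subtype.ext ?_, fun i j l hij hjl x => Subtype.ext ?_⟩,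
    fun i j hij => ⟨isBinaryQFTMorphism_symCumulantConj hN _ (integrationTo_deltaPrime hN hij),
      fun k d v hv => proj₁_symCumulantConj _ k d v hv⟩⟩
  · rw [coe_symCumulantConj, integrationTo_self, cumulantConj_id]
  · rw [coe_symCumulantConj, coe_symCumulantConj, cumulantConj_comp, integrationTo_comp,
      coe_symCumulantConj]
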